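/- Let $\Bbbk$ be a field, $A=\Bbbk[x_1,\dots,x_n]$ with the standard grading, $\mathfrak a\subseteq A$ a homogeneous ideal and $R=A/\mathfrak a$. Let $t$ be a positive integer or $\infty$, $B=A[z]$ (standard graded) and $S=R[z]/(z^t)=B/(\mathfrak aB+(z^t))$, where $z^\infty=0$. For a homogeneous ideal $I$ of $R$ or of $S$, $H_I$ denotes the Hilbert series of $I$ itself (not of the quotient); Hilbert series are ordered coefficientwise, $H\succcurlyeq H'$ meaning that every coefficient of $H$ is at least that of $H'$. Let $\mathcal I_R$, $\mathcal I_S$ be the posets of homogeneous ideals of $R$, $S$ under inclusion, and $\mathcal H_R=\{H_I : I\in\mathcal I_R\}$. Let $\beta^A_{i,j}(M)=\dim_\Bbbk \mathrm{Tor}^A_i(M,\Bbbk)_j$, and similarly over $B$. For an ideal $J$ of $S$ and an integer $0\le i<t$ let $J_{\langle i\rangle}=(J:_Sz^i)\cap R$. The ideal $J$ is $z$-stable if it is homogeneous for the grading of $S$ by $\mathbb N^2$ with $\deg x_l=(1,0)$, $\deg z=(0,1)$, and $\mathfrak m_RJ_{\langle i\rangle}\subseteq J_{\langle i-1\rangle}$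 for all $0<i<t$, where $\mathfrak m_R=(x_1,\dots,x_n)R$. Let $\mathcal H_S^{\mathrm{stab}}=\{H_J : J\text{ a }z\text{-stable ideal of }S\}$. Let $\epsilon_R:\mathcal H_R\hookrightarrow\mathcal I_R$ be an embedding of posets with $H_{\epsilon_R(H)}=H$ for all $H\in\mathcal H_R$, and suppose that $\beta^A_{i,j}(R/I)\le\beta^A_{i,j}(R/\epsilon_R(H_I))$ for all homogeneous ideals $I$ of $R$ and all $i,j$. Then there is exactly one embedding of posets $\epsilon_S:\mathcal H_S^{\mathrm{stab}}\hookrightarrow\mathcal I_S$ (the embedding induced by $\epsilon_R$) such that 1. $H_{\epsilon_S(H)}=H$ for all $H\in\mathcal H_S^{\mathrm{stab}}$; 2. for every $H\in\mathcal H_S^{\mathrm{stab}}$, the ideal $L=\epsilon_S(H)$ is $z$-stable, and $L_{\langle i\rangle}$ is in the image of $\epsilon_R$ for all $0\le i<t$; 3. for every $z$-stable ideal $J$ of $S$, with $L=\epsilon_S(H_J)$, one has $H_{J+(z^i)}\succcurlyeq H_{L+(z^i)}$ for all integers $0\le i<t$. Moreover, for every $z$-stable ideal $J$ of $S$ and all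 $i,j$, $$\beta^B_{i,j}(S/J)\le\beta^B_{i,j}(S/\epsilon_S(H_J)).$$ -/

import Mathlib

noncomputable section

namespace PosetEmbedding

open MvPolynomial

attribute [local instance] MvPolynomial.gradedAlgebra MvPolynomial.weightedGradedAlgebra

/-- A homogeneous ideal of the standard graded polynomial ring `k[x_1, …, x_n]`. -/
abbrev IsHomog {k : Type*} [Field k] {n : ℕ} (I : Ideal (MvPolynomial (Fin n) k)) : Prop :=
  I.IsHomogeneous (homogeneousSubmodule (Fin n) k)

/-! ### Standard graded algebras, homogeneous ideals and Hilbert series -/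

section Graded

variable (k : Type*) [Field k] (n : ℕ)

/-- The degree `d` component of a standard graded algebra `Q` presented by a polynomial ring
`A = k[x_1, …, x_n]`: the image of the forms of degree `d`. -/
def component (Q : Type*) [CommRing Q] [Algebra k Q] [Algebra (MvPolynomial (Fin n) k) Q]
    [IsScalarTower k (MvPolynomial (Fin n) k) Q] (d : ℕ) : Submodule k Q :=
  (homogeneousSubmodule (Fin n) k d).map
    (IsScalarTower.toAlgHom k (MvPolynomial (Fin n) k) Q).toLinearMap

variable {k n}

/-- The Hilbert series `H_I` of an ideal `I` of `A/𝔞` (not of the quotient by `I`), given by its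
coefficients: `hilb I d = dim_k I_d`.  Sequences are compared coefficientwise. -/
def hilb {𝔞 : Ideal (MvPolynomial (Fin n) k)} (I : Ideal (MvPolynomial (Fin n) k ⧸ 𝔞)) :
    ℕ → ℕ := fun d =>
  Module.finrank k
    ↥(I.restrictScalars k ⊓ component k n (MvPolynomial (Fin n) k ⧸ 𝔞) d : Submodule k _)

/-- The poset of homogeneous ideals of `A/𝔞` (for a homogeneous ideal `𝔞`), ordered by inclusion.
An ideal of `A/𝔞` is homogeneous iff its preimage in `A` is. -/
abbrev HomogIdeal (𝔞 : Ideal (MvPolynomial (Fin n) k)) :=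
  {I : Ideal (MvPolynomial (Fin n) k ⧸ 𝔞) //
    IsHomog (I.comap (Ideal.Quotient.mk 𝔞))}

/-- The set of Hilbert series of homogeneous ideals of `A/𝔞`, with the coefficientwise order
inherited from `ℕ → ℕ`. -/
def hilbPoset (𝔞 : Ideal (MvPolynomial (Fin n) k)) : Set (ℕ → ℕ) :=
  {H | ∃ I : HomogIdeal 𝔞, hilb I.1 = H}

/-- `H ∘ ε = id` for a map `ε` from a set of Hilbert series to the homogeneous ideals. -/
def IsSection {𝔞 : Ideal (MvPolynomial (Fin n) k)} {P : Set (ℕ → ℕ)}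
    (ε : P ↪o HomogIdeal 𝔞) : Prop :=
  ∀ H : P, hilb (ε H).1 = H.1

/-- The ideal of `A/𝔞` generated by the variables, i.e. the homogeneous maximal ideal. -/
def maxIdeal (𝔞 : Ideal (MvPolynomial (Fin n) k)) : Ideal (MvPolynomial (Fin n) k ⧸ 𝔞) :=
  Ideal.span (Set.range fun i : Fin n => Ideal.Quotient.mk 𝔞 (X i))

end Graded

/-! ### The extension `S = R[z]/(z^t)` -/

section Extension

variable {k : Type*} [Field k] {n : ℕ}

/-- The ideal `𝔞B + (z^t)` of `B = A[z]`; the variable `z` is `X 0` and the variable `x_i` of `A`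
becomes `X i.succ`.  For `t = ⊤` there is no power of `z` (that is, `z^∞ = 0`). -/
def extIdeal (𝔞 : Ideal (MvPolynomial (Fin n) k)) (t : ℕ∞) :
    Ideal (MvPolynomial (Fin (n + 1)) k) :=
  𝔞.map (rename (R := k) Fin.succ) ⊔
    Ideal.span {p | ∃ m : ℕ, t = (m : ℕ∞) ∧ p = X 0 ^ m}

/-- The ring `S = R[z]/(z^t) = B/(𝔞B + (z^t))`, where `R = A/𝔞`. -/
abbrev ExtRing (𝔞 : Ideal (MvPolynomial (Fin n) k)) (t : ℕ∞) :=
  MvPolynomial (Fin (n + 1)) k ⧸ extIdeal 𝔞 t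

variable {𝔞 : Ideal (MvPolynomial (Fin n) k)} {t : ℕ∞}

/-- The natural map `R → S`. -/
def baseMap (𝔞 : Ideal (MvPolynomial (Fin n) k)) (t : ℕ∞) :
    (MvPolynomial (Fin n) k ⧸ 𝔞) →+* ExtRing 𝔞 t :=
  Ideal.quotientMap (extIdeal 𝔞 t) (rename (R := k) Fin.succ).toRingHom
    (Ideal.map_le_iff_le_comap.mp le_sup_left)

/-- The class of `z` in `S`. -/
def zElt (𝔞 : Ideal (MvPolynomial (Fin n) k)) (t : ℕ∞) : ExtRing 𝔞 t :=
  Ideal.Quotient.mk (extIdeal 𝔞 t) (X 0)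

/-- The ideal `J_⟨i⟩ = (J :_S z^i) ∩ R` of `R`. -/
def slice (J : Ideal (ExtRing 𝔞 t)) (i : ℕ) : Ideal (MvPolynomial (Fin n) k ⧸ 𝔞) :=
  (Submodule.colon J {zElt 𝔞 t ^ i}).comap (baseMap 𝔞 t)

/-- The bidegrees of the variables of `B`: `deg x_i = (1,0)` and `deg z = (0,1)`. -/
def bidegree (n : ℕ) : Fin (n + 1) → ℕ × ℕ := Fin.cons (0, 1) fun _ => (1, 0)

/-- `J` is multigraded: homogeneous for the grading of `S` by `ℕ × ℕ`. -/
def Multigraded (J : Ideal (ExtRing 𝔞 t)) : Prop :=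
  (J.comap (Ideal.Quotient.mk (extIdeal 𝔞 t))).IsHomogeneous
    (weightedHomogeneousSubmodule k (bidegree n))

/-- `J` is `z`-stable: it is multigraded and `𝔪_R J_⟨i⟩ ⊆ J_⟨i-1⟩` for all `0 < i < t`. -/
def ZStable (J : Ideal (ExtRing 𝔞 t)) : Prop :=
  Multigraded J ∧
    ∀ i : ℕ, 0 < i → (i : ℕ∞) < t → maxIdeal 𝔞 * slice J i ≤ slice J (i - 1)

/-- The set of Hilbert series (for the standard grading of `S`) of `z`-stable ideals of `S`. -/
def stabHilbPoset (𝔞 : Ideal (MvPolynomial (Fin n) k)) (t : ℕ∞) : Set (ℕ → ℕ) :=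
  {H | ∃ J : Ideal (ExtRing 𝔞 t), ZStable J ∧ hilb J = H}

/-- The Hilbert series of a `z`-stable ideal, as an element of the poset of those series. -/
def stabHilb (J : Ideal (ExtRing 𝔞 t)) (hJ : ZStable J) : stabHilbPoset 𝔞 t :=
  ⟨hilb J, J, hJ, rfl⟩

/-- The properties that characterize the embedding `ε_S` of the poset of Hilbert series of
`z`-stable ideals of `S` induced by an embedding `ε_R` for `R`: it is a section of the Hilbert
series map; its values are `z`-stable (in particular multigraded) ideals `L` all of whose
slices `L_⟨i⟩` are in the image of `ε_R`; and `H_{J + (z^i)} ≽ H_{L + (z^i)}` for all `i < t`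
whenever `J` is `z`-stable and `L = ε_S(H_J)`. -/
structure IsInduced (εR : hilbPoset 𝔞 ↪o HomogIdeal 𝔞)
    (εS : stabHilbPoset 𝔞 t ↪o HomogIdeal (extIdeal 𝔞 t)) : Prop where
  isSection : IsSection εS
  zStable : ∀ H, ZStable (εS H).1
  slice_mem_range : ∀ H, ∀ i : ℕ, (i : ℕ∞) < t → ∃ H' : hilbPoset 𝔞,
    (εR H').1 = slice (εS H).1 i
  restriction : ∀ (J : Ideal (ExtRing 𝔞 t)) (hJ : ZStable J), ∀ i : ℕ, (i : ℕ∞) < t →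
    hilb ((εS (stabHilb J hJ)).1 ⊔ Ideal.span {zElt 𝔞 t ^ i}) ≤
      hilb (J ⊔ Ideal.span {zElt 𝔞 t ^ i})

end Extension

/-! ### Graded Betti numbers

`Tor_i^A(M, k)` is the `i`-th homology of `M ⊗_A K`, for a graded free resolution `K` of `k`
over `A = k[x_1, …, x_n]`.  We take for `K` the Koszul complex on the variables; the basis element
`e_T` of `K`, `T ⊆ {1, …, n}`, has homological degree and internal degree `|T|`.  That this is a
complex, and a resolution of `k`, is proved in `koszulD_koszulD`, `koszul_exact` and
`koszul_augmentation`. -/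

section Betti

variable {k : Type*} [Field k] {n : ℕ}

/-- The sign `(-1)^{#{l ∈ T : l < j}}`. -/
def koszulSign (j : Fin n) (T : Finset (Fin n)) : ℤ := (-1) ^ (T.filter (· < j)).card

variable (k n) in
/-- The differential of `M ⊗_A K`, on all homological degrees at once: the element
`∑_T f(T) ⊗ e_T` is written as `f`, and `∂(m ⊗ e_U) = ∑_{j ∈ U} ± x_j m ⊗ e_{U \ j}`. -/
def koszulD (M : Type*) [AddCommGroup M] [Module (MvPolynomial (Fin n) k) M] :
    (Finset (Fin n) → M) →ₗ[MvPolynomial (Fin n) k] (Finset (Fin n) → M) where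
  toFun f T := ∑ j ∈ Tᶜ, koszulSign j T • (X j : MvPolynomial (Fin n) k) • f (insert j T)
  map_add' f g := by
    funext T
    simp [smul_add, Finset.sum_add_distrib]
  map_smul' a f := by
    funext T
    simp only [Pi.smul_apply, RingHom.id_apply, Finset.smul_sum]
    refine Finset.sum_congr rfl fun j _ => ?_
    rw [smul_comm a, smul_smul, smul_smul, mul_comm]

theorem koszulD_apply {M : Type*} [AddCommGroup M] [Module (MvPolynomial (Fin n) k) M]
    (f : Finset (Fin n) → M) (T : Finset (Fin n)) :
    koszulD k n M f T =
      ∑ j ∈ Tᶜ, koszulSign j T • (X j : MvPolynomial (Fin n) k) • f (insert j T) := rfl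

theorem koszulSign_insert {j l : Fin n} {T : Finset (Fin n)} (hl : l ∉ T) :
    koszulSign j (insert l T) = if l < j then -koszulSign j T else koszulSign j T := by
  unfold koszulSign
  rw [Finset.filter_insert]
  split_ifs with h
  · rw [Finset.card_insert_of_notMem (by simp [hl]), pow_succ]; ring
  · rfl

/-- The Koszul differential squares to zero. -/
theorem koszulD_koszulD {M : Type*} [AddCommGroup M] [Module (MvPolynomial (Fin n) k) M]
    (f : Finset (Fin n) → M) : koszulD k n M (koszulD k n M f) = 0 := by
  funext T
  simp only [koszulD_apply, Finset.smul_sum, Pi.zero_apply]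
  rw [Finset.sum_sigma']
  refine Finset.sum_involution (fun p _ => ⟨p.2, p.1⟩) ?_ ?_ ?_ ?_
  · rintro ⟨j, l⟩ h
    simp only [Finset.mem_sigma, Finset.mem_compl, Finset.mem_insert, not_or] at h
    obtain ⟨hj, hlj, hl⟩ := h
    dsimp only
    rw [koszulSign_insert hj, koszulSign_insert hl, Finset.insert_comm l j T,
      smul_comm (X j : MvPolynomial (Fin n) k), smul_comm (X l : MvPolynomial (Fin n) k),
      smul_smul (X l : MvPolynomial (Fin n) k), smul_smul (X j : MvPolynomial (Fin n) k),
      mul_comm (X l : MvPolynomial (Fin n) k), smul_smul, smul_smul, ← add_smul]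
    rcases lt_or_gt_of_ne hlj with h | h
    · rw [if_neg h.asymm, if_pos h]
      convert zero_smul ℤ _ using 2
      ring
    · rw [if_pos h, if_neg h.asymm]
      convert zero_smul ℤ _ using 2
      ring
  · rintro ⟨j, l⟩ h _ he
    simp only [Finset.mem_sigma, Finset.mem_compl, Finset.mem_insert, not_or] at h
    simp only [Sigma.mk.injEq, heq_eq_eq] at he
    exact h.2.1 he.1
  · rintro ⟨j, l⟩ h
    simp only [Finset.mem_sigma, Finset.mem_compl, Finset.mem_insert, not_or] at h ⊢
    exact ⟨h.2.2, fun e => h.2.1 e.symm, h.1⟩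
  · rintro ⟨j, l⟩ h
    rfl

/-- A contraction of the Koszul complex: on the monomial `x^a e_T` with `m = min (supp a ∪ T)`,
it is `x^{a - e_m} e_{T ∪ m}` if `m ∉ T` and zero otherwise. -/
def koszulHomotopy (f : Finset (Fin n) → MvPolynomial (Fin n) k) (T : Finset (Fin n)) :
    MvPolynomial (Fin n) k :=
  if h : T.Nonempty then
    let m := T.min' h
    let p := f (T.erase m)
    ∑ b ∈ p.support.filter (fun b => 0 < b m ∧ ∀ l < m, b l = 0),
      monomial (b - Finsupp.single m 1) (coeff b p)
  else 0

theorem coeff_koszulHomotopy (f : Finset (Fin n) → MvPolynomial (Fin n) k)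
    {T : Finset (Fin n)} {m : Fin n} (hm : m ∈ T) (hmin : ∀ l ∈ T, m ≤ l) (a : Fin n →₀ ℕ) :
    coeff a (koszulHomotopy f T) =
      if ∀ l < m, a l = 0 then coeff (a + Finsupp.single m 1) (f (T.erase m)) else 0 := by
  have hT : T.Nonempty := ⟨m, hm⟩
  have hm' : T.min' hT = m := le_antisymm (Finset.min'_le _ _ hm) (hmin _ (Finset.min'_mem _ _))
  simp only [koszulHomotopy, dif_pos hT, hm', coeff_sum, coeff_monomial]
  split_ifs with hc
  · rw [Finset.sum_eq_single (a + Finsupp.single m 1)]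
    · simp
    · rintro b hb hne
      simp only [Finset.mem_filter] at hb
      rw [if_neg]
      rintro rfl
      refine hne (tsub_add_cancel_of_le ?_).symm
      rw [Finsupp.single_le_iff]
      exact hb.2.1
    · intro hb
      simp only [Finset.mem_filter, mem_support_iff, not_and] at hb
      by_cases h0 : coeff (a + Finsupp.single m 1) (f (T.erase m)) = 0
      · simp [h0]
      · exact (hb h0 (by simp) fun l hl => by simp [hc l hl, hl.ne']).elim
  · refine Finset.sum_eq_zero fun b hb => ?_
    simp only [Finset.mem_filter] at hb
    rw [if_neg]
    rintro rfl
    refine hc fun l hl => ?_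
    simp [hb.2.2 l hl]

theorem coeff_koszulD (f : Finset (Fin n) → MvPolynomial (Fin n) k) (T : Finset (Fin n))
    (a : Fin n →₀ ℕ) :
    coeff a (koszulD k n _ f T) = ∑ j ∈ Tᶜ, koszulSign j T •
      if a j = 0 then 0 else coeff (a - Finsupp.single j 1) (f (insert j T)) := by
  rw [koszulD_apply, coeff_sum]
  refine Finset.sum_congr rfl fun j _ => ?_
  rw [coeff_smul, smul_eq_mul, coeff_X_mul']
  by_cases h : a j = 0 <;> simp [h]

theorem koszulSign_eq_one {j : Fin n} {T : Finset (Fin n)} (h : ∀ l ∈ T, j ≤ l) :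
    koszulSign j T = 1 := by
  unfold koszulSign
  rw [Finset.filter_false_of_mem fun l hl => (h l hl).not_gt]
  simp

theorem koszul_homotopy (f : Finset (Fin n) → MvPolynomial (Fin n) k) (T : Finset (Fin n))
    (a : Fin n →₀ ℕ) (h : T.Nonempty ∨ a ≠ 0) :
    coeff a (koszulD k n _ (koszulHomotopy f) T) + coeff a (koszulHomotopy (koszulD k n _ f) T) =
      coeff a (f T) := by
  obtain ⟨m, hm, hmin⟩ : ∃ m, (m ∈ T ∨ a m ≠ 0) ∧ ∀ l, (l ∈ T ∨ a l ≠ 0) → m ≤ l := by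
    have hU : (T ∪ a.support).Nonempty := by
      rcases h with h | h
      · exact h.mono Finset.subset_union_left
      · exact (Finsupp.support_nonempty_iff.mpr h).mono Finset.subset_union_right
    refine ⟨(T ∪ a.support).min' hU, ?_, fun l hl => ?_⟩
    · simpa using Finset.min'_mem _ hU
    · exact Finset.min'_le _ _ (by simpa using hl)
  have hlow : ∀ l < m, a l = 0 := fun l hl => by
    by_contra h0
    exact (hmin l (Or.inr h0)).not_gt hl
  by_cases hmT : m ∈ T
  · rw [coeff_koszulHomotopy _ hmT (fun l hl => hmin l (Or.inl hl)), if_pos hlow,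
      coeff_koszulD, coeff_koszulD, Finset.compl_erase,
      Finset.sum_insert (by simpa using hmT), koszulSign_eq_one
        (fun l hl => hmin l (Or.inl (Finset.mem_of_mem_erase hl))), Finset.insert_erase hmT,
      add_left_comm, ← Finset.sum_add_distrib, Finset.sum_eq_zero, add_zero]
    · simp
    · intro j hj
      rw [Finset.mem_compl] at hj
      have hjm : j ≠ m := fun e => hj (e ▸ hmT)
      by_cases h0 : a j = 0
      · simp [h0, hjm.symm]
      · have hlt : m < j := lt_of_le_of_ne (hmin j (Or.inr h0)) hjm.symm
        have hs : koszulSign j T = -koszulSign j (T.erase m) := by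
          conv_lhs => rw [← Finset.insert_erase hmT]
          rw [koszulSign_insert (Finset.notMem_erase m T), if_pos hlt]
        have hs' : Finsupp.single j 1 ≤ a := by
          rw [Finsupp.single_le_iff]
          exact Nat.one_le_iff_ne_zero.mpr h0
        rw [if_neg h0, if_neg (by simp [h0]), hs,
          coeff_koszulHomotopy f (m := m) (by simp [hmT]), if_pos, neg_smul,
          Finset.erase_insert_of_ne hjm, tsub_add_eq_add_tsub hs']
        · exact neg_add_cancel _
        · intro l hl
          simp [hlow l hl]
        · intro l hl
          rcases Finset.mem_insert.mp hl with rfl | hl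
          · exact hlt.le
          · exact hmin l (Or.inl hl)
  · have ham : a m ≠ 0 := hm.resolve_left hmT
    have h2 : coeff a (koszulHomotopy (koszulD k n _ f) T) = 0 := by
      by_cases hT : T.Nonempty
      · rw [coeff_koszulHomotopy _ (Finset.min'_mem T hT) (fun l hl => Finset.min'_le _ _ hl),
          if_neg]
        intro hc
        refine ham (hc m (lt_of_le_of_ne (hmin _ (Or.inl (Finset.min'_mem T hT))) ?_))
        intro e
        exact hmT (e ▸ Finset.min'_mem T hT)
      · simp [koszulHomotopy, hT]
    have hs' : Finsupp.single m 1 ≤ a := by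
      rw [Finsupp.single_le_iff]
      exact Nat.one_le_iff_ne_zero.mpr ham
    rw [h2, add_zero, coeff_koszulD, Finset.sum_eq_single m]
    · rw [if_neg ham, koszulSign_eq_one (fun l hl => hmin l (Or.inl hl)),
        coeff_koszulHomotopy f (m := m) (by simp), if_pos, Finset.erase_insert hmT,
        tsub_add_cancel_of_le hs', one_smul]
      · intro l hl
        simp [hlow l hl]
      · intro l hl
        rcases Finset.mem_insert.mp hl with rfl | hl
        · exact le_rfl
        · exact hmin l (Or.inl hl)
    · intro j hj hjm
      rw [Finset.mem_compl] at hj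
      by_cases h0 : a j = 0
      · simp [h0]
      · have hT : (insert j T).Nonempty := Finset.insert_nonempty j T
        rw [if_neg h0, coeff_koszulHomotopy f (Finset.min'_mem _ hT)
          (fun l hl => Finset.min'_le _ _ hl), if_neg, smul_zero]
        intro hc
        have hne : m ∉ insert j T := by simp [hmT, hjm.symm]
        have hlt : m < (insert j T).min' hT := by
          refine lt_of_le_of_ne ?_ fun e => hne (e ▸ Finset.min'_mem _ hT)
          rcases Finset.mem_insert.mp (Finset.min'_mem _ hT) with e | e
          · rw [e]; exact hmin j (Or.inr h0)
          · exact hmin _ (Or.inl e)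
        have := hc m hlt
        simp [hjm] at this
        exact ham this
    · intro h'
      exact absurd (Finset.mem_compl.mpr hmT) h'

/-- The Koszul complex `K` over `A` is exact in positive homological degrees. -/
theorem koszul_exact {i : ℕ} (hi : 0 < i) (f : Finset (Fin n) → MvPolynomial (Fin n) k)
    (hf : ∀ T, T.card ≠ i → f T = 0) (hd : koszulD k n _ f = 0) :
    ∃ g : Finset (Fin n) → MvPolynomial (Fin n) k,
      (∀ T, T.card ≠ i + 1 → g T = 0) ∧ koszulD k n _ g = f := by
  refine ⟨koszulHomotopy f, fun T hT => ?_, ?_⟩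
  · by_cases h : T.Nonempty
    · have hz : f (T.erase (T.min' h)) = 0 := by
        refine hf _ fun e => hT ?_
        rw [← e, Finset.card_erase_add_one (Finset.min'_mem T h)]
      simp [koszulHomotopy, h, hz]
    · simp [koszulHomotopy, h]
  · funext T
    ext a
    by_cases h : T.Nonempty ∨ a ≠ 0
    · rw [← koszul_homotopy f T a h, hd]
      have : coeff a (koszulHomotopy (0 : Finset (Fin n) → MvPolynomial (Fin n) k) T) = 0 := by
        simp [koszulHomotopy]
      rw [this, add_zero]
    · push Not at h
      obtain ⟨rfl, rfl⟩ := h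
      rw [coeff_koszulD, hf ∅ (by simpa using hi.ne)]
      simp

/-- The zeroth homology of `K` is `k = A/(x_1, …, x_n)`. -/
theorem koszul_augmentation (p : MvPolynomial (Fin n) k) :
    p ∈ Ideal.span (Set.range (X : Fin n → MvPolynomial (Fin n) k)) ↔
      ∃ g : Finset (Fin n) → MvPolynomial (Fin n) k,
        (∀ T, T.card ≠ 1 → g T = 0) ∧ koszulD k n _ g ∅ = p := by
  constructor
  · intro hp
    obtain ⟨c, hc⟩ := (Submodule.mem_span_range_iff_exists_fun _).mp hp
    refine ⟨fun T => ∑ j, if T = {j} then c j else 0, fun T hT => ?_, ?_⟩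
    · refine Finset.sum_eq_zero fun j _ => if_neg ?_
      rintro rfl
      exact hT (by simp)
    · rw [koszulD_apply, ← hc, Finset.compl_empty]
      refine Finset.sum_congr rfl fun j _ => ?_
      rw [koszulSign_eq_one (by simp), one_smul]
      simp [Finset.singleton_inj, mul_comm]
  · rintro ⟨g, -, rfl⟩
    rw [koszulD_apply]
    refine Ideal.sum_mem _ fun j _ => ?_
    refine Submodule.smul_of_tower_mem _ _ ?_
    rw [smul_eq_mul]
    exact Ideal.mul_mem_right _ _ (Ideal.subset_span ⟨j, rfl⟩)

section Module

variable {M : Type*} [AddCommGroup M] [Module k M] [Module (MvPolynomial (Fin n) k) M]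
  [IsScalarTower k (MvPolynomial (Fin n) k) M]

/-- `(M ⊗_A K_i)_j`, which is the direct sum of copies of `M_{j-i}` indexed by the subsets `T`
with `i` elements, for the graded module `M = ⨁_d 𝓜 d`. -/
def koszulChains (𝓜 : ℕ → Submodule k M) (i j : ℕ) : Submodule k (Finset (Fin n) → M) :=
  Submodule.pi Set.univ fun T => if T.card = i ∧ i ≤ j then 𝓜 (j - i) else ⊥

/-- The cycles in `(M ⊗_A K_i)_j`. -/
def koszulCycles (𝓜 : ℕ → Submodule k M) (i j : ℕ) : Submodule k (Finset (Fin n) → M) :=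
  koszulChains 𝓜 i j ⊓ LinearMap.ker ((koszulD k n M).restrictScalars k)

/-- The boundaries in `(M ⊗_A K_i)_j`. -/
def koszulBoundaries (𝓜 : ℕ → Submodule k M) (i j : ℕ) : Submodule k (Finset (Fin n) → M) :=
  (koszulChains 𝓜 (i + 1) j).map ((koszulD k n M).restrictScalars k)

/-- The graded Betti number `β_{i,j}^A(M) = dim_k Tor_i^A(M, k)_j` of the graded module
`M = ⨁_d 𝓜 d` over `A = k[x_1, …, x_n]`. -/
def gradedBetti (𝓜 : ℕ → Submodule k M) (i j : ℕ) : ℕ :=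
  Module.finrank k
    (↥(koszulCycles (n := n) 𝓜 i j) ⧸
      (koszulBoundaries (n := n) 𝓜 i j).submoduleOf (koszulCycles 𝓜 i j))

end Module

/-- `β_{i,j}^A(R/I)` for an ideal `I` of `R = A/𝔞`. -/
def bettiQuot {𝔞 : Ideal (MvPolynomial (Fin n) k)} (I : Ideal (MvPolynomial (Fin n) k ⧸ 𝔞))
    (i j : ℕ) : ℕ :=
  gradedBetti (n := n) (component k n ((MvPolynomial (Fin n) k ⧸ 𝔞) ⧸ I)) i j

end Betti

end PosetEmbedding

end

/-!
A multigraded ideal `J` of `S` is the same as an increasing family of homogeneous ideals of `R`, its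
slices `J_⟨i⟩`, `i < t`; here they are handled through their preimages `sliceIdeal J i` in `A`. So
`dim J_D = ∑ i, dim (J_⟨i⟩)_{D-i}`, and `J` is `z`-stable iff moreover each slice multiplied by a
variable of `A` lies in the slice before it.

*Numerical conditions.* Let `growth 𝔞 d v` be the least dimension in degree `d + 1` of an ideal of
`R` whose dimension in degree `d` is at least `v`. As `ε_R` is an embedding of posets, the piece of
`ε_R(H)` in degree `d` depends only on `H d`, and monotonically so (`gradedPiece_epsIdeal_le`:
compare `H` with the Hilbert series of truncations). Hence the Hilbert series of ideals of `R` are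
characterized by their growth in each degree, and a variable takes the degree `d` piece of `ε_R(H)`
into `ε_R(H')` as soon as `growth 𝔞 d (H d) ≤ H' (d + 1)`. This turns the question of which
`z`-stable ideals have all their slices in the image of `ε_R` into one about the vectors `i ↦ dim
(J_⟨i⟩)_{D-i}`. For a `z`-stable `J` these are `Admissible`: each entry bounds the growth of the
next one.

*Existence and uniqueness.* Among the admissible vectors of a given sum there is a `Greedy` one, as
large as possible in the high `z`-degrees (`exists_greedy`). Greedy vectors of different sums are
comparable, they minimize all partial sums, and the ideal generated by a greedy piece is greedy
(`Greedy.shiftVector`). Thus the ideals attached by `ε_R` to the greedy vectors with sums `H D` are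
the slices of an ideal `ε_S(H)` (`exists_ideal_of_sliceSeries`). The Hilbert series of `J + (z^s)`
records the partial sums of the dimension vectors, so that the last condition on `ε_S` says that the
partial sums for `ε_S(H_J)` are at most those for `J`; this determines the Hilbert series of the
slices of `ε_S(H)`, and with them `ε_S(H)`.

*Betti numbers.* `Tor^B(S/J, k)` is the homology of the mapping cone of `z` on the Koszul complex
over `A` with coefficients in `M = S/J` (`koszulD_glue`). Over `A`, `M = R/J_⟨0⟩ ⊕ zM`, and
stability gives that the kernel of `z` is the direct sum of `(R/J_⟨t-1⟩) z^(t-1)`, which is absent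
if `t = ∞`, and of a module killed by the variables of `A` (`ZSplitting`). So, in positive
homological degrees, the Betti numbers of `S/J` are the sum of those of `R/J_⟨0⟩`, of those of the
shifted `R/J_⟨t-1⟩`, and of a number given by dimensions (`ZSplitting.gradedBetti_eq`). Let now `L =
ε_S(H_J)`. By the inequalities of partial sums, the first slice of `J` has a larger Hilbert series
than that of `L`, and the last slice a smaller one. Replacing the slices of `J` by their images
under `ε_R` does not lower the Betti numbers, by the hypothesis on `ε_R`; these images contain,
resp. are contained in, the slices of `L`. Finally, estimating the ranks of the Koszul differentials
in a quotient (`gradedBetti_le_of_map`, `gradedBetti_succ_le_of_map`) compares the Betti numbers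
with those for the slices of `L`, up to differences of dimensions of Koszul chains. These
differences cancel in the sum, because `S/J` and `S/L` have the same Hilbert series.
-/

noncomputable section

namespace PosetEmbedding

open MvPolynomial Module

attribute [local instance] MvPolynomial.gradedAlgebra MvPolynomial.weightedGradedAlgebra

/-! ### Graded pieces of ideals and Hilbert series -/

theorem finrank_map_add_finrank_inf_ker {K V W : Type*} [Field K] [AddCommGroup V] [Module K V]
    [AddCommGroup W] [Module K W] (f : V →ₗ[K] W) (U : Submodule K V) [Module.Finite K U] :
    finrank K (U.map f) + finrank K ↥(U ⊓ LinearMap.ker f) = finrank K U := by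
  have h := (f.domRestrict U).finrank_range_add_finrank_ker
  rw [LinearMap.range_domRestrict, LinearMap.ker_domRestrict] at h
  rw [← h, inf_comm]
  congr 1
  refine (Submodule.submoduleOfEquivOfLe
    (inf_le_right : LinearMap.ker f ⊓ U ≤ U)).finrank_eq.symm.trans ?_
  rw [Submodule.submoduleOf, Submodule.comap_inf, Submodule.comap_subtype_self, inf_top_eq]

section GradedPieces

variable {k : Type*} [Field k] {n : ℕ}

/-- The degree `d` component `I_d` of a homogeneous ideal `I` of the polynomial ring. -/
def gradedPiece (I : Ideal (MvPolynomial (Fin n) k)) (d : ℕ) :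
    Submodule k (MvPolynomial (Fin n) k) :=
  I.restrictScalars k ⊓ homogeneousSubmodule (Fin n) k d

theorem mem_gradedPiece {I : Ideal (MvPolynomial (Fin n) k)} {d : ℕ}
    {p : MvPolynomial (Fin n) k} : p ∈ gradedPiece I d ↔ p ∈ I ∧ p.IsHomogeneous d := Iff.rfl

instance finite_homogeneousSubmodule (d : ℕ) :
    Module.Finite k (homogeneousSubmodule (Fin n) k d) :=
  Module.Finite.iff_fg.mpr (homogeneousSubmodule_fg _ _ d)

instance finite_gradedPiece (I : Ideal (MvPolynomial (Fin n) k)) (d : ℕ) :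
    Module.Finite k (gradedPiece I d) :=
  Submodule.finiteDimensional_of_le (inf_le_right : _ ≤ homogeneousSubmodule (Fin n) k d)

theorem gradedPiece_mono {I J : Ideal (MvPolynomial (Fin n) k)} (h : I ≤ J) (d : ℕ) :
    gradedPiece I d ≤ gradedPiece J d := fun _ hp => ⟨h hp.1, hp.2⟩

theorem X_mul_mem_gradedPiece {I : Ideal (MvPolynomial (Fin n) k)} {d : ℕ}
    {p : MvPolynomial (Fin n) k} (l : Fin n) (hp : p ∈ gradedPiece I d) :
    X l * p ∈ gradedPiece I (d + 1) :=
  ⟨I.mul_mem_left _ hp.1, by simpa [add_comm] using (isHomogeneous_X k l).mul hp.2⟩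

theorem homogeneousComponent_homogeneousComponent (d e : ℕ) (p : MvPolynomial (Fin n) k) :
    homogeneousComponent d (homogeneousComponent e p) =
      if e = d then homogeneousComponent e p else 0 := by
  rw [homogeneousComponent_of_mem (homogeneousComponent_isHomogeneous e p)]
  simp [eq_comm]

theorem isHomog_of_homogeneousComponent_mem {I : Ideal (MvPolynomial (Fin n) k)}
    (h : ∀ p ∈ I, ∀ d, homogeneousComponent d p ∈ I) : IsHomog I := by
  intro d p hp
  have e : (DirectSum.decompose (homogeneousSubmodule (Fin n) k) p d : MvPolynomial (Fin n) k) =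
      homogeneousComponent d p := decomposition.decompose'_apply p d
  rw [e]
  exact h p hp d

/-- The homogeneous ideal with prescribed graded pieces `V d`; these have to be compatible with
multiplication by the variables. -/
def ofPieces (V : ℕ → Submodule k (MvPolynomial (Fin n) k))
    (hV : ∀ d l, ∀ p ∈ V d, X l * p ∈ V (d + 1)) : Ideal (MvPolynomial (Fin n) k) where
  carrier := {p | ∀ d, homogeneousComponent d p ∈ V d}
  add_mem' hp hq d := by
    rw [map_add]
    exact (V d).add_mem (hp d) (hq d)
  zero_mem' d := by
    rw [map_zero]
    exact (V d).zero_mem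
  smul_mem' c := by
    induction c using MvPolynomial.induction_on with
    | C a =>
      intro p hp d
      rw [smul_eq_mul, homogeneousComponent_C_mul, C_mul']
      exact (V d).smul_mem _ (hp d)
    | add a b ha hb =>
      intro p hp d
      rw [add_smul, map_add]
      exact (V d).add_mem (ha hp d) (hb hp d)
    | mul_X a l ha =>
      intro p hp d
      have h := ha hp
      rw [mul_comm, mul_smul]
      generalize a • p = q at h
      rw [smul_eq_mul, ← sum_homogeneousComponent q, Finset.mul_sum, map_sum]
      refine (V d).sum_mem fun i _ => ?_
      rw [homogeneousComponent_of_mem (n := i + 1)]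
      · split_ifs with hd
        · subst hd
          exact hV i l _ (h i)
        · exact (V d).zero_mem
      · rw [mem_homogeneousSubmodule, add_comm]
        exact (isHomogeneous_X k l).mul (homogeneousComponent_isHomogeneous i q)

theorem isHomog_ofPieces (V : ℕ → Submodule k (MvPolynomial (Fin n) k))
    (hV : ∀ d l, ∀ p ∈ V d, X l * p ∈ V (d + 1)) : IsHomog (ofPieces V hV) := by
  refine isHomog_of_homogeneousComponent_mem fun p hp e d => ?_
  rw [homogeneousComponent_homogeneousComponent]
  split_ifs with h
  · exact h ▸ hp e
  · exact (V d).zero_mem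

theorem gradedPiece_ofPieces {V : ℕ → Submodule k (MvPolynomial (Fin n) k)}
    (hV : ∀ d l, ∀ p ∈ V d, X l * p ∈ V (d + 1))
    (hV' : ∀ d, V d ≤ homogeneousSubmodule (Fin n) k d) (d : ℕ) :
    gradedPiece (ofPieces V hV) d = V d := by
  ext p
  rw [mem_gradedPiece]
  constructor
  · rintro ⟨h, hp⟩
    have := h d
    rwa [homogeneousComponent_of_mem hp, if_pos rfl] at this
  · intro hp
    refine ⟨fun e => ?_, hV' d hp⟩
    rw [homogeneousComponent_of_mem (hV' d hp)]
    split_ifs with h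
    · exact h ▸ hp
    · exact (V e).zero_mem

theorem le_ofPieces {V : ℕ → Submodule k (MvPolynomial (Fin n) k)}
    {hV : ∀ d l, ∀ p ∈ V d, X l * p ∈ V (d + 1)} {I : Ideal (MvPolynomial (Fin n) k)}
    (hI : IsHomog I) (h : ∀ d, gradedPiece I d ≤ V d) : I ≤ ofPieces V hV :=
  fun p hp d => h d ⟨homogeneousComponent_mem_of_mem hI hp d,
    homogeneousComponent_isHomogeneous d p⟩

/-- `dim I_d = dim Ĩ_d - dim 𝔞_d` for an ideal `I` of `A/𝔞` and its preimage `Ĩ` in `A`. -/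
theorem hilb_add {𝔞 : Ideal (MvPolynomial (Fin n) k)} (I : Ideal (MvPolynomial (Fin n) k ⧸ 𝔞))
    (d : ℕ) :
    hilb I d + finrank k (gradedPiece 𝔞 d) =
      finrank k (gradedPiece (I.comap (Ideal.Quotient.mk 𝔞)) d) := by
  let f := (IsScalarTower.toAlgHom k (MvPolynomial (Fin n) k)
    (MvPolynomial (Fin n) k ⧸ 𝔞)).toLinearMap
  have h1 : I.restrictScalars k ⊓ component k n (MvPolynomial (Fin n) k ⧸ 𝔞) d =
      (gradedPiece (I.comap (Ideal.Quotient.mk 𝔞)) d).map f := by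
    ext q
    constructor
    · rintro ⟨hq, p, hp, rfl⟩
      exact ⟨p, ⟨hq, hp⟩, rfl⟩
    · rintro ⟨p, ⟨hq, hp⟩, rfl⟩
      exact ⟨hq, p, hp, rfl⟩
  have h2 : gradedPiece 𝔞 d = gradedPiece (I.comap (Ideal.Quotient.mk 𝔞)) d ⊓ LinearMap.ker f := by
    ext p
    have hk : p ∈ LinearMap.ker f ↔ p ∈ 𝔞 := Ideal.Quotient.eq_zero_iff_mem
    rw [Submodule.mem_inf, mem_gradedPiece, mem_gradedPiece, hk, Ideal.mem_comap]
    constructor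
    · rintro ⟨h1, h2⟩
      exact ⟨⟨by rw [Ideal.Quotient.eq_zero_iff_mem.mpr h1]; exact I.zero_mem, h2⟩, h1⟩
    · rintro ⟨⟨-, h2⟩, h1⟩
      exact ⟨h1, h2⟩
  rw [hilb, h1, h2, finrank_map_add_finrank_inf_ker]

instance finite_component (Q : Type*) [CommRing Q] [Algebra k Q]
    [Algebra (MvPolynomial (Fin n) k) Q] [IsScalarTower k (MvPolynomial (Fin n) k) Q] (d : ℕ) :
    Module.Finite k (component k n Q d) := by
  unfold component
  infer_instance

theorem finrank_component_quotient (I : Ideal (MvPolynomial (Fin n) k)) (d : ℕ) :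
    finrank k (component k n (MvPolynomial (Fin n) k ⧸ I) d) + finrank k (gradedPiece I d) =
      finrank k (homogeneousSubmodule (Fin n) k d) := by
  let f := (IsScalarTower.toAlgHom k (MvPolynomial (Fin n) k)
    (MvPolynomial (Fin n) k ⧸ I)).toLinearMap
  have h2 : gradedPiece I d = homogeneousSubmodule (Fin n) k d ⊓ LinearMap.ker f := by
    ext p
    have hk : p ∈ LinearMap.ker f ↔ p ∈ I := Ideal.Quotient.eq_zero_iff_mem
    rw [Submodule.mem_inf, mem_gradedPiece, hk, and_comm]
    rfl
  rw [component, h2, finrank_map_add_finrank_inf_ker]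

end GradedPieces

/-! ### Growth of Hilbert functions in the presence of an embedding -/

theorem exists_submodule_between {K V : Type*} [Field K] [AddCommGroup V] [Module K V]
    {U W : Submodule K V} [Module.Finite K W] (hUW : U ≤ W) {m : ℕ} (hU : finrank K U ≤ m)
    (hW : m ≤ finrank K W) : ∃ T : Submodule K V, U ≤ T ∧ T ≤ W ∧ finrank K T = m := by
  induction m, hU using Nat.le_induction with
  | base => exact ⟨U, le_rfl, hUW, rfl⟩
  | succ m hm ih =>
    obtain ⟨T, hUT, hTW, hT⟩ := ih (by omega)
    have hne : T ≠ W := by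
      rintro rfl
      omega
    obtain ⟨x, hxW, hxT⟩ := SetLike.exists_of_lt (lt_of_le_of_ne hTW hne)
    have hle : T ⊔ Submodule.span K {x} ≤ W :=
      sup_le hTW ((Submodule.span_singleton_le_iff_mem x W).mpr hxW)
    have : Module.Finite K T := Submodule.finiteDimensional_of_le hTW
    have : Module.Finite K ↥(T ⊔ Submodule.span K {x}) := Submodule.finiteDimensional_of_le hle
    refine ⟨T ⊔ Submodule.span K {x}, hUT.trans le_sup_left, hle, le_antisymm ?_ ?_⟩
    · refine (Submodule.finrank_add_le_finrank_add_finrank _ _).trans ?_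
      rw [hT]
      gcongr
      exact (finrank_span_le_card {x}).trans (by simp)
    · rw [← hT]
      refine Submodule.finrank_lt_finrank_of_lt (lt_of_le_of_ne le_sup_left fun h => hxT ?_)
      rw [h]
      exact Submodule.mem_sup_right (Submodule.mem_span_singleton_self x)

section Growth

variable {k : Type*} [Field k] {n : ℕ} {𝔞 : Ideal (MvPolynomial (Fin n) k)}

instance finite_inf_component (I : Ideal (MvPolynomial (Fin n) k ⧸ 𝔞)) (d : ℕ) :
    Module.Finite k ↥(I.restrictScalars k ⊓ component k n (MvPolynomial (Fin n) k ⧸ 𝔞) d) :=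
  Submodule.finiteDimensional_of_le (inf_le_right : _ ≤ component k n _ d)

theorem hilb_mono {I J : Ideal (MvPolynomial (Fin n) k ⧸ 𝔞)} (h : I ≤ J) : hilb I ≤ hilb J :=
  fun _ => Submodule.finrank_mono (inf_le_inf_right _ h)

theorem hilb_map_add {K : Ideal (MvPolynomial (Fin n) k)} (h : 𝔞 ≤ K) (d : ℕ) :
    hilb (K.map (Ideal.Quotient.mk 𝔞)) d + finrank k (gradedPiece 𝔞 d) =
      finrank k (gradedPiece K d) := by
  rw [hilb_add, Ideal.comap_map_mk h]

theorem le_comap_mk (I : Ideal (MvPolynomial (Fin n) k ⧸ 𝔞)) :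
    𝔞 ≤ I.comap (Ideal.Quotient.mk 𝔞) := fun p hp => by
  rw [Ideal.mem_comap, Ideal.Quotient.eq_zero_iff_mem.mpr hp]
  exact I.zero_mem

variable (𝔞) in
/-- The Hilbert series of `R = A/𝔞` itself. -/
def totalHilb : ℕ → ℕ := hilb (⊤ : Ideal (MvPolynomial (Fin n) k ⧸ 𝔞))

theorem hilb_le_totalHilb (I : Ideal (MvPolynomial (Fin n) k ⧸ 𝔞)) (d : ℕ) :
    hilb I d ≤ totalHilb 𝔞 d := hilb_mono le_top d

theorem totalHilb_add (d : ℕ) :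
    totalHilb 𝔞 d + finrank k (gradedPiece 𝔞 d) =
      finrank k (homogeneousSubmodule (Fin n) k d) := by
  have h : gradedPiece (⊤ : Ideal (MvPolynomial (Fin n) k)) d =
      homogeneousSubmodule (Fin n) k d := by
    simp [gradedPiece]
  rw [totalHilb, hilb_add, Ideal.comap_top, h]

/-- The Hilbert series of the homogeneous ideal of `A/𝔞` whose preimage in `A` is `K`. -/
def hilbOf {K : Ideal (MvPolynomial (Fin n) k)} (hK : IsHomog K) (h : 𝔞 ≤ K) : hilbPoset 𝔞 :=
  ⟨hilb (K.map (Ideal.Quotient.mk 𝔞)), ⟨K.map (Ideal.Quotient.mk 𝔞), by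
    rwa [Ideal.comap_map_mk h]⟩, rfl⟩

theorem hilbOf_add {K : Ideal (MvPolynomial (Fin n) k)} (hK : IsHomog K) (h : 𝔞 ≤ K) (d : ℕ) :
    (hilbOf hK h).1 d + finrank k (gradedPiece 𝔞 d) = finrank k (gradedPiece K d) :=
  hilb_map_add h d

theorem le_totalHilb {H : ℕ → ℕ} (hH : H ∈ hilbPoset 𝔞) (d : ℕ) : H d ≤ totalHilb 𝔞 d := by
  obtain ⟨I, rfl⟩ := hH
  exact hilb_le_totalHilb _ d

variable (𝔞) in
/-- The least possible dimension in degree `d + 1` of a homogeneous ideal of `A/𝔞` having dimension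
at least `v` in degree `d`.  (It has the junk value `0` for `v > dim (A/𝔞)_d`.) -/
def growth (d v : ℕ) : ℕ := sInf {m | ∃ H ∈ hilbPoset 𝔞, v ≤ H d ∧ H (d + 1) = m}

theorem growth_le {H : ℕ → ℕ} (hH : H ∈ hilbPoset 𝔞) {d v : ℕ} (hv : v ≤ H d) :
    growth 𝔞 d v ≤ H (d + 1) := Nat.sInf_le ⟨H, hH, hv, rfl⟩

theorem totalHilb_mem : totalHilb 𝔞 ∈ hilbPoset 𝔞 :=
  ⟨⟨⊤, by rw [Ideal.comap_top]; exact fun i p _ => trivial⟩, rfl⟩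

theorem exists_growth_eq {d v : ℕ} (hv : v ≤ totalHilb 𝔞 d) :
    ∃ H ∈ hilbPoset 𝔞, v ≤ H d ∧ H (d + 1) = growth 𝔞 d v :=
  Nat.sInf_mem (s := {m | ∃ H ∈ hilbPoset 𝔞, v ≤ H d ∧ H (d + 1) = m})
    ⟨_, totalHilb 𝔞, totalHilb_mem, hv, rfl⟩

theorem growth_mono {d v w : ℕ} (hvw : v ≤ w) (hw : w ≤ totalHilb 𝔞 d) :
    growth 𝔞 d v ≤ growth 𝔞 d w := by
  obtain ⟨H, hH, h1, h2⟩ := exists_growth_eq hw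
  rw [← h2]
  exact growth_le hH (hvw.trans h1)

theorem growth_le_totalHilb {d v : ℕ} (hv : v ≤ totalHilb 𝔞 d) :
    growth 𝔞 d v ≤ totalHilb 𝔞 (d + 1) := growth_le totalHilb_mem hv

theorem growth_zero (h𝔞 : IsHomog 𝔞) (d : ℕ) : growth 𝔞 d 0 = 0 := by
  have h := growth_le (hilbOf h𝔞 le_rfl).2 (zero_le (a := (hilbOf h𝔞 le_rfl).1 d))
  have h' := hilbOf_add h𝔞 le_rfl (d + 1)
  omega

/-- The pieces of the ideal agreeing with `𝔞` below degree `d`, with `V` in degree `d`, with `W` in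
degree `d + 1` and with the whole ring above. -/
def twoStepPieces (𝔞 : Ideal (MvPolynomial (Fin n) k)) (d : ℕ)
    (V W : Submodule k (MvPolynomial (Fin n) k)) (e : ℕ) : Submodule k (MvPolynomial (Fin n) k) :=
  if e < d then gradedPiece 𝔞 e else if e = d then V else if e = d + 1 then W else
    homogeneousSubmodule (Fin n) k e

/-- The ideal agreeing with `𝔞` below degree `d`, with `V` in degree `d`, with `W` in
degree `d + 1` and with the whole ring above. -/
theorem exists_twoStep (h𝔞 : IsHomog 𝔞) (d : ℕ) {V W : Submodule k (MvPolynomial (Fin n) k)}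
    (h𝔞V : gradedPiece 𝔞 d ≤ V) (h𝔞W : gradedPiece 𝔞 (d + 1) ≤ W)
    (hV : V ≤ homogeneousSubmodule (Fin n) k d) (hW : W ≤ homogeneousSubmodule (Fin n) k (d + 1))
    (hVW : ∀ l, ∀ p ∈ V, X l * p ∈ W) :
    ∃ K, IsHomog K ∧ 𝔞 ≤ K ∧ ∀ e, gradedPiece K e = twoStepPieces 𝔞 d V W e := by
  have hle : ∀ e, twoStepPieces 𝔞 d V W e ≤ homogeneousSubmodule (Fin n) k e := by
    intro e
    unfold twoStepPieces
    split_ifs with h1 h2 h3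
    · exact inf_le_right
    · exact h2 ▸ hV
    · exact h3 ▸ hW
    · exact le_rfl
  have hmul : ∀ e l, ∀ p ∈ twoStepPieces 𝔞 d V W e, X l * p ∈ twoStepPieces 𝔞 d V W (e + 1) := by
    intro e l p hp
    have hX : X l * p ∈ homogeneousSubmodule (Fin n) k (e + 1) := by
      rw [mem_homogeneousSubmodule, add_comm]
      exact (isHomogeneous_X k l).mul (hle e hp)
    unfold twoStepPieces at hp ⊢
    rcases lt_trichotomy e d with h | rfl | h
    · rw [if_pos h] at hp
      have hp' := X_mul_mem_gradedPiece l hp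
      split_ifs with h1 h2 h3
      · exact hp'
      · exact h𝔞V (h2 ▸ hp')
      · omega
      · exact hX
    · simp only [lt_irrefl, if_false, if_true] at hp
      rw [if_neg (by omega), if_neg (by omega), if_pos rfl]
      exact hVW l p hp
    · rw [if_neg (by omega), if_neg (by omega), if_neg (by omega)]
      exact hX
  refine ⟨ofPieces _ hmul, isHomog_ofPieces _ hmul, le_ofPieces h𝔞 fun e => ?_,
    gradedPiece_ofPieces hmul hle⟩
  unfold twoStepPieces
  split_ifs with h1 h2 h3
  · exact le_rfl
  · exact h2 ▸ h𝔞V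
  · exact h3 ▸ h𝔞W
  · exact inf_le_right

theorem growth_le_of_X_mul (h𝔞 : IsHomog 𝔞) {K K' : Ideal (MvPolynomial (Fin n) k)}
    (h : 𝔞 ≤ K) (h' : 𝔞 ≤ K') {d : ℕ}
    (hX : ∀ l, ∀ p ∈ gradedPiece K d, X l * p ∈ gradedPiece K' (d + 1)) :
    growth 𝔞 d (hilb (K.map (Ideal.Quotient.mk 𝔞)) d) ≤
      hilb (K'.map (Ideal.Quotient.mk 𝔞)) (d + 1) := by
  obtain ⟨T, hT, h𝔞T, hTe⟩ := exists_twoStep h𝔞 d (gradedPiece_mono h d)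
    (gradedPiece_mono h' (d + 1)) inf_le_right inf_le_right hX
  have e1 := hilb_map_add h d
  have e2 := hilb_map_add h' (d + 1)
  have e3 := hilbOf_add hT h𝔞T d
  have e4 := hilbOf_add hT h𝔞T (d + 1)
  rw [hTe, twoStepPieces, if_neg (lt_irrefl d), if_pos rfl] at e3
  rw [hTe, twoStepPieces, if_neg (by omega), if_neg (by omega), if_pos rfl] at e4
  have := growth_le (hilbOf hT h𝔞T).2 (d := d) (v := hilb (K.map (Ideal.Quotient.mk 𝔞)) d)
    (by omega)
  omega

/-- The ideal agreeing with `𝔞` below degree `d` and with `I` from there on. -/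
theorem exists_truncation (h𝔞 : IsHomog 𝔞) (d : ℕ) {I : Ideal (MvPolynomial (Fin n) k)}
    (hI : 𝔞 ≤ I) :
    ∃ K, IsHomog K ∧ 𝔞 ≤ K ∧
      ∀ e, gradedPiece K e = if e < d then gradedPiece 𝔞 e else gradedPiece I e := by
  have hle : ∀ e, (if e < d then gradedPiece 𝔞 e else gradedPiece I e) ≤
      homogeneousSubmodule (Fin n) k e := by
    intro e
    split_ifs
    exacts [inf_le_right, inf_le_right]
  have hmul : ∀ e l, ∀ p ∈ (if e < d then gradedPiece 𝔞 e else gradedPiece I e),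
      X l * p ∈ (if e + 1 < d then gradedPiece 𝔞 (e + 1) else gradedPiece I (e + 1)) := by
    intro e l p hp
    have hp' : e < d → p ∈ gradedPiece 𝔞 e := fun h => by rwa [if_pos h] at hp
    have hp'' : p ∈ gradedPiece I e := by
      split_ifs at hp
      · exact gradedPiece_mono hI _ hp
      · exact hp
    split_ifs with h
    · exact X_mul_mem_gradedPiece l (hp' (by omega))
    · exact X_mul_mem_gradedPiece l hp''
  refine ⟨ofPieces _ hmul, isHomog_ofPieces _ hmul, le_ofPieces h𝔞 fun e => ?_,
    gradedPiece_ofPieces hmul hle⟩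
  split_ifs
  · exact le_rfl
  · exact gradedPiece_mono hI e

section Embedding

variable (εR : hilbPoset 𝔞 ↪o HomogIdeal 𝔞)

/-- The preimage in `A` of the ideal `ε_R(H)` of `A/𝔞`. -/
def epsIdeal (H : hilbPoset 𝔞) : Ideal (MvPolynomial (Fin n) k) :=
  (εR H).1.comap (Ideal.Quotient.mk 𝔞)

theorem isHomog_epsIdeal (H : hilbPoset 𝔞) : IsHomog (epsIdeal εR H) := (εR H).2

theorem le_epsIdeal (H : hilbPoset 𝔞) : 𝔞 ≤ epsIdeal εR H := le_comap_mk _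

theorem epsIdeal_mono {H H' : hilbPoset 𝔞} (h : H.1 ≤ H'.1) : epsIdeal εR H ≤ epsIdeal εR H' :=
  Ideal.comap_mono (εR.monotone h)

variable {εR}

theorem finrank_epsIdeal (hεR : IsSection εR) (H : hilbPoset 𝔞) (d : ℕ) :
    H.1 d + finrank k (gradedPiece 𝔞 d) = finrank k (gradedPiece (epsIdeal εR H) d) := by
  rw [epsIdeal, ← hilb_add, hεR H]

theorem gradedPiece_epsIdeal_eq (hεR : IsSection εR) {H H' : hilbPoset 𝔞} (h : H.1 ≤ H'.1) {d : ℕ}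
    (hd : H.1 d = H'.1 d) :
    gradedPiece (epsIdeal εR H) d = gradedPiece (epsIdeal εR H') d := by
  refine Submodule.eq_of_le_of_finrank_eq (gradedPiece_mono (epsIdeal_mono εR h) d) ?_
  rw [← finrank_epsIdeal hεR, ← finrank_epsIdeal hεR, hd]

/-- The degree `d` piece of `ε_R(H)` depends only on `H d`, and monotonically so.  This is seen by
comparing `H` with the Hilbert series of its truncation `ε_R(H)_{≥ d}` and of
`ε_R(H)_{≥ d} + R_{≥ d + 1}`. -/
theorem gradedPiece_epsIdeal_le (h𝔞 : IsHomog 𝔞) (hεR : IsSection εR) {H H' : hilbPoset 𝔞} {d : ℕ}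
    (hd : H.1 d ≤ H'.1 d) :
    gradedPiece (epsIdeal εR H) d ≤ gradedPiece (epsIdeal εR H') d := by
  have key : ∀ H : hilbPoset 𝔞, ∃ P : hilbPoset 𝔞,
      (∀ e, P.1 e = if e < d then 0 else if e = d then H.1 d else totalHilb 𝔞 e) ∧
      gradedPiece (epsIdeal εR H) d = gradedPiece (epsIdeal εR P) d := by
    intro H
    obtain ⟨G, hG, h𝔞G, hGe⟩ := exists_truncation h𝔞 d (le_epsIdeal εR H)
    obtain ⟨K, hK, h𝔞K, hKe⟩ := exists_twoStep h𝔞 d (gradedPiece_mono (le_epsIdeal εR H) d)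
      (W := homogeneousSubmodule (Fin n) k (d + 1)) inf_le_right inf_le_right le_rfl
      (fun l p hp => (X_mul_mem_gradedPiece l hp).2)
    have eG : ∀ e, (hilbOf hG h𝔞G).1 e = if e < d then 0 else H.1 e := by
      intro e
      have e1 := hilbOf_add hG h𝔞G e
      have e2 := finrank_epsIdeal hεR H e
      rw [hGe] at e1
      by_cases h : e < d
      · rw [if_pos h] at e1 ⊢
        omega
      · rw [if_neg h] at e1 ⊢
        omega
    have eK : ∀ e, (hilbOf hK h𝔞K).1 e =
        if e < d then 0 else if e = d then H.1 d else totalHilb 𝔞 e := by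
      intro e
      have e1 := hilbOf_add hK h𝔞K e
      have e2 := finrank_epsIdeal hεR H e
      have e3 := totalHilb_add (𝔞 := 𝔞) e
      rw [hKe, twoStepPieces] at e1
      rcases lt_trichotomy e d with h | rfl | h
      · rw [if_pos h] at e1 ⊢
        omega
      · rw [if_neg (lt_irrefl e), if_pos rfl] at e1 ⊢
        omega
      · have h' : (if e = d + 1 then homogeneousSubmodule (Fin n) k (d + 1) else
            homogeneousSubmodule (Fin n) k e) = homogeneousSubmodule (Fin n) k e := by
          split_ifs with h3
          · rw [h3]
          · rfl
        rw [if_neg (by omega), if_neg (by omega), h'] at e1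
        rw [if_neg (by omega), if_neg (by omega)]
        omega
    refine ⟨hilbOf hK h𝔞K, eK, ?_⟩
    rw [← gradedPiece_epsIdeal_eq hεR (H := hilbOf hG h𝔞G) (H' := H),
      ← gradedPiece_epsIdeal_eq hεR (H := hilbOf hG h𝔞G) (H' := hilbOf hK h𝔞K)]
    · intro e
      rw [eG, eK]
      split_ifs with h1 h2
      · exact le_rfl
      · exact h2 ▸ le_rfl
      · exact le_totalHilb H.2 e
    · rw [eG, eK]
      simp
    · intro e
      rw [eG]
      split_ifs
      · exact Nat.zero_le _
      · exact le_rfl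
    · rw [eG]
      simp
  obtain ⟨P, hP, e⟩ := key H
  obtain ⟨P', hP', e'⟩ := key H'
  rw [e, e']
  refine gradedPiece_mono (epsIdeal_mono εR fun i => ?_) d
  rw [hP, hP']
  split_ifs
  · exact le_rfl
  · exact hd
  · exact le_rfl

/-- The variables take the degree `d` piece of `ε_R(H)` into `ε_R(H')` if the numbers permit it, as
both can be compared with `ε_R(G)`, where `G` has the least growth from the value `H d`. -/
theorem X_mul_mem_epsIdeal (h𝔞 : IsHomog 𝔞) (hεR : IsSection εR) {H H' : hilbPoset 𝔞} {d : ℕ}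
    (hd : growth 𝔞 d (H.1 d) ≤ H'.1 (d + 1)) (l : Fin n) {p : MvPolynomial (Fin n) k}
    (hp : p ∈ gradedPiece (epsIdeal εR H) d) : X l * p ∈ gradedPiece (epsIdeal εR H') (d + 1) := by
  obtain ⟨G, hG, h1, h2⟩ := exists_growth_eq (le_totalHilb H.2 d)
  exact gradedPiece_epsIdeal_le h𝔞 hεR (H := ⟨G, hG⟩) (h2.trans_le hd)
    (X_mul_mem_gradedPiece l (gradedPiece_epsIdeal_le h𝔞 hεR (H' := ⟨G, hG⟩) h1 hp))

theorem exists_hilbPoset_eq (h𝔞 : IsHomog 𝔞) {d v : ℕ} (hv : v ≤ totalHilb 𝔞 d) :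
    ∃ H : hilbPoset 𝔞, H.1 d = v := by
  have h := totalHilb_add (𝔞 := 𝔞) d
  obtain ⟨V, h1, h2, h3⟩ := exists_submodule_between
    (inf_le_right : gradedPiece 𝔞 d ≤ homogeneousSubmodule (Fin n) k d)
    (m := v + finrank k (gradedPiece 𝔞 d)) (Nat.le_add_left _ _) (by omega)
  obtain ⟨K, hK, h𝔞K, hKe⟩ := exists_twoStep h𝔞 d h1
      (W := homogeneousSubmodule (Fin n) k (d + 1)) inf_le_right h2 le_rfl
      (fun l p hp => by
        rw [mem_homogeneousSubmodule, add_comm]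
        exact (isHomogeneous_X k l).mul (h2 hp))
  refine ⟨hilbOf hK h𝔞K, ?_⟩
  have e := hilbOf_add hK h𝔞K d
  rw [hKe, twoStepPieces, if_neg (lt_irrefl d), if_pos rfl] at e
  omega

/-- If `R` has an embedding of its poset of Hilbert series, then the Hilbert series of the
homogeneous ideals of `R` are characterized by their growth from each degree to the next. -/
theorem mem_hilbPoset_of_growth (h𝔞 : IsHomog 𝔞) (hεR : IsSection εR) {h : ℕ → ℕ}
    (h1 : ∀ d, h d ≤ totalHilb 𝔞 d) (h2 : ∀ d, growth 𝔞 d (h d) ≤ h (d + 1)) :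
    h ∈ hilbPoset 𝔞 := by
  choose P hP using fun d => exists_hilbPoset_eq h𝔞 (h1 d)
  have hmul : ∀ d l, ∀ p ∈ gradedPiece (epsIdeal εR (P d)) d,
      X l * p ∈ gradedPiece (epsIdeal εR (P (d + 1))) (d + 1) := by
    intro d l p hp
    refine X_mul_mem_epsIdeal h𝔞 hεR ?_ l hp
    rw [hP, hP]
    exact h2 d
  have hle : 𝔞 ≤ ofPieces (fun d => gradedPiece (epsIdeal εR (P d)) d) hmul :=
    le_ofPieces h𝔞 fun d => gradedPiece_mono (le_epsIdeal εR _) d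
  convert (hilbOf (isHomog_ofPieces _ hmul) hle).2
  funext d
  have e1 := hilbOf_add (isHomog_ofPieces _ hmul) hle d
  rw [gradedPiece_ofPieces hmul (fun d => inf_le_right), ← finrank_epsIdeal hεR, hP] at e1
  omega

end Embedding

end Growth

/-! ### Greedy dimension vectors -/

section Greedy

/-- The properties of the growth function `g` of a ring with Hilbert series `r` that the
combinatorics of dimension vectors depends on. -/
structure IsGrowthBound (r : ℕ → ℕ) (g : ℕ → ℕ → ℕ) : Prop where
  mono : ∀ d v w, v ≤ w → w ≤ r d → g d v ≤ g d w
  le_top : ∀ d v, v ≤ r d → g d v ≤ r (d + 1)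
  zero : ∀ d, g d 0 = 0

variable {r : ℕ → ℕ} {g : ℕ → ℕ → ℕ} {t : ℕ∞} {D : ℕ} {b b' d : ℕ → ℕ}

/-- The dimension of the part of `S_D` of degree `i` in `z`, for `i ≤ D`. -/
def cap (r : ℕ → ℕ) (t : ℕ∞) (D i : ℕ) : ℕ := if (i : ℕ∞) < t then r (D - i) else 0

/-- The conditions on the dimensions `b i` of the parts of degree `i` in `z` of the degree `D`
piece of a `z`-stable ideal. -/
structure Admissible (r : ℕ → ℕ) (g : ℕ → ℕ → ℕ) (t : ℕ∞) (D : ℕ) (b : ℕ → ℕ) : Prop where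
  le_cap : ∀ i ≤ D, b i ≤ cap r t D i
  growth : ∀ i, i + 1 ≤ D → g (D - (i + 1)) (b (i + 1)) ≤ b i

/-- An admissible vector is greedy if it is as large as possible in the high `z`-degrees: it
is exceeded by another admissible vector in `z`-degree `j` only if that vector is at least as large
in all `z`-degrees below `j`. -/
structure Greedy (r : ℕ → ℕ) (g : ℕ → ℕ → ℕ) (t : ℕ∞) (D : ℕ) (b : ℕ → ℕ) : Prop
    extends Admissible r g t D b where
  greedy : ∀ d, Admissible r g t D d → ∀ i j, i < j → j ≤ D → b j < d j → b i ≤ d i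

theorem cap_le (D i : ℕ) : cap r t D i ≤ r (D - i) := by
  unfold cap
  split_ifs
  · exact le_rfl
  · exact Nat.zero_le _

theorem Greedy.le_of_sum_le (h : Greedy r g t D b) (h' : Greedy r g t D b')
    (hs : ∑ i ∈ Finset.range (D + 1), b i ≤ ∑ i ∈ Finset.range (D + 1), b' i) {i : ℕ}
    (hi : i ≤ D) : b i ≤ b' i := by
  by_contra! hlt
  obtain ⟨j, hj, hjlt⟩ : ∃ j ≤ D, b j < b' j := by
    by_contra! hle
    refine hs.not_gt (Finset.sum_lt_sum (fun j hj => hle j ?_) ⟨i, ?_, hlt⟩)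
    · exact Nat.lt_succ_iff.mp (Finset.mem_range.mp hj)
    · exact Finset.mem_range.mpr (Nat.lt_succ_iff.mpr hi)
  rcases lt_trichotomy i j with hij | rfl | hij
  · exact (h.greedy b' h'.toAdmissible i j hij hj hjlt).not_gt hlt
  · omega
  · exact (h'.greedy b h.toAdmissible j i hij hi hlt).not_gt hjlt

/-- Greedy vectors minimize all the partial sums. -/
theorem Greedy.sum_range_le (h : Greedy r g t D b) (hd : Admissible r g t D d)
    (hs : ∑ i ∈ Finset.range (D + 1), b i = ∑ i ∈ Finset.range (D + 1), d i) {s : ℕ}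
    (hsD : s ≤ D + 1) : ∑ i ∈ Finset.range s, b i ≤ ∑ i ∈ Finset.range s, d i := by
  by_contra! hlt
  obtain ⟨a, ha, hda⟩ := Finset.exists_lt_of_sum_lt hlt
  have h1 := Finset.sum_range_add_sum_Ico b hsD
  have h2 := Finset.sum_range_add_sum_Ico d hsD
  obtain ⟨j, hj, hbj⟩ := Finset.exists_lt_of_sum_lt (s := Finset.Ico s (D + 1)) (f := b) (g := d)
    (by omega)
  rw [Finset.mem_range] at ha
  rw [Finset.mem_Ico] at hj
  exact (h.greedy d hd a j (by omega) (by omega) hbj).not_gt hda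

theorem greedy_zero (hg : IsGrowthBound r g) : Greedy r g t D 0 where
  le_cap _ _ := Nat.zero_le _
  growth _ _ := (hg.zero _).le
  greedy _ _ _ _ _ _ _ := Nat.zero_le _

/-- Greedy vectors of any possible sum exist.  The sum can be increased by increasing the
entry in the highest `z`-degree where the vector stays admissible. -/
theorem exists_greedy (hg : IsGrowthBound r g) {N : ℕ}
    (hN : N ≤ ∑ i ∈ Finset.range (D + 1), cap r t D i) :
    ∃ b, Greedy r g t D b ∧ ∑ i ∈ Finset.range (D + 1), b i = N := by
  induction N with
  | zero => exact ⟨0, greedy_zero hg, by simp⟩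
  | succ N ih =>
    obtain ⟨b, hb, hbN⟩ := ih (by omega)
    -- the `z`-degrees in which `b` can be increased
    let P : ℕ → Prop := fun x => b x < cap r t D x ∧
      ∀ y, y + 1 = x → g (D - x) (b x + 1) ≤ b y
    have hex : ∃ x ≤ D, P x := by
      have hex' : ∃ x, x ≤ D ∧ b x < cap r t D x := by
        obtain ⟨x, hx, hlt⟩ := Finset.exists_lt_of_sum_lt (s := Finset.range (D + 1)) (f := b)
          (g := cap r t D) (by omega)
        exact ⟨x, Nat.lt_succ_iff.mp (Finset.mem_range.mp hx), hlt⟩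
      classical
      obtain ⟨hxD, hx⟩ := Nat.find_spec hex'
      refine ⟨Nat.find hex', hxD, hx, fun y hy => ?_⟩
      have hmin := Nat.find_min hex' (m := y) (by omega)
      have hcap : cap r t D y ≤ b y := by
        by_contra! hlt
        exact hmin ⟨by omega, hlt⟩
      refine le_trans ?_ hcap
      have hlt : ((Nat.find hex' : ℕ) : ℕ∞) < t := by
        by_contra hge
        rw [cap, if_neg hge] at hx
        omega
      have hyt : (y : ℕ∞) < t := lt_of_le_of_lt (by exact_mod_cast (by omega)) hlt
      rw [cap, if_pos hyt]
      have := hg.le_top (D - Nat.find hex') _ (Nat.succ_le_of_lt (hx.trans_le (cap_le _ _)))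
      rwa [show D - Nat.find hex' + 1 = D - y by omega] at this
    classical
    obtain ⟨x, ⟨hxD, hxP⟩, hmax⟩ : ∃ x, (x ≤ D ∧ P x) ∧ ∀ y, x < y → y ≤ D → ¬ P y := by
      obtain ⟨x, hx⟩ := hex
      refine ⟨Nat.findGreatest P D, ⟨Nat.findGreatest_le D, Nat.findGreatest_spec hx.1 hx.2⟩,
        fun y hy hyD => Nat.findGreatest_is_greatest hy hyD⟩
    refine ⟨Function.update b x (b x + 1), ⟨⟨fun i hi => ?_, fun i hi => ?_⟩, ?_⟩, ?_⟩
    · rcases eq_or_ne i x with rfl | hne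
      · rw [Function.update_self]
        exact hxP.1
      · rw [Function.update_of_ne hne]
        exact hb.le_cap i hi
    · rcases eq_or_ne (i + 1) x with rfl | hne
      · rw [Function.update_self, Function.update_of_ne (by omega)]
        exact hxP.2 i rfl
      · rw [Function.update_of_ne hne]
        refine (hb.growth i hi).trans ?_
        rcases eq_or_ne i x with rfl | hne'
        · rw [Function.update_self]
          omega
        · rw [Function.update_of_ne hne']
    · intro d hd i j hij hjD hlt
      have hlt' : b j < d j := by
        refine lt_of_le_of_lt ?_ hlt
        rcases eq_or_ne j x with rfl | hne
        · rw [Function.update_self]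
          omega
        · rw [Function.update_of_ne hne]
      have hle := hb.greedy d hd i j hij hjD hlt'
      rcases eq_or_ne i x with rfl | hne
      · rw [Function.update_self]
        by_contra! hgt
        -- the first `z`-degree above `i` where `d` exceeds `b` would be one in which `b` can be
        -- increased
        have hex' : ∃ y, i < y ∧ y ≤ D ∧ b y < d y := ⟨j, hij, hjD, hlt'⟩
        obtain ⟨h1, h2, h3⟩ := Nat.find_spec hex'
        have hmin := fun m => Nat.find_min hex' (m := m)
        generalize Nat.find hex' = y at h1 h2 h3 hmin
        refine hmax y h1 h2 ⟨h3.trans_le (hd.le_cap y h2), fun z hz => ?_⟩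
        subst hz
        have h4 : g (D - (z + 1)) (b (z + 1) + 1) ≤ g (D - (z + 1)) (d (z + 1)) :=
          hg.mono _ _ _ h3 ((hd.le_cap _ h2).trans (cap_le _ _))
        refine h4.trans ((hd.growth z h2).trans ?_)
        rcases eq_or_lt_of_le (Nat.lt_succ_iff.mp h1) with rfl | h5
        · omega
        · by_contra! h6
          exact hmin z (by omega) ⟨h5, by omega, h6⟩
      · rwa [Function.update_of_ne hne]
    · rw [Finset.sum_update_of_mem (Finset.mem_range.mpr (Nat.lt_succ_iff.mpr hxD)), ← hbN,
        ← Finset.add_sum_erase _ b (Finset.mem_range.mpr (Nat.lt_succ_iff.mpr hxD)),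
        Finset.sdiff_singleton_eq_erase]
      omega

/-- The dimension vector, in degree `D + 1`, of the ideal generated by a piece in degree `D`. -/
def shiftVector (g : ℕ → ℕ → ℕ) (t : ℕ∞) (D : ℕ) (b : ℕ → ℕ) : ℕ → ℕ
  | 0 => g D (b 0)
  | i + 1 => if ((i + 1 : ℕ) : ℕ∞) < t then b i else 0

theorem cap_succ_le (D i : ℕ) : cap r t (D + 1) (i + 1) ≤ cap r t D i := by
  unfold cap
  rw [Nat.add_sub_add_right]
  split_ifs with h1 h2
  · exact le_rfl
  · exact absurd (lt_of_le_of_lt (by exact_mod_cast Nat.le_succ i) h1) h2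
  · exact Nat.zero_le _
  · exact le_rfl

theorem Admissible.tail (h : Admissible r g t (D + 1) d) :
    Admissible r g t D (fun i => d (i + 1)) where
  le_cap i hi := (h.le_cap (i + 1) (by omega)).trans (cap_succ_le D i)
  growth i hi := by
    have := h.growth (i + 1) (by omega)
    rwa [Nat.add_sub_add_right] at this

theorem shiftVector_succ_le (i : ℕ) : shiftVector g t D b (i + 1) ≤ b i := by
  simp only [shiftVector]
  split_ifs
  · exact le_rfl
  · exact Nat.zero_le _

/-- The ideal generated by a greedy piece is greedy in the next degree. -/
theorem Greedy.shiftVector (hg : IsGrowthBound r g) (ht : 1 ≤ t) (h : Greedy r g t D b) :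
    Greedy r g t (D + 1) (shiftVector g t D b) where
  le_cap i hi := by
    cases i with
    | zero =>
      rw [cap, if_pos (by exact_mod_cast lt_of_lt_of_le zero_lt_one ht)]
      exact hg.le_top D _ ((h.le_cap 0 (Nat.zero_le _)).trans (cap_le _ _))
    | succ i =>
      simp only [PosetEmbedding.shiftVector, cap]
      split_ifs with h1
      · rw [Nat.add_sub_add_right]
        exact (h.le_cap i (by omega)).trans (cap_le _ _)
      · exact le_rfl
  growth i hi := by
    rw [Nat.add_sub_add_right]
    have hi' : i ≤ D := by omega
    refine (hg.mono _ _ _ (shiftVector_succ_le i) ((h.le_cap i hi').trans (cap_le _ _))).trans ?_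
    cases i with
    | zero => exact le_rfl
    | succ i =>
      simp only [PosetEmbedding.shiftVector]
      split_ifs with h1
      · exact h.growth i hi'
      · have := h.le_cap (i + 1) hi'
        rw [cap, if_neg h1, Nat.le_zero] at this
        rw [this, hg.zero]
  greedy d hd i j hij hjD hlt := by
    obtain ⟨j, rfl⟩ : ∃ y, j = y + 1 := ⟨j - 1, by omega⟩
    have hjt : ((j + 1 : ℕ) : ℕ∞) < t := by
      by_contra hge
      have := hd.le_cap (j + 1) hjD
      rw [cap, if_neg hge] at this
      omega
    simp only [PosetEmbedding.shiftVector, if_pos hjt] at hlt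
    have key : ∀ i, i ≤ j → b i ≤ d (i + 1) := by
      intro i hi
      rcases eq_or_lt_of_le hi with rfl | hi
      · exact hlt.le
      · exact h.greedy _ hd.tail i j hi (by omega) hlt
    cases i with
    | zero =>
      have h1 := hd.growth 0 (by omega)
      refine (hg.mono D _ _ (key 0 (Nat.zero_le _)) ?_).trans h1
      exact (hd.tail.le_cap 0 (Nat.zero_le _)).trans (cap_le _ _)
    | succ i => exact (shiftVector_succ_le i).trans (key i (by omega))

/-- The ideal generated by a greedy piece is no larger than the degree `D + 1` piece `d'` of a
`z`-stable ideal with a piece `d` of the same dimension in degree `D`. -/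
theorem sum_shiftVector_le {d' : ℕ → ℕ} (hg : IsGrowthBound r g) (h : Greedy r g t D b)
    (hd : Admissible r g t D d)
    (hs : ∑ i ∈ Finset.range (D + 1), b i = ∑ i ∈ Finset.range (D + 1), d i)
    (h0 : g D (d 0) ≤ d' 0) (hdd' : ∀ i ≤ D, ((i + 1 : ℕ) : ℕ∞) < t → d i ≤ d' (i + 1)) :
    ∑ i ∈ Finset.range (D + 2), shiftVector g t D b i ≤ ∑ i ∈ Finset.range (D + 2), d' i := by
  -- only the entries `b i` with `i + 1 < t` survive multiplication by `z`
  obtain ⟨s, hsD, hst⟩ : ∃ s ≤ D + 1, ∀ i ≤ D, ((i + 1 : ℕ) : ℕ∞) < t ↔ i < s := by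
    induction t using ENat.recTopCoe with
    | top => exact ⟨D + 1, le_rfl, fun i hi => ⟨fun _ => by omega, fun _ => ENat.natCast_lt_top _⟩⟩
    | coe m =>
      refine ⟨min (D + 1) (m - 1), min_le_left _ _, fun i hi => ?_⟩
      rw [Nat.cast_lt, lt_min_iff]
      omega
  have hsum : ∀ f : ℕ → ℕ,
      ∑ i ∈ Finset.range (D + 1), (if ((i + 1 : ℕ) : ℕ∞) < t then f i else 0) =
        ∑ i ∈ Finset.range s, f i := by
    intro f
    rw [← Finset.sum_range_add_sum_Ico _ hsD, Finset.sum_eq_zero (s := Finset.Ico s (D + 1)),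
      add_zero]
    · refine Finset.sum_congr rfl fun i hi => if_pos ((hst i ?_).mpr (Finset.mem_range.mp hi))
      have := Finset.mem_range.mp hi
      omega
    · intro i hi
      rw [Finset.mem_Ico] at hi
      exact if_neg fun h => by have := (hst i (by omega)).mp h; omega
  rw [Finset.sum_range_succ', Finset.sum_range_succ' d']
  refine add_le_add ?_ ?_
  · simp only [PosetEmbedding.shiftVector]
    rw [hsum]
    refine (h.sum_range_le hd hs hsD).trans ?_
    rw [← hsum]
    refine Finset.sum_le_sum fun i hi => ?_
    have hi' : i ≤ D := Nat.lt_succ_iff.mp (Finset.mem_range.mp hi)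
    split_ifs with h1
    · exact hdd' i hi' h1
    · exact Nat.zero_le _
  · refine le_trans (hg.mono D _ _ ?_ ((hd.le_cap 0 (Nat.zero_le _)).trans (cap_le _ _))) h0
    simpa using h.sum_range_le hd hs (s := 1) (by omega)

end Greedy

/-! ### Multigraded ideals of the extension and their slices -/

section Slices

variable {k : Type*} [Field k] {n : ℕ}

/-- The coefficient of `z ^ i` of an element of `B = A[z]`. -/
def zCoeff (i : ℕ) : MvPolynomial (Fin (n + 1)) k →ₗ[k] MvPolynomial (Fin n) k where
  toFun p := (finSuccEquiv k n p).coeff i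
  map_add' p q := by rw [map_add, Polynomial.coeff_add]
  map_smul' c p := by rw [map_smul, Polynomial.coeff_smul, RingHom.id_apply]

theorem zCoeff_apply (i : ℕ) (p : MvPolynomial (Fin (n + 1)) k) :
    zCoeff i p = (finSuccEquiv k n p).coeff i := rfl

theorem zCoeff_ext {p q : MvPolynomial (Fin (n + 1)) k} (h : ∀ i, zCoeff i p = zCoeff i q) :
    p = q := (finSuccEquiv k n).injective (Polynomial.ext h)

theorem coeff_zCoeff (i : ℕ) (p : MvPolynomial (Fin (n + 1)) k) (m : Fin n →₀ ℕ) :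
    coeff m (zCoeff i p) = coeff (m.cons i) p := finSuccEquiv_coeff_coeff m p i

theorem zCoeff_X_zero_mul (i : ℕ) (p : MvPolynomial (Fin (n + 1)) k) :
    zCoeff (i + 1) (X 0 * p) = zCoeff i p := by
  rw [zCoeff_apply, map_mul, finSuccEquiv_X_zero, Polynomial.coeff_X_mul, zCoeff_apply]

theorem zCoeff_zero_X_zero_mul (p : MvPolynomial (Fin (n + 1)) k) : zCoeff 0 (X 0 * p) = 0 := by
  rw [zCoeff_apply, map_mul, finSuccEquiv_X_zero, Polynomial.coeff_X_mul_zero]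

theorem finSuccEquiv_rename_succ (a : MvPolynomial (Fin n) k) :
    finSuccEquiv k n (rename Fin.succ a) = Polynomial.C a := by
  induction a using MvPolynomial.induction_on with
  | C c => rw [rename_C]; simp [finSuccEquiv_apply]
  | add a b ha hb => rw [map_add, map_add, ha, hb, Polynomial.C_add]
  | mul_X a l ha => rw [map_mul, map_mul, ha, rename_X, finSuccEquiv_X_succ, Polynomial.C_mul]

theorem zCoeff_rename_mul (i : ℕ) (a : MvPolynomial (Fin n) k) (p : MvPolynomial (Fin (n + 1)) k) :
    zCoeff i (rename Fin.succ a * p) = a * zCoeff i p := by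
  rw [zCoeff_apply, map_mul, finSuccEquiv_rename_succ, Polynomial.coeff_C_mul, zCoeff_apply]

theorem zCoeff_rename_mul_X_pow (i j : ℕ) (a : MvPolynomial (Fin n) k) :
    zCoeff j (rename Fin.succ a * X 0 ^ i) = if j = i then a else 0 := by
  rw [zCoeff_apply, map_mul, finSuccEquiv_rename_succ, map_pow, finSuccEquiv_X_zero,
    Polynomial.coeff_C_mul_X_pow]

theorem zCoeff_mul (i : ℕ) (p q : MvPolynomial (Fin (n + 1)) k) :
    zCoeff i (p * q) =
      ∑ x ∈ Finset.HasAntidiagonal.antidiagonal i, zCoeff x.1 p * zCoeff x.2 q := by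
  rw [zCoeff_apply, map_mul, Polynomial.coeff_mul]
  rfl

theorem exists_eq_sum_zCoeff (p : MvPolynomial (Fin (n + 1)) k) :
    ∃ N, p = ∑ i ∈ Finset.range N, rename Fin.succ (zCoeff i p) * X 0 ^ i := by
  refine ⟨(finSuccEquiv k n p).natDegree + 1, (finSuccEquiv k n).injective ?_⟩
  conv_lhs => rw [(finSuccEquiv k n p).as_sum_range_C_mul_X_pow]
  rw [map_sum]
  refine Finset.sum_congr rfl fun i _ => ?_
  rw [map_mul, finSuccEquiv_rename_succ, map_pow, finSuccEquiv_X_zero, zCoeff_apply]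

theorem weight_bidegree_cons (i : ℕ) (m : Fin n →₀ ℕ) :
    Finsupp.weight (bidegree n) (m.cons i) = (m.degree, i) := by
  rw [Finsupp.weight_apply, Finsupp.sum_fintype _ _ (by simp), Fin.sum_univ_succ]
  simp only [bidegree, Finsupp.cons_zero, Fin.cons_zero, Finsupp.cons_succ, Fin.cons_succ]
  rw [← Finset.sum_smul, Finsupp.degree_eq_sum]
  simp

/-- The bihomogeneous components of a polynomial are the homogeneous components of its
coefficients with respect to `z`. -/
theorem weightedHomogeneousComponent_bidegree (e i : ℕ) (p : MvPolynomial (Fin (n + 1)) k) :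
    weightedHomogeneousComponent (bidegree n) (e, i) p =
      rename Fin.succ (homogeneousComponent e (zCoeff i p)) * X 0 ^ i := by
  classical
  refine zCoeff_ext fun j => ?_
  rw [zCoeff_rename_mul_X_pow]
  ext m
  rw [coeff_zCoeff, coeff_weightedHomogeneousComponent, weight_bidegree_cons]
  by_cases hj : j = i
  · subst hj
    rw [if_pos rfl, coeff_homogeneousComponent, coeff_zCoeff]
    simp
  · rw [if_neg (by simp [hj]), if_neg hj, coeff_zero]

theorem isHomogeneous_iff_zCoeff {p : MvPolynomial (Fin (n + 1)) k} {D : ℕ} :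
    p.IsHomogeneous D ↔ (∀ i ≤ D, (zCoeff i p).IsHomogeneous (D - i)) ∧
      ∀ i, D < i → zCoeff i p = 0 := by
  constructor
  · intro h
    refine ⟨fun i hi => h.finSuccEquiv_coeff_isHomogeneous i (D - i) (by omega), fun i hi => ?_⟩
    ext m
    rw [coeff_zCoeff, coeff_zero]
    by_contra hne
    have := h.degree_eq_sum_deg_support (mem_support_iff.mpr hne)
    rw [← Finsupp.degree_apply, Finsupp.degree_eq_sum, Fin.sum_univ_succ, Finsupp.cons_zero] at this
    omega
  · rintro ⟨h1, h2⟩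
    obtain ⟨N, hN⟩ := exists_eq_sum_zCoeff p
    rw [hN]
    refine IsHomogeneous.sum _ _ _ fun i _ => ?_
    by_cases hi : i ≤ D
    · have := ((h1 i hi).rename_isHomogeneous (f := Fin.succ)).mul
        (isHomogeneous_X_pow (R := k) (0 : Fin (n + 1)) i)
      rwa [Nat.sub_add_cancel hi] at this
    · rw [h2 i (by omega), map_zero, zero_mul]
      exact isHomogeneous_zero _ _ _

theorem zCoeff_homogeneousComponent (i D : ℕ) (p : MvPolynomial (Fin (n + 1)) k) :
    zCoeff i (homogeneousComponent D p) =
      if i ≤ D then homogeneousComponent (D - i) (zCoeff i p) else 0 := by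
  ext m
  have hdeg : (m.cons i).degree = i + m.degree := by
    rw [Finsupp.degree_eq_sum, Finsupp.degree_eq_sum, Fin.sum_univ_succ, Finsupp.cons_zero]
    simp
  rw [coeff_zCoeff, coeff_homogeneousComponent, hdeg]
  split_ifs with h1 h2 h2
  · rw [coeff_homogeneousComponent, if_pos (by omega), coeff_zCoeff]
  · omega
  · rw [coeff_homogeneousComponent, if_neg (by omega)]
  · rw [coeff_zero]

/-- The ideal `⨁_i F_i z^i` of `B`, for an increasing family of ideals `F_i` of `A`. -/
def coefIdeal (F : ℕ → Ideal (MvPolynomial (Fin n) k)) (hF : Monotone F) :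
    Ideal (MvPolynomial (Fin (n + 1)) k) where
  carrier := {p | ∀ i, zCoeff i p ∈ F i}
  add_mem' hp hq i := by
    rw [map_add]
    exact (F i).add_mem (hp i) (hq i)
  zero_mem' i := by
    rw [map_zero]
    exact (F i).zero_mem
  smul_mem' c p hp i := by
    rw [smul_eq_mul, zCoeff_mul]
    refine (F i).sum_mem fun x hx => (F i).mul_mem_left _ (hF ?_ (hp x.2))
    exact by have := Finset.HasAntidiagonal.mem_antidiagonal.mp hx; omega

variable {F : ℕ → Ideal (MvPolynomial (Fin n) k)} {hF : Monotone F}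

theorem mem_coefIdeal {p : MvPolynomial (Fin (n + 1)) k} :
    p ∈ coefIdeal F hF ↔ ∀ i, zCoeff i p ∈ F i := Iff.rfl

theorem rename_mul_X_pow_mem_coefIdeal {a : MvPolynomial (Fin n) k} {i : ℕ} :
    rename Fin.succ a * X 0 ^ i ∈ coefIdeal F hF ↔ a ∈ F i := by
  rw [mem_coefIdeal]
  simp only [zCoeff_rename_mul_X_pow]
  constructor
  · intro h
    simpa using h i
  · intro h j
    split_ifs with hj
    · exact hj ▸ h
    · exact (F j).zero_mem

theorem coefIdeal_le {I : Ideal (MvPolynomial (Fin (n + 1)) k)}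
    (h : ∀ i, ∀ a ∈ F i, rename Fin.succ a * X 0 ^ i ∈ I) : coefIdeal F hF ≤ I := by
  intro p hp
  obtain ⟨N, hN⟩ := exists_eq_sum_zCoeff p
  rw [hN]
  exact I.sum_mem fun i _ => h i _ (hp i)

theorem finrank_gradedPiece_coefIdeal (D : ℕ) :
    finrank k (gradedPiece (coefIdeal F hF) D) =
      ∑ i ∈ Finset.range (D + 1), finrank k (gradedPiece (F i) (D - i)) := by
  let f : gradedPiece (coefIdeal F hF) D →ₗ[k]
      ((i : Fin (D + 1)) → gradedPiece (F i) (D - i)) :=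
    LinearMap.pi fun i => ((zCoeff (i : ℕ)).domRestrict _).codRestrict _ fun p =>
      ⟨p.2.1 i, (isHomogeneous_iff_zCoeff.mp p.2.2).1 i (Nat.lt_succ_iff.mp i.2)⟩
  have hf : Function.Bijective f := by
    constructor
    · rw [injective_iff_map_eq_zero]
      rintro ⟨p, hp⟩ h
      refine Subtype.ext (zCoeff_ext fun i => ?_)
      rw [ZeroMemClass.coe_zero, map_zero]
      by_cases hi : i < D + 1
      · exact congrArg Subtype.val (congrFun h ⟨i, hi⟩)
      · exact (isHomogeneous_iff_zCoeff.mp hp.2).2 i (by omega)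
    · intro a
      have hz : ∀ j, zCoeff j (∑ i : Fin (D + 1),
          rename Fin.succ (a i : MvPolynomial (Fin n) k) * X 0 ^ (i : ℕ)) =
          if h : j < D + 1 then (a ⟨j, h⟩ : MvPolynomial (Fin n) k) else 0 := by
        intro j
        simp only [map_sum, zCoeff_rename_mul_X_pow]
        split_ifs with h
        · rw [Finset.sum_eq_single ⟨j, h⟩]
          · simp
          · intro i _ hi
            exact if_neg fun e => hi (Fin.ext e.symm)
          · simp
        · exact Finset.sum_eq_zero fun i _ => if_neg (by omega)
      refine ⟨⟨∑ i : Fin (D + 1), rename Fin.succ (a i : MvPolynomial (Fin n) k) * X 0 ^ (i : ℕ),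
        fun j => ?_, isHomogeneous_iff_zCoeff.mpr ⟨fun j hj => ?_, fun j hj => ?_⟩⟩, ?_⟩
      · rw [hz]
        split_ifs with h
        · exact (a ⟨j, h⟩).2.1
        · exact (F j).zero_mem
      · rw [hz, dif_pos (by omega)]
        exact (a ⟨j, _⟩).2.2
      · rw [hz, dif_neg (by omega)]
      · funext i
        refine Subtype.ext ((hz i).trans ?_)
        rw [dif_pos i.2]
  rw [(LinearEquiv.ofBijective f hf).finrank_eq, Module.finrank_pi_fintype,
    Finset.sum_range (fun i => finrank k (gradedPiece (F i) (D - i)))]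

variable {𝔞 : Ideal (MvPolynomial (Fin n) k)} {t : ℕ∞}

theorem X_zero_pow_mem_extIdeal {i : ℕ} (hi : t ≤ i) : X 0 ^ i ∈ extIdeal 𝔞 t := by
  obtain ⟨m, rfl⟩ := ENat.ne_top_iff_exists.mp (ne_top_of_le_ne_top (ENat.natCast_ne_top i) hi)
  rw [← Nat.sub_add_cancel (Nat.cast_le.mp hi), pow_add]
  exact Ideal.mul_mem_left _ _ (Ideal.mem_sup_right (Ideal.subset_span ⟨m, rfl, rfl⟩))

theorem extIdeal_le_coefIdeal (h𝔞 : 𝔞 ≤ F 0) (htop : ∀ i : ℕ, t ≤ i → F i = ⊤) :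
    extIdeal 𝔞 t ≤ coefIdeal F hF := by
  refine sup_le (Ideal.map_le_iff_le_comap.mpr fun a ha => ?_) (Ideal.span_le.mpr ?_)
  · rw [Ideal.mem_comap]
    have := (rename_mul_X_pow_mem_coefIdeal (hF := hF) (i := 0)).mpr (h𝔞 ha)
    rwa [pow_zero, mul_one] at this
  · rintro p ⟨m, rfl, rfl⟩
    have := (rename_mul_X_pow_mem_coefIdeal (hF := hF) (a := 1) (i := m)).mpr
      (by rw [htop m le_rfl]; trivial)
    rwa [map_one, one_mul] at this

theorem extIdeal_eq_coefIdeal (𝔞 : Ideal (MvPolynomial (Fin n) k)) (t : ℕ∞) :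
    ∃ hF : Monotone fun i : ℕ => if (i : ℕ∞) < t then 𝔞 else ⊤,
      extIdeal 𝔞 t = coefIdeal (fun i : ℕ => if (i : ℕ∞) < t then 𝔞 else ⊤) hF := by
  have hF : Monotone fun i : ℕ => if (i : ℕ∞) < t then 𝔞 else ⊤ := by
    intro i j hij
    dsimp only
    split_ifs with h1 h2
    · exact le_rfl
    · exact le_top
    · exact absurd (lt_of_le_of_lt (by exact_mod_cast hij) ‹(j : ℕ∞) < t›) h1
    · exact le_rfl
  refine ⟨hF, le_antisymm (extIdeal_le_coefIdeal ?_ fun i hi => if_neg hi.not_gt)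
    (coefIdeal_le fun i a ha => ?_)⟩
  · split_ifs
    · exact le_rfl
    · exact le_top
  · split_ifs at ha with h
    · exact Ideal.mul_mem_right _ _ (Ideal.mem_sup_left (Ideal.mem_map_of_mem _ ha))
    · exact Ideal.mul_mem_left _ _ (X_zero_pow_mem_extIdeal (not_lt.mp h))

/-- The ideal `⨁_i F_i z^i` of `S`, for an increasing family of ideals `F_i` of `A`. -/
def filtIdeal (𝔞 : Ideal (MvPolynomial (Fin n) k)) (t : ℕ∞)
    (F : ℕ → Ideal (MvPolynomial (Fin n) k)) (hF : Monotone F) : Ideal (ExtRing 𝔞 t) :=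
  (coefIdeal F hF).map (Ideal.Quotient.mk (extIdeal 𝔞 t))

theorem comap_filtIdeal (h𝔞 : 𝔞 ≤ F 0) (htop : ∀ i : ℕ, t ≤ i → F i = ⊤) :
    (filtIdeal 𝔞 t F hF).comap (Ideal.Quotient.mk (extIdeal 𝔞 t)) = coefIdeal F hF :=
  Ideal.comap_map_mk (extIdeal_le_coefIdeal h𝔞 htop)

theorem hilb_filtIdeal (h𝔞 : 𝔞 ≤ F 0) (htop : ∀ i : ℕ, t ≤ i → F i = ⊤) (D : ℕ) :
    hilb (filtIdeal 𝔞 t F hF) D = ∑ i ∈ Finset.range (D + 1),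
      if (i : ℕ∞) < t then hilb ((F i).map (Ideal.Quotient.mk 𝔞)) (D - i) else 0 := by
  have h1 := hilb_add (filtIdeal 𝔞 t F hF) D
  obtain ⟨hF0, hext⟩ := extIdeal_eq_coefIdeal 𝔞 t
  have h2 : finrank k (gradedPiece (extIdeal 𝔞 t) D) = _ :=
    (congrArg (fun I => finrank k (gradedPiece I D)) hext).trans (finrank_gradedPiece_coefIdeal D)
  rw [comap_filtIdeal h𝔞 htop, finrank_gradedPiece_coefIdeal, h2] at h1
  refine Nat.add_right_cancel (h1.trans ?_)
  rw [← Finset.sum_add_distrib]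
  refine Finset.sum_congr rfl fun i _ => ?_
  by_cases h : (i : ℕ∞) < t
  · have e : (if (i : ℕ∞) < t then 𝔞 else ⊤) = 𝔞 := if_pos h
    rw [if_pos h, e]
    exact (hilb_map_add (h𝔞.trans (hF (Nat.zero_le i))) _).symm
  · have e : (if (i : ℕ∞) < t then 𝔞 else ⊤) = ⊤ := if_neg h
    rw [if_neg h, e, htop i (not_lt.mp h), zero_add]

/-- The preimage in `A` of the slice `J_⟨i⟩` of an ideal `J` of `S`. -/
def sliceIdeal (J : Ideal (ExtRing 𝔞 t)) (i : ℕ) : Ideal (MvPolynomial (Fin n) k) :=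
  (slice J i).comap (Ideal.Quotient.mk 𝔞)

theorem mem_sliceIdeal {J : Ideal (ExtRing 𝔞 t)} {i : ℕ} {a : MvPolynomial (Fin n) k} :
    a ∈ sliceIdeal J i ↔
      rename Fin.succ a * X 0 ^ i ∈ J.comap (Ideal.Quotient.mk (extIdeal 𝔞 t)) := by
  rw [sliceIdeal, Ideal.mem_comap, slice, Ideal.mem_comap, Submodule.mem_colon_singleton]
  rfl

theorem map_sliceIdeal (J : Ideal (ExtRing 𝔞 t)) (i : ℕ) :
    (sliceIdeal J i).map (Ideal.Quotient.mk 𝔞) = slice J i :=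
  Ideal.map_comap_of_surjective _ Ideal.Quotient.mk_surjective _

theorem sliceIdeal_mono (J : Ideal (ExtRing 𝔞 t)) : Monotone (sliceIdeal J) := by
  refine monotone_nat_of_le_succ fun i a ha => ?_
  rw [mem_sliceIdeal] at ha ⊢
  rw [pow_succ, ← mul_assoc]
  exact Ideal.mul_mem_right _ _ ha

theorem le_sliceIdeal (J : Ideal (ExtRing 𝔞 t)) (i : ℕ) : 𝔞 ≤ sliceIdeal J i := le_comap_mk _

theorem sliceIdeal_eq_top (J : Ideal (ExtRing 𝔞 t)) {i : ℕ} (hi : t ≤ i) : sliceIdeal J i = ⊤ := by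
  refine eq_top_iff.mpr fun a _ => ?_
  rw [mem_sliceIdeal]
  exact le_comap_mk J (Ideal.mul_mem_left _ _ (X_zero_pow_mem_extIdeal hi))

theorem sliceIdeal_filtIdeal (h𝔞 : 𝔞 ≤ F 0) (htop : ∀ i : ℕ, t ≤ i → F i = ⊤) (i : ℕ) :
    sliceIdeal (filtIdeal 𝔞 t F hF) i = F i := by
  ext a
  rw [mem_sliceIdeal, comap_filtIdeal h𝔞 htop, rename_mul_X_pow_mem_coefIdeal]

theorem homogeneousComponent_mem_sliceIdeal {J : Ideal (ExtRing 𝔞 t)} (hJ : Multigraded J)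
    {p : MvPolynomial (Fin (n + 1)) k}
    (hp : p ∈ J.comap (Ideal.Quotient.mk (extIdeal 𝔞 t))) (e i : ℕ) :
    homogeneousComponent e (zCoeff i p) ∈ sliceIdeal J i := by
  rw [mem_sliceIdeal, ← weightedHomogeneousComponent_bidegree]
  exact weightedHomogeneousComponent_mem_of_mem k _ hJ hp (e, i)

theorem comap_eq_coefIdeal {J : Ideal (ExtRing 𝔞 t)} (hJ : Multigraded J) :
    J.comap (Ideal.Quotient.mk (extIdeal 𝔞 t)) = coefIdeal (sliceIdeal J) (sliceIdeal_mono J) := by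
  refine le_antisymm (fun p hp i => ?_) (coefIdeal_le fun i a ha => mem_sliceIdeal.mp ha)
  rw [← sum_homogeneousComponent (zCoeff i p)]
  exact Ideal.sum_mem _ fun e _ => homogeneousComponent_mem_sliceIdeal hJ hp e i

theorem eq_filtIdeal {J : Ideal (ExtRing 𝔞 t)} (hJ : Multigraded J) :
    J = filtIdeal 𝔞 t (sliceIdeal J) (sliceIdeal_mono J) := by
  rw [filtIdeal, ← comap_eq_coefIdeal hJ,
    Ideal.map_comap_of_surjective _ Ideal.Quotient.mk_surjective]

theorem isHomog_sliceIdeal {J : Ideal (ExtRing 𝔞 t)} (hJ : Multigraded J) (i : ℕ) :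
    IsHomog (sliceIdeal J i) := by
  refine isHomog_of_homogeneousComponent_mem fun a ha e => ?_
  have := homogeneousComponent_mem_sliceIdeal hJ (mem_sliceIdeal.mp ha) e i
  rwa [zCoeff_rename_mul_X_pow, if_pos rfl] at this

theorem ideal_le_of_sliceIdeal_le {J J' : Ideal (ExtRing 𝔞 t)} (hJ : Multigraded J)
    (h : ∀ i : ℕ, (i : ℕ∞) < t → sliceIdeal J i ≤ sliceIdeal J' i) : J ≤ J' := by
  rw [eq_filtIdeal hJ]
  refine Ideal.map_le_iff_le_comap.mpr (coefIdeal_le fun i a ha => ?_)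
  rw [← mem_sliceIdeal]
  by_cases hi : (i : ℕ∞) < t
  · exact h i hi ha
  · rw [sliceIdeal_eq_top J' (not_lt.mp hi)]
    trivial

theorem multigraded_filtIdeal (h𝔞 : 𝔞 ≤ F 0) (htop : ∀ i : ℕ, t ≤ i → F i = ⊤)
    (hhom : ∀ i, IsHomog (F i)) : Multigraded (filtIdeal 𝔞 t F hF) := by
  rw [Multigraded, comap_filtIdeal h𝔞 htop]
  intro d p hp
  have e : (DirectSum.decompose (weightedHomogeneousSubmodule k (bidegree n)) p d :
      MvPolynomial (Fin (n + 1)) k) = weightedHomogeneousComponent (bidegree n) d p :=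
    weightedDecomposition.decompose'_apply k _ p d
  rw [e]
  rw [weightedHomogeneousComponent_bidegree, rename_mul_X_pow_mem_coefIdeal]
  exact homogeneousComponent_mem_of_mem (hhom _) (hp _) _

/-- A multigraded ideal is homogeneous for the standard grading. -/
theorem isHomog_comap_of_multigraded {J : Ideal (ExtRing 𝔞 t)} (hJ : Multigraded J) :
    IsHomog (J.comap (Ideal.Quotient.mk (extIdeal 𝔞 t))) := by
  refine isHomog_of_homogeneousComponent_mem fun p hp D => ?_
  rw [comap_eq_coefIdeal hJ] at hp ⊢
  intro i
  rw [zCoeff_homogeneousComponent]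
  split_ifs with h
  · exact homogeneousComponent_mem_of_mem (isHomog_sliceIdeal hJ i) (hp i) _
  · exact Ideal.zero_mem _

theorem maxIdeal_mul_le_iff {I I' : Ideal (MvPolynomial (Fin n) k ⧸ 𝔞)} :
    maxIdeal 𝔞 * I ≤ I' ↔ ∀ l, ∀ a ∈ I.comap (Ideal.Quotient.mk 𝔞),
      X l * a ∈ I'.comap (Ideal.Quotient.mk 𝔞) := by
  constructor
  · intro h l a ha
    rw [Ideal.mem_comap, map_mul]
    exact h (Ideal.mul_mem_mul (Ideal.subset_span ⟨l, rfl⟩) ha)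
  · intro h
    refine Ideal.mul_le.mpr fun x hx y hy => ?_
    refine Submodule.span_induction (p := fun x _ => x * y ∈ I') ?_ ?_ ?_ ?_ hx
    · rintro _ ⟨l, rfl⟩
      obtain ⟨a, rfl⟩ := Ideal.Quotient.mk_surjective y
      have := h l a hy
      rwa [Ideal.mem_comap, map_mul] at this
    · rw [zero_mul]
      exact I'.zero_mem
    · intro u v _ _ hu hv
      rw [add_mul]
      exact I'.add_mem hu hv
    · intro c u _ hu
      rw [smul_eq_mul, mul_assoc]
      exact I'.mul_mem_left _ hu

theorem ZStable.X_mul_mem {J : Ideal (ExtRing 𝔞 t)} (hJ : ZStable J) {i : ℕ}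
    (hi : ((i + 1 : ℕ) : ℕ∞) < t) (l : Fin n) {a : MvPolynomial (Fin n) k}
    (ha : a ∈ sliceIdeal J (i + 1)) : X l * a ∈ sliceIdeal J i :=
  maxIdeal_mul_le_iff.mp (hJ.2 (i + 1) (Nat.succ_pos i) hi) l a ha

theorem zStable_filtIdeal (h𝔞 : 𝔞 ≤ F 0) (htop : ∀ i : ℕ, t ≤ i → F i = ⊤)
    (hhom : ∀ i, IsHomog (F i))
    (hst : ∀ i : ℕ, ((i + 1 : ℕ) : ℕ∞) < t → ∀ l, ∀ a ∈ F (i + 1), X l * a ∈ F i) :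
    ZStable (filtIdeal 𝔞 t F hF) := by
  refine ⟨multigraded_filtIdeal h𝔞 htop hhom, fun i hi hit => maxIdeal_mul_le_iff.mpr ?_⟩
  obtain ⟨i, rfl⟩ : ∃ j, i = j + 1 := ⟨i - 1, by omega⟩
  have := hst i hit
  rw [← sliceIdeal_filtIdeal (hF := hF) h𝔞 htop, ← sliceIdeal_filtIdeal (hF := hF) h𝔞 htop] at this
  exact this

theorem hilb_eq_sum {J : Ideal (ExtRing 𝔞 t)} (hJ : Multigraded J) (D : ℕ) :
    hilb J D = ∑ i ∈ Finset.range (D + 1),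
      if (i : ℕ∞) < t then hilb (slice J i) (D - i) else 0 := by
  conv_lhs => rw [eq_filtIdeal hJ]
  rw [hilb_filtIdeal (le_sliceIdeal J 0) fun i => sliceIdeal_eq_top J]
  simp only [map_sliceIdeal]

theorem hilb_sup_span_eq_sum {J : Ideal (ExtRing 𝔞 t)} (hJ : Multigraded J) (s D : ℕ) :
    hilb (J ⊔ Ideal.span {zElt 𝔞 t ^ s}) D = ∑ i ∈ Finset.range (D + 1),
      if (i : ℕ∞) < t then if i < s then hilb (slice J i) (D - i) else totalHilb 𝔞 (D - i)
        else 0 := by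
  have hG : Monotone fun i => if i < s then sliceIdeal J i else ⊤ := by
    intro i j hij
    dsimp only
    split_ifs with h1 h2
    · exact sliceIdeal_mono J hij
    · exact le_top
    · omega
    · exact le_rfl
  have hle : 𝔞 ≤ (fun i => if i < s then sliceIdeal J i else ⊤) 0 := by
    dsimp only
    split_ifs
    · exact le_sliceIdeal J 0
    · exact le_top
  have htop : ∀ i : ℕ, t ≤ i → (fun i => if i < s then sliceIdeal J i else ⊤) i = ⊤ := by
    intro i hi
    dsimp only
    split_ifs
    · exact sliceIdeal_eq_top J hi
    · rfl
  have heq : J ⊔ Ideal.span {zElt 𝔞 t ^ s} =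
      filtIdeal 𝔞 t (fun i => if i < s then sliceIdeal J i else ⊤) hG := by
    refine le_antisymm (sup_le ?_ ?_)
      (Ideal.map_le_iff_le_comap.mpr (coefIdeal_le fun i a ha => ?_))
    · refine ideal_le_of_sliceIdeal_le hJ fun i _ => ?_
      rw [sliceIdeal_filtIdeal hle htop]
      split_ifs
      · exact le_rfl
      · exact le_top
    · rw [Ideal.span_singleton_le_iff_mem]
      have : rename Fin.succ (1 : MvPolynomial (Fin n) k) * X 0 ^ s ∈
          coefIdeal (fun i => if i < s then sliceIdeal J i else ⊤) hG := by
        rw [rename_mul_X_pow_mem_coefIdeal, if_neg (lt_irrefl s)]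
        trivial
      rw [map_one, one_mul] at this
      exact Ideal.mem_map_of_mem _ this
    · split_ifs at ha with h
      · exact Ideal.mem_sup_left (mem_sliceIdeal.mp ha)
      · refine Ideal.mem_sup_right ?_
        rw [map_mul, map_pow]
        exact Ideal.mul_mem_left _ _ (Ideal.mem_span_singleton.mpr (pow_dvd_pow _ (not_lt.mp h)))
  rw [heq, hilb_filtIdeal hle htop]
  refine Finset.sum_congr rfl fun i _ => ?_
  split_ifs
  · rw [map_sliceIdeal]
  · rw [Ideal.map_top]
    rfl
  · rfl

end Slices

/-! ### The induced embedding -/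

section Induced

variable {k : Type*} [Field k] {n : ℕ} {𝔞 : Ideal (MvPolynomial (Fin n) k)} {t : ℕ∞}

theorem isGrowthBound (h𝔞 : IsHomog 𝔞) : IsGrowthBound (totalHilb 𝔞) (growth 𝔞) where
  mono _ _ _ := growth_mono
  le_top _ _ := growth_le_totalHilb
  zero := growth_zero h𝔞

/-- The dimension of the part of degree `i` in `z` of the degree `D` piece of a multigraded
ideal `J` of `S`. -/
def sliceDim (J : Ideal (ExtRing 𝔞 t)) (D i : ℕ) : ℕ :=
  if (i : ℕ∞) < t then hilb (slice J i) (D - i) else 0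

theorem sliceDim_le_cap (J : Ideal (ExtRing 𝔞 t)) (D i : ℕ) :
    sliceDim J D i ≤ cap (totalHilb 𝔞) t D i := by
  unfold sliceDim cap
  split_ifs
  · exact hilb_le_totalHilb _ _
  · exact le_rfl

theorem ZStable.admissible (h𝔞 : IsHomog 𝔞) {J : Ideal (ExtRing 𝔞 t)} (hJ : ZStable J) (D : ℕ) :
    Admissible (totalHilb 𝔞) (growth 𝔞) t D (sliceDim J D) where
  le_cap i _ := sliceDim_le_cap J D i
  growth i hi := by
    unfold sliceDim
    by_cases h : ((i + 1 : ℕ) : ℕ∞) < t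
    · have h' : (i : ℕ∞) < t := lt_of_le_of_lt (by exact_mod_cast Nat.le_succ i) h
      rw [if_pos h, if_pos h', ← map_sliceIdeal, ← map_sliceIdeal,
        show D - i = D - (i + 1) + 1 by omega]
      refine growth_le_of_X_mul h𝔞 (le_sliceIdeal J _) (le_sliceIdeal J _) fun l p hp => ?_
      exact ⟨hJ.X_mul_mem h l hp.1, (X_mul_mem_gradedPiece l hp).2⟩
    · rw [if_neg h, growth_zero h𝔞]
      exact Nat.zero_le _

theorem sum_sliceDim {J : Ideal (ExtRing 𝔞 t)} (hJ : Multigraded J) (D : ℕ) :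
    ∑ i ∈ Finset.range (D + 1), sliceDim J D i = hilb J D := (hilb_eq_sum hJ D).symm

theorem exists_greedy_stabHilbPoset (h𝔞 : IsHomog 𝔞) (H : stabHilbPoset 𝔞 t) (D : ℕ) :
    ∃ b, Greedy (totalHilb 𝔞) (growth 𝔞) t D b ∧ ∑ i ∈ Finset.range (D + 1), b i = H.1 D := by
  refine exists_greedy (isGrowthBound h𝔞) ?_
  obtain ⟨J, hJ, hJH⟩ := H.2
  rw [← hJH, ← sum_sliceDim hJ.1]
  exact Finset.sum_le_sum fun i _ => sliceDim_le_cap J D i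

/-- The greedy dimension vector in degree `D` of sum `H D`. -/
def greedyVector (h𝔞 : IsHomog 𝔞) (H : stabHilbPoset 𝔞 t) (D : ℕ) : ℕ → ℕ :=
  (exists_greedy_stabHilbPoset h𝔞 H D).choose

theorem greedy_greedyVector (h𝔞 : IsHomog 𝔞) (H : stabHilbPoset 𝔞 t) (D : ℕ) :
    Greedy (totalHilb 𝔞) (growth 𝔞) t D (greedyVector h𝔞 H D) :=
  (exists_greedy_stabHilbPoset h𝔞 H D).choose_spec.1

theorem sum_greedyVector (h𝔞 : IsHomog 𝔞) (H : stabHilbPoset 𝔞 t) (D : ℕ) :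
    ∑ i ∈ Finset.range (D + 1), greedyVector h𝔞 H D i = H.1 D :=
  (exists_greedy_stabHilbPoset h𝔞 H D).choose_spec.2

/-- The greedy vector in degree `D + 1` contains the ideal generated by the one in degree `D`,
because the degree `D + 1` piece of any `z`-stable ideal with Hilbert series `H` is large enough. -/
theorem shiftVector_greedyVector_le (h𝔞 : IsHomog 𝔞) (ht : 1 ≤ t) (H : stabHilbPoset 𝔞 t) (D : ℕ)
    {i : ℕ} (hi : i ≤ D + 1) :
    shiftVector (growth 𝔞) t D (greedyVector h𝔞 H D) i ≤ greedyVector h𝔞 H (D + 1) i := by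
  have hg := isGrowthBound h𝔞
  refine ((greedy_greedyVector h𝔞 H D).shiftVector hg ht).le_of_sum_le
    (greedy_greedyVector h𝔞 H (D + 1)) ?_ hi
  obtain ⟨J, hJ, hJH⟩ := H.2
  rw [sum_greedyVector, ← hJH, ← sum_sliceDim hJ.1]
  refine sum_shiftVector_le hg (greedy_greedyVector h𝔞 H D) (hJ.admissible h𝔞 D) ?_ ?_ ?_
  · rw [sum_greedyVector, ← hJH, sum_sliceDim hJ.1]
  · have h0 : ((0 : ℕ) : ℕ∞) < t := by exact_mod_cast lt_of_lt_of_le zero_lt_one ht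
    rw [sliceDim, sliceDim, if_pos h0, if_pos h0, ← map_sliceIdeal]
    exact growth_le_of_X_mul h𝔞 (le_sliceIdeal J 0) (le_sliceIdeal J 0) fun l p hp =>
      X_mul_mem_gradedPiece l hp
  · intro i hi hit
    have hit' : (i : ℕ∞) < t := lt_of_le_of_lt (by exact_mod_cast Nat.le_succ i) hit
    rw [sliceDim, sliceDim, if_pos hit, if_pos hit', Nat.add_sub_add_right]
    rw [← map_sliceIdeal, ← map_sliceIdeal]
    exact hilb_mono (Ideal.map_mono (sliceIdeal_mono J (Nat.le_succ i))) _

/-- The Hilbert series of the slices of the ideal of `S` attached to `H`. -/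
def sliceSeries (h𝔞 : IsHomog 𝔞) (H : stabHilbPoset 𝔞 t) (i e : ℕ) : ℕ :=
  greedyVector h𝔞 H (i + e) i

theorem sliceSeries_mono (h𝔞 : IsHomog 𝔞) (ht : 1 ≤ t) (H : stabHilbPoset 𝔞 t) {i : ℕ}
    (hi : ((i + 1 : ℕ) : ℕ∞) < t) : sliceSeries h𝔞 H i ≤ sliceSeries h𝔞 H (i + 1) := by
  intro e
  have := shiftVector_greedyVector_le h𝔞 ht H (i + e) (i := i + 1) (by omega)
  simp only [shiftVector, if_pos hi] at this
  rwa [sliceSeries, sliceSeries, show i + 1 + e = i + e + 1 by omega]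

theorem growth_sliceSeries_le (h𝔞 : IsHomog 𝔞) (H : stabHilbPoset 𝔞 t) (i e : ℕ) :
    growth 𝔞 e (sliceSeries h𝔞 H (i + 1) e) ≤ sliceSeries h𝔞 H i (e + 1) := by
  have := (greedy_greedyVector h𝔞 H (i + 1 + e)).growth i (by omega)
  rw [Nat.add_sub_cancel_left] at this
  rwa [sliceSeries, sliceSeries, show i + (e + 1) = i + 1 + e by omega]

variable {εR : hilbPoset 𝔞 ↪o HomogIdeal 𝔞}

theorem sliceSeries_mem (h𝔞 : IsHomog 𝔞) (hεR : IsSection εR) (ht : 1 ≤ t)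
    (H : stabHilbPoset 𝔞 t) {i : ℕ} (hi : (i : ℕ∞) < t) : sliceSeries h𝔞 H i ∈ hilbPoset 𝔞 := by
  refine mem_hilbPoset_of_growth h𝔞 hεR (fun e => ?_) fun e => ?_
  · have := ((greedy_greedyVector h𝔞 H (i + e)).le_cap i (by omega)).trans (cap_le _ _)
    rwa [Nat.add_sub_cancel_left] at this
  · cases i with
    | zero =>
      have := shiftVector_greedyVector_le h𝔞 ht H e (i := 0) (Nat.zero_le _)
      rw [sliceSeries, sliceSeries, Nat.zero_add, Nat.zero_add]
      exact this
    | succ i => exact (growth_sliceSeries_le h𝔞 H i e).trans (sliceSeries_mono h𝔞 ht H hi _)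

theorem X_mul_mem_of_gradedPiece {I I' : Ideal (MvPolynomial (Fin n) k)} (hI : IsHomog I)
    {l : Fin n} (h : ∀ d, ∀ p ∈ gradedPiece I d, X l * p ∈ I') {p : MvPolynomial (Fin n) k}
    (hp : p ∈ I) : X l * p ∈ I' := by
  rw [← sum_homogeneousComponent p, Finset.mul_sum]
  exact I'.sum_mem fun d _ => h d _
    ⟨homogeneousComponent_mem_of_mem hI hp d, homogeneousComponent_isHomogeneous d p⟩

/-- For every Hilbert series `H` of a `z`-stable ideal there is a `z`-stable ideal whose slices are
the ideals attached by `ε_R` to the greedy dimensions. -/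
theorem exists_ideal_of_sliceSeries (h𝔞 : IsHomog 𝔞) (hεR : IsSection εR) (ht : 1 ≤ t)
    (H : stabHilbPoset 𝔞 t) :
    ∃ L : Ideal (ExtRing 𝔞 t), ZStable L ∧ ∀ (i : ℕ) (hi : (i : ℕ∞) < t),
      slice L i = (εR ⟨sliceSeries h𝔞 H i, sliceSeries_mem h𝔞 hεR ht H hi⟩).1 := by
  let F : ℕ → Ideal (MvPolynomial (Fin n) k) := fun i =>
    if hi : (i : ℕ∞) < t then
      epsIdeal εR ⟨sliceSeries h𝔞 H i, sliceSeries_mem h𝔞 hεR ht H hi⟩ else ⊤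
  have hFpos : ∀ (i : ℕ) (hi : (i : ℕ∞) < t),
      F i = epsIdeal εR ⟨sliceSeries h𝔞 H i, sliceSeries_mem h𝔞 hεR ht H hi⟩ :=
    fun i hi => dif_pos hi
  have hlt : ∀ i : ℕ, ((i + 1 : ℕ) : ℕ∞) < t → (i : ℕ∞) < t := fun i hi =>
    lt_of_le_of_lt (by exact_mod_cast Nat.le_succ i) hi
  have htop : ∀ i : ℕ, t ≤ i → F i = ⊤ := fun i hi => dif_neg hi.not_gt
  have hF : Monotone F := by
    refine monotone_nat_of_le_succ fun i => ?_
    by_cases hi : ((i + 1 : ℕ) : ℕ∞) < t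
    · rw [hFpos _ hi, hFpos _ (hlt i hi)]
      exact epsIdeal_mono εR (sliceSeries_mono h𝔞 ht H hi)
    · rw [htop _ (not_lt.mp hi)]
      exact le_top
  have h𝔞F : 𝔞 ≤ F 0 := by
    rw [hFpos 0 (by exact_mod_cast lt_of_lt_of_le zero_lt_one ht)]
    exact le_epsIdeal εR _
  refine ⟨filtIdeal 𝔞 t F hF, zStable_filtIdeal h𝔞F htop (fun i => ?_) ?_, fun i hi => ?_⟩
  · by_cases hi : (i : ℕ∞) < t
    · rw [hFpos i hi]
      exact isHomog_epsIdeal εR _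
    · rw [htop i (not_lt.mp hi)]
      exact isHomog_of_homogeneousComponent_mem fun _ _ _ => trivial
  · intro i hi l a ha
    rw [hFpos _ hi] at ha
    rw [hFpos _ (hlt i hi)]
    refine X_mul_mem_of_gradedPiece (isHomog_epsIdeal εR _) (fun d p hp => ?_) ha
    exact (X_mul_mem_epsIdeal h𝔞 hεR (growth_sliceSeries_le h𝔞 H i d) l hp).1
  · rw [← map_sliceIdeal, sliceIdeal_filtIdeal h𝔞F htop, hFpos i hi, epsIdeal,
      Ideal.map_comap_of_surjective _ Ideal.Quotient.mk_surjective]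

theorem sliceDim_eq_greedyVector (h𝔞 : IsHomog 𝔞) (hεR : IsSection εR) (ht : 1 ≤ t)
    {H : stabHilbPoset 𝔞 t} {L : Ideal (ExtRing 𝔞 t)}
    (hL : ∀ (i : ℕ) (hi : (i : ℕ∞) < t),
      slice L i = (εR ⟨sliceSeries h𝔞 H i, sliceSeries_mem h𝔞 hεR ht H hi⟩).1) {D i : ℕ}
    (hi : i ≤ D) : sliceDim L D i = greedyVector h𝔞 H D i := by
  unfold sliceDim
  split_ifs with hit
  · rw [hL i hit, hεR]
    change sliceSeries h𝔞 H i (D - i) = _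
    rw [sliceSeries, Nat.add_sub_cancel' hi]
  · have := (greedy_greedyVector h𝔞 H D).le_cap i hi
    rw [cap, if_neg hit] at this
    omega

theorem hilb_sup_span_eq {J : Ideal (ExtRing 𝔞 t)} (hJ : Multigraded J) (s D : ℕ) :
    hilb (J ⊔ Ideal.span {zElt 𝔞 t ^ s}) D =
      ∑ i ∈ Finset.range (min s (D + 1)), sliceDim J D i +
        ∑ i ∈ Finset.Ico (min s (D + 1)) (D + 1), cap (totalHilb 𝔞) t D i := by
  rw [hilb_sup_span_eq_sum hJ, ← Finset.sum_range_add_sum_Ico _ (min_le_right s (D + 1))]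
  congr 1
  · refine Finset.sum_congr rfl fun i hi => ?_
    have := Finset.mem_range.mp hi
    rw [if_pos (show i < s by omega), sliceDim]
  · refine Finset.sum_congr rfl fun i hi => ?_
    have := Finset.mem_Ico.mp hi
    rw [if_neg (show ¬ i < s by omega), cap]

theorem sliceDim_eq_zero (J : Ideal (ExtRing 𝔞 t)) (D : ℕ) {i : ℕ} (hi : t ≤ i) :
    sliceDim J D i = 0 := if_neg hi.not_gt

theorem multigraded_eq_of_slice_eq {J J' : Ideal (ExtRing 𝔞 t)} (hJ : Multigraded J)
    (hJ' : Multigraded J') (h : ∀ i : ℕ, (i : ℕ∞) < t → slice J i = slice J' i) : J = J' := by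
  refine le_antisymm (ideal_le_of_sliceIdeal_le hJ fun i hi => ?_)
    (ideal_le_of_sliceIdeal_le hJ' fun i hi => ?_)
  · rw [sliceIdeal, h i hi]
    exact le_rfl
  · rw [sliceIdeal, ← h i hi]
    exact le_rfl

/-- The ideals with greedy slices form an embedding with the required properties,
because greedy vectors of different sums are comparable and have the least partial sums among the
admissible ones. -/
theorem exists_isInduced (h𝔞 : IsHomog 𝔞) (hεR : IsSection εR) (ht : 1 ≤ t) :
    ∃ εS : stabHilbPoset 𝔞 t ↪o HomogIdeal (extIdeal 𝔞 t), IsInduced εR εS := by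
  choose L hstab hslice using fun H => exists_ideal_of_sliceSeries h𝔞 hεR ht (t := t) H
  have hhilb : ∀ H, hilb (L H) = H.1 := by
    intro H
    funext D
    rw [← sum_sliceDim (hstab H).1, ← sum_greedyVector h𝔞 H D]
    refine Finset.sum_congr rfl fun i hi => ?_
    exact sliceDim_eq_greedyVector h𝔞 hεR ht (hslice H)
      (Nat.lt_succ_iff.mp (Finset.mem_range.mp hi))
  have hle : ∀ H H', (⟨L H, isHomog_comap_of_multigraded (hstab H).1⟩ : HomogIdeal (extIdeal 𝔞 t)) ≤
      ⟨L H', isHomog_comap_of_multigraded (hstab H').1⟩ ↔ H ≤ H' := by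
    intro H H'
    constructor
    · intro h
      have h1 : hilb (L H) ≤ hilb (L H') := hilb_mono h
      rw [hhilb, hhilb] at h1
      exact h1
    · intro h
      refine ideal_le_of_sliceIdeal_le (hstab H).1 fun i hi => ?_
      rw [sliceIdeal, sliceIdeal, hslice H i hi, hslice H' i hi]
      refine epsIdeal_mono εR fun e => ?_
      refine (greedy_greedyVector h𝔞 H (i + e)).le_of_sum_le (greedy_greedyVector h𝔞 H' (i + e)) ?_
        (by omega)
      rw [sum_greedyVector, sum_greedyVector]
      exact h (i + e)
  refine ⟨OrderEmbedding.ofMapLEIff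
    (fun H => ⟨L H, isHomog_comap_of_multigraded (hstab H).1⟩) hle, hhilb, hstab,
    fun H i hi => ⟨_, (hslice H i hi).symm⟩, fun J hJ s _ D => ?_⟩
  change hilb (L (stabHilb J hJ) ⊔ _) D ≤ _
  rw [hilb_sup_span_eq (hstab _).1, hilb_sup_span_eq hJ.1]
  refine Nat.add_le_add_right ?_ _
  have hsum : ∑ i ∈ Finset.range (min s (D + 1)), sliceDim (L (stabHilb J hJ)) D i =
      ∑ i ∈ Finset.range (min s (D + 1)), greedyVector h𝔞 (stabHilb J hJ) D i := by
    refine Finset.sum_congr rfl fun i hi => ?_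
    have := Finset.mem_range.mp hi
    exact sliceDim_eq_greedyVector h𝔞 hεR ht (hslice _) (by omega)
  rw [hsum]
  refine (greedy_greedyVector h𝔞 _ D).sum_range_le (hJ.admissible h𝔞 D) ?_ (min_le_right _ _)
  rw [sum_greedyVector, sum_sliceDim hJ.1]
  rfl

variable {εS : stabHilbPoset 𝔞 t ↪o HomogIdeal (extIdeal 𝔞 t)}

/-- The condition on `H_{J + (z^s)}` compares the partial sums of the dimensions of the slices. -/
theorem IsInduced.sum_sliceDim_le (hS : IsInduced εR εS) {J : Ideal (ExtRing 𝔞 t)} (hJ : ZStable J)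
    {D s : ℕ} (hs : s ≤ D + 1) :
    ∑ i ∈ Finset.range s, sliceDim (εS (stabHilb J hJ)).1 D i ≤
      ∑ i ∈ Finset.range s, sliceDim J D i := by
  have hL := (hS.zStable (stabHilb J hJ)).1
  by_cases hst : (s : ℕ∞) < t
  · have := hS.restriction J hJ s hst D
    rw [hilb_sup_span_eq hL, hilb_sup_span_eq hJ.1, min_eq_left hs] at this
    exact Nat.le_of_add_le_add_right this
  · have key : ∀ I : Ideal (ExtRing 𝔞 t), Multigraded I →
        ∑ i ∈ Finset.range s, sliceDim I D i = hilb I D := by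
      intro I hI
      rw [← sum_sliceDim hI, ← Finset.sum_range_add_sum_Ico _ hs,
        Finset.sum_eq_zero (s := Finset.Ico s (D + 1)), add_zero]
      intro i hi
      refine sliceDim_eq_zero I D ((not_lt.mp hst).trans ?_)
      exact_mod_cast (Finset.mem_Ico.mp hi).1
    rw [key _ hL, key J hJ.1, hS.isSection]
    exact le_rfl

/-- Two induced embeddings have the same partial sums of dimensions of slices, as each satisfies the
condition on `H_{J + (z^s)}` for the values of the other; and the slices are determined by their
Hilbert series. -/
theorem IsInduced.unique (hεR : IsSection εR) {εS' : stabHilbPoset 𝔞 t ↪o HomogIdeal (extIdeal 𝔞 t)}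
    (hS : IsInduced εR εS) (hS' : IsInduced εR εS') : εS = εS' := by
  ext H : 1
  have hle : ∀ {ε ε' : stabHilbPoset 𝔞 t ↪o HomogIdeal (extIdeal 𝔞 t)}, IsInduced εR ε →
      IsInduced εR ε' → ∀ {D s : ℕ}, s ≤ D + 1 →
      ∑ i ∈ Finset.range s, sliceDim (ε H).1 D i ≤ ∑ i ∈ Finset.range s, sliceDim (ε' H).1 D i := by
    intro ε ε' h h' D s hs
    have e : stabHilb (ε' H).1 (h'.zStable H) = H := Subtype.ext (h'.isSection H)
    have := h.sum_sliceDim_le (h'.zStable H) hs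
    rwa [e] at this
  have heq : ∀ {D s : ℕ}, s ≤ D + 1 →
      ∑ i ∈ Finset.range s, sliceDim (εS H).1 D i = ∑ i ∈ Finset.range s, sliceDim (εS' H).1 D i :=
    fun hs => le_antisymm (hle hS hS' hs) (hle hS' hS hs)
  refine Subtype.ext (multigraded_eq_of_slice_eq (hS.zStable H).1 (hS'.zStable H).1 fun i hi => ?_)
  obtain ⟨P, hP⟩ := hS.slice_mem_range H i hi
  obtain ⟨P', hP'⟩ := hS'.slice_mem_range H i hi
  have : P = P' := by
    refine Subtype.ext (funext fun e => ?_)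
    have h1 := heq (D := i + e) (s := i) (by omega)
    have h2 := heq (D := i + e) (s := i + 1) (by omega)
    rw [Finset.sum_range_succ, Finset.sum_range_succ, h1] at h2
    have h3 := Nat.add_left_cancel h2
    rwa [sliceDim, sliceDim, if_pos hi, if_pos hi, Nat.add_sub_cancel_left, ← hP, ← hP', hεR,
      hεR] at h3
  rw [← hP, ← hP', this]

end Induced

/-! ### Betti numbers and ranks of Koszul differentials -/

theorem koszulD_comp {k : Type*} [Field k] {n : ℕ} {M M' : Type*} [AddCommGroup M] [AddCommGroup M']
    [Module (MvPolynomial (Fin n) k) M] [Module (MvPolynomial (Fin n) k) M']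
    (f : M →ₗ[MvPolynomial (Fin n) k] M') (x : Finset (Fin n) → M) :
    koszulD k n M' (fun T => f (x T)) = fun T => f (koszulD k n M x T) := by
  funext T
  simp only [koszulD_apply, map_sum, map_zsmul, map_smul]

section Ranks

variable {k : Type*} [Field k] {n : ℕ}
variable {M : Type*} [AddCommGroup M] [Module k M] {M' : Type*} [AddCommGroup M'] [Module k M']
variable {𝓜 : ℕ → Submodule k M} {𝓜' : ℕ → Submodule k M'}

theorem mem_koszulChains {i j : ℕ} {x : Finset (Fin n) → M} :
    x ∈ koszulChains 𝓜 i j ↔ ∀ T, (T.card = i ∧ i ≤ j → x T ∈ 𝓜 (j - i)) ∧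
      (¬ (T.card = i ∧ i ≤ j) → x T = 0) := by
  unfold koszulChains
  simp only [Submodule.mem_pi, Set.mem_univ, true_imp_iff]
  refine forall_congr' fun T => ?_
  by_cases h : T.card = i ∧ i ≤ j
  · rw [if_pos h]
    simp [h]
  · rw [if_neg h, Submodule.mem_bot]
    simp [h]

theorem koszulChains_eq_bot {i j : ℕ} (h : j < i) : koszulChains (n := n) 𝓜 i j = ⊥ := by
  refine (Submodule.eq_bot_iff _).mpr fun x hx => funext fun T => ?_
  exact (mem_koszulChains.mp hx T).2 fun h' => by omega

variable (𝓜) in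
/-- The space of Koszul chains as a product. -/
def koszulChainsEquiv (i j : ℕ) : koszulChains (n := n) 𝓜 i j ≃ₗ[k]
    ((T : Finset (Fin n)) → ↥(if T.card = i ∧ i ≤ j then 𝓜 (j - i) else ⊥ : Submodule k M)) where
  toFun x T := ⟨x.1 T, x.2 T trivial⟩
  map_add' _ _ := rfl
  map_smul' _ _ := rfl
  invFun y := ⟨fun T => (y T).1, fun T _ => (y T).2⟩
  left_inv _ := rfl
  right_inv _ := rfl

section Finite

variable [∀ d, Module.Finite k (𝓜 d)]

instance finite_koszulChains (i j : ℕ) : Module.Finite k (koszulChains (n := n) 𝓜 i j) := by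
  have : ∀ T : Finset (Fin n), Module.Finite k
      ↥(if T.card = i ∧ i ≤ j then 𝓜 (j - i) else ⊥ : Submodule k M) := by
    intro T
    by_cases h : T.card = i ∧ i ≤ j
    · rw [if_pos h]
      infer_instance
    · rw [if_neg h]
      infer_instance
  exact Module.Finite.equiv (koszulChainsEquiv 𝓜 i j).symm

theorem finrank_koszulChains {i j : ℕ} (hij : i ≤ j) :
    finrank k (koszulChains (n := n) 𝓜 i j) = n.choose i * finrank k (𝓜 (j - i)) := by
  have : ∀ T : Finset (Fin n), Module.Finite k
      ↥(if T.card = i ∧ i ≤ j then 𝓜 (j - i) else ⊥ : Submodule k M) := by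
    intro T
    by_cases h : T.card = i ∧ i ≤ j
    · rw [if_pos h]
      infer_instance
    · rw [if_neg h]
      infer_instance
  have hT : ∀ T : Finset (Fin n),
      finrank k ↥(if T.card = i ∧ i ≤ j then 𝓜 (j - i) else ⊥ : Submodule k M) =
      if T.card = i then finrank k (𝓜 (j - i)) else 0 := by
    intro T
    by_cases h : T.card = i
    · rw [if_pos ⟨h, hij⟩, if_pos h]
    · rw [if_neg fun h' => h h'.1, if_neg h, finrank_bot]
  rw [(koszulChainsEquiv 𝓜 i j).finrank_eq, Module.finrank_pi_fintype]
  simp only [hT]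
  rw [← Finset.sum_filter, Finset.sum_const, Finset.univ_filter_card_eq, Finset.card_powersetCard,
    Finset.card_univ, Fintype.card_fin, smul_eq_mul]

end Finite

variable [Module (MvPolynomial (Fin n) k) M] [Module (MvPolynomial (Fin n) k) M']

variable (n 𝓜) in
/-- `𝓜` is compatible with the grading of the polynomial ring. -/
def IsGradedPieces : Prop :=
  ∀ d, ∀ l : Fin n, ∀ m ∈ 𝓜 d, (X l : MvPolynomial (Fin n) k) • m ∈ 𝓜 (d + 1)

theorem koszulD_mem_koszulChains (h𝓜 : IsGradedPieces n 𝓜) {i j : ℕ} {x : Finset (Fin n) → M}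
    (hx : x ∈ koszulChains 𝓜 (i + 1) j) : koszulD k n M x ∈ koszulChains 𝓜 i j := by
  rw [mem_koszulChains] at hx ⊢
  refine fun T => ⟨fun hT => ?_, fun hT => ?_⟩
  · rw [koszulD_apply]
    refine (𝓜 (j - i)).sum_mem fun l hl => ?_
    rw [Finset.mem_compl] at hl
    refine (𝓜 (j - i)).smul_of_tower_mem _ ?_
    have hc := Finset.card_insert_of_notMem hl
    by_cases hj : i + 1 ≤ j
    · have := h𝓜 _ l _ ((hx (insert l T)).1 ⟨by omega, hj⟩)
      rwa [show j - (i + 1) + 1 = j - i by omega] at this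
    · rw [(hx (insert l T)).2 (by omega), smul_zero]
      exact zero_mem _
  · rw [koszulD_apply]
    refine Finset.sum_eq_zero fun l hl => ?_
    rw [Finset.mem_compl] at hl
    have hc := Finset.card_insert_of_notMem hl
    rw [(hx (insert l T)).2 (by omega), smul_zero, smul_zero]

variable [IsScalarTower k (MvPolynomial (Fin n) k) M]
  [IsScalarTower k (MvPolynomial (Fin n) k) M']

theorem koszulBoundaries_le (h𝓜 : IsGradedPieces n 𝓜) (i j : ℕ) :
    koszulBoundaries (n := n) 𝓜 i j ≤ koszulCycles 𝓜 i j := by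
  rintro _ ⟨x, hx, rfl⟩
  exact ⟨koszulD_mem_koszulChains h𝓜 hx, koszulD_koszulD x⟩

variable (n 𝓜) in
/-- The rank of the Koszul differential on the chains of homological degree `i` and internal degree
`j`. -/
def koszulRank (i j : ℕ) : ℕ :=
  finrank k ((koszulChains (n := n) 𝓜 i j).map ((koszulD k n M).restrictScalars k))

theorem gradedBetti_add_koszulRank [∀ d, Module.Finite k (𝓜 d)] (h𝓜 : IsGradedPieces n 𝓜)
    (i j : ℕ) :
    gradedBetti (n := n) 𝓜 i j + koszulRank n 𝓜 (i + 1) j + koszulRank n 𝓜 i j =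
      finrank k (koszulChains (n := n) 𝓜 i j) := by
  have h1 := finrank_map_add_finrank_inf_ker ((koszulD k n M).restrictScalars k)
    (koszulChains (n := n) 𝓜 i j)
  have : Module.Finite k (koszulCycles (n := n) 𝓜 i j) :=
    Submodule.finiteDimensional_of_le (inf_le_left : _ ≤ koszulChains 𝓜 i j)
  have h2 := ((koszulBoundaries (n := n) 𝓜 i j).submoduleOf
    (koszulCycles 𝓜 i j)).finrank_quotient_add_finrank
  rw [(Submodule.submoduleOfEquivOfLe (koszulBoundaries_le h𝓜 i j)).finrank_eq] at h2
  unfold gradedBetti koszulRank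
  unfold koszulCycles koszulBoundaries at h2 ⊢
  omega

theorem map_koszulChains {f : M →ₗ[MvPolynomial (Fin n) k] M'}
    (hf : ∀ d, (𝓜 d).map (f.restrictScalars k) = 𝓜' d) (i j : ℕ) :
    (koszulChains (n := n) 𝓜 i j).map ((f.restrictScalars k).compLeft (Finset (Fin n))) =
      koszulChains 𝓜' i j := by
  ext y
  constructor
  · rintro ⟨x, hx, rfl⟩
    rw [SetLike.mem_coe, mem_koszulChains] at hx
    refine mem_koszulChains.mpr fun T => ⟨fun hT => ?_, fun hT => ?_⟩
    · rw [← hf]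
      exact ⟨x T, (hx T).1 hT, rfl⟩
    · change f (x T) = 0
      rw [(hx T).2 hT, map_zero]
  · intro hy
    rw [mem_koszulChains] at hy
    have : ∀ T, ∃ m, f m = y T ∧ (T.card = i ∧ i ≤ j → m ∈ 𝓜 (j - i)) ∧
        (¬ (T.card = i ∧ i ≤ j) → m = 0) := by
      intro T
      by_cases hT : T.card = i ∧ i ≤ j
      · have := (hy T).1 hT
        rw [← hf] at this
        obtain ⟨m, hm, hmy⟩ := this
        exact ⟨m, hmy, fun _ => hm, fun h => (h hT).elim⟩
      · exact ⟨0, by rw [map_zero, (hy T).2 hT], fun h => (hT h).elim, fun _ => rfl⟩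
    choose x hx hx' using this
    exact ⟨x, mem_koszulChains.mpr hx', funext hx⟩

theorem map_koszulBoundaries {f : M →ₗ[MvPolynomial (Fin n) k] M'}
    (hf : ∀ d, (𝓜 d).map (f.restrictScalars k) = 𝓜' d) (i j : ℕ) :
    (koszulBoundaries (n := n) 𝓜 i j).map ((f.restrictScalars k).compLeft (Finset (Fin n))) =
      koszulBoundaries 𝓜' i j := by
  rw [koszulBoundaries, koszulBoundaries, ← map_koszulChains hf, ← Submodule.map_comp,
    ← Submodule.map_comp]
  congr 1
  refine LinearMap.ext fun x => ?_
  exact (koszulD_comp f x).symm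

variable [∀ d, Module.Finite k (𝓜 d)] {f : M →ₗ[MvPolynomial (Fin n) k] M'}

theorem koszulRank_le_of_map (hf : ∀ d, (𝓜 d).map (f.restrictScalars k) = 𝓜' d) (i j : ℕ) :
    koszulRank n 𝓜' i j ≤ koszulRank n 𝓜 i j := by
  rw [koszulRank, ← map_koszulChains hf, ← Submodule.map_comp]
  have : ((koszulD k n M').restrictScalars k ∘ₗ (f.restrictScalars k).compLeft (Finset (Fin n))) =
      (f.restrictScalars k).compLeft (Finset (Fin n)) ∘ₗ (koszulD k n M).restrictScalars k :=
    LinearMap.ext fun x => koszulD_comp f x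
  rw [this, Submodule.map_comp]
  exact Submodule.finrank_map_le _ _

/-- Passing to a quotient, the rank of the Koszul differential drops by at most the loss of
dimension in its target. -/
theorem koszulRank_add_le_of_map (h𝓜 : IsGradedPieces n 𝓜)
    (hf : ∀ d, (𝓜 d).map (f.restrictScalars k) = 𝓜' d) (i j : ℕ) :
    koszulRank n 𝓜 (i + 1) j + finrank k (koszulChains (n := n) 𝓜' i j) ≤
      koszulRank n 𝓜' (i + 1) j + finrank k (koszulChains (n := n) 𝓜 i j) := by
  have hle : koszulBoundaries (n := n) 𝓜 i j ≤ koszulChains 𝓜 i j :=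
    (koszulBoundaries_le h𝓜 i j).trans inf_le_left
  have : Module.Finite k (koszulBoundaries (n := n) 𝓜 i j) :=
    Submodule.finiteDimensional_of_le hle
  have h1 := finrank_map_add_finrank_inf_ker ((f.restrictScalars k).compLeft (Finset (Fin n)))
    (koszulBoundaries (n := n) 𝓜 i j)
  have h2 := finrank_map_add_finrank_inf_ker ((f.restrictScalars k).compLeft (Finset (Fin n)))
    (koszulChains (n := n) 𝓜 i j)
  rw [map_koszulBoundaries hf] at h1
  rw [map_koszulChains hf] at h2
  have h3 : finrank k ↥(koszulBoundaries (n := n) 𝓜 i j ⊓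
      LinearMap.ker ((f.restrictScalars k).compLeft (Finset (Fin n)))) ≤
      finrank k ↥(koszulChains (n := n) 𝓜 i j ⊓
      LinearMap.ker ((f.restrictScalars k).compLeft (Finset (Fin n)))) := by
    have : Module.Finite k ↥(koszulChains (n := n) 𝓜 i j ⊓
      LinearMap.ker ((f.restrictScalars k).compLeft (Finset (Fin n)))) :=
      Submodule.finiteDimensional_of_le (inf_le_left : _ ≤ koszulChains 𝓜 i j)
    exact Submodule.finrank_mono (inf_le_inf_right _ hle)
  unfold koszulRank
  unfold koszulBoundaries at h1 h3
  omega

variable [∀ d, Module.Finite k (𝓜' d)]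

theorem gradedBetti_le_of_map (h𝓜 : IsGradedPieces n 𝓜) (h𝓜' : IsGradedPieces n 𝓜')
    (hf : ∀ d, (𝓜 d).map (f.restrictScalars k) = 𝓜' d) (i j : ℕ) :
    gradedBetti (n := n) 𝓜 i j + finrank k (koszulChains (n := n) 𝓜' i j) ≤
      gradedBetti (n := n) 𝓜' i j + finrank k (koszulChains (n := n) 𝓜 i j) := by
  have h1 := gradedBetti_add_koszulRank h𝓜 i j
  have h2 := gradedBetti_add_koszulRank h𝓜' i j
  have h3 := koszulRank_le_of_map hf i j
  have h4 := koszulRank_le_of_map hf (i + 1) j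
  omega

theorem gradedBetti_succ_le_of_map (h𝓜 : IsGradedPieces n 𝓜) (h𝓜' : IsGradedPieces n 𝓜')
    (hf : ∀ d, (𝓜 d).map (f.restrictScalars k) = 𝓜' d) (i j : ℕ) :
    gradedBetti (n := n) 𝓜' (i + 1) j + finrank k (koszulChains (n := n) 𝓜' i j) ≤
      gradedBetti (n := n) 𝓜 (i + 1) j + finrank k (koszulChains (n := n) 𝓜 i j) := by
  have h1 := gradedBetti_add_koszulRank h𝓜 (i + 1) j
  have h2 := gradedBetti_add_koszulRank h𝓜' (i + 1) j
  have h3 := koszulRank_add_le_of_map h𝓜 hf i j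
  have h4 := koszulRank_add_le_of_map h𝓜 hf (i + 1) j
  omega

end Ranks

/-! ### Betti numbers of cyclic modules -/

section Cyclic

variable {k : Type*} [Field k] {n : ℕ}

/-- The graded Betti numbers `β_{i,j}(A/I)`. -/
def bettiCyclic (I : Ideal (MvPolynomial (Fin n) k)) (i j : ℕ) : ℕ :=
  gradedBetti (n := n) (component k n (MvPolynomial (Fin n) k ⧸ I)) i j

theorem isGradedPieces_component (Q : Type*) [CommRing Q] [Algebra k Q]
    [Algebra (MvPolynomial (Fin n) k) Q] [IsScalarTower k (MvPolynomial (Fin n) k) Q] :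
    IsGradedPieces n (component k n Q) := by
  rintro d l _ ⟨p, hp, rfl⟩
  refine ⟨X l * p, ?_, ?_⟩
  · rw [SetLike.mem_coe, mem_homogeneousSubmodule, add_comm]
    exact (isHomogeneous_X k l).mul hp
  · change algebraMap _ Q (X l * p) = _
    rw [map_mul, Algebra.smul_def]
    rfl

theorem map_component {Q Q' : Type*} [CommRing Q] [Algebra k Q]
    [Algebra (MvPolynomial (Fin n) k) Q] [IsScalarTower k (MvPolynomial (Fin n) k) Q]
    [CommRing Q'] [Algebra k Q'] [Algebra (MvPolynomial (Fin n) k) Q']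
    [IsScalarTower k (MvPolynomial (Fin n) k) Q'] (f : Q →ₐ[MvPolynomial (Fin n) k] Q') (d : ℕ) :
    (component k n Q d).map (f.toLinearMap.restrictScalars k) = component k n Q' d := by
  rw [component, component, ← Submodule.map_comp]
  congr 1
  refine LinearMap.ext fun p => ?_
  exact f.commutes p

theorem bettiCyclic_add_le {I I' : Ideal (MvPolynomial (Fin n) k)} (h : I ≤ I') (i j : ℕ) :
    bettiCyclic I i j + finrank k
        (koszulChains (n := n) (component k n (MvPolynomial (Fin n) k ⧸ I')) i j) ≤
      bettiCyclic I' i j + finrank k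
        (koszulChains (n := n) (component k n (MvPolynomial (Fin n) k ⧸ I)) i j) :=
  gradedBetti_le_of_map (isGradedPieces_component _) (isGradedPieces_component _)
    (map_component (Ideal.Quotient.factorₐ _ h)) i j

theorem bettiCyclic_succ_add_le {I I' : Ideal (MvPolynomial (Fin n) k)} (h : I ≤ I') (i j : ℕ) :
    bettiCyclic I' (i + 1) j + finrank k
        (koszulChains (n := n) (component k n (MvPolynomial (Fin n) k ⧸ I')) i j) ≤
      bettiCyclic I (i + 1) j + finrank k
        (koszulChains (n := n) (component k n (MvPolynomial (Fin n) k ⧸ I)) i j) :=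
  gradedBetti_succ_le_of_map (isGradedPieces_component _) (isGradedPieces_component _)
    (map_component (Ideal.Quotient.factorₐ _ h)) i j

theorem gradedBetti_component_le_of_equiv {Q Q' : Type*} [CommRing Q] [Algebra k Q]
    [Algebra (MvPolynomial (Fin n) k) Q] [IsScalarTower k (MvPolynomial (Fin n) k) Q]
    [CommRing Q'] [Algebra k Q'] [Algebra (MvPolynomial (Fin n) k) Q']
    [IsScalarTower k (MvPolynomial (Fin n) k) Q'] (e : Q ≃ₐ[MvPolynomial (Fin n) k] Q')
    (i j : ℕ) :
    gradedBetti (n := n) (component k n Q) i j ≤ gradedBetti (n := n) (component k n Q') i j := by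
  have h1 := gradedBetti_le_of_map (isGradedPieces_component Q) (isGradedPieces_component Q')
    (map_component e.toAlgHom) i j
  have h2 : finrank k (koszulChains (n := n) (component k n Q) i j) ≤
      finrank k (koszulChains (n := n) (component k n Q') i j) := by
    rw [← map_koszulChains (map_component e.symm.toAlgHom)]
    exact Submodule.finrank_map_le _ _
  omega

theorem bettiQuot_eq {𝔞 : Ideal (MvPolynomial (Fin n) k)} (I : Ideal (MvPolynomial (Fin n) k ⧸ 𝔞))
    (i j : ℕ) : bettiQuot I i j = bettiCyclic (I.comap (Ideal.Quotient.mk 𝔞)) i j := by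
  have hsurj : Function.Surjective
      (Algebra.ofId (MvPolynomial (Fin n) k) ((MvPolynomial (Fin n) k ⧸ 𝔞) ⧸ I)) := by
    intro q
    obtain ⟨r, rfl⟩ := Ideal.Quotient.mk_surjective q
    obtain ⟨p, rfl⟩ := Ideal.Quotient.mk_surjective r
    exact ⟨p, rfl⟩
  have hker : I.comap (Ideal.Quotient.mk 𝔞) = RingHom.ker
      (Algebra.ofId (MvPolynomial (Fin n) k) ((MvPolynomial (Fin n) k ⧸ 𝔞) ⧸ I)) := by
    ext p
    exact (Ideal.Quotient.eq_zero_iff_mem (I := I) (a := Ideal.Quotient.mk 𝔞 p)).symm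
  let e := Ideal.quotientKerAlgEquivOfSurjective hsurj
  rw [hker]
  exact le_antisymm (gradedBetti_component_le_of_equiv e.symm i j)
    (gradedBetti_component_le_of_equiv e i j)

end Cyclic

/-! ### The Koszul complex on one more variable -/

section Cone

variable {k : Type*} [Field k] {n : ℕ}

/-- A set of variables of `A`, as a set of variables of `B`. -/
def liftSet (T : Finset (Fin n)) : Finset (Fin (n + 1)) := T.map (Fin.succEmb n)

theorem succ_mem_liftSet {T : Finset (Fin n)} {l : Fin n} : l.succ ∈ liftSet T ↔ l ∈ T := by
  simp [liftSet]

theorem zero_notMem_liftSet (T : Finset (Fin n)) : (0 : Fin (n + 1)) ∉ liftSet T := by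
  simp [liftSet]

theorem card_liftSet (T : Finset (Fin n)) : (liftSet T).card = T.card := Finset.card_map _

theorem card_insert_zero_liftSet (T : Finset (Fin n)) :
    (insert 0 (liftSet T)).card = T.card + 1 := by
  rw [Finset.card_insert_of_notMem (zero_notMem_liftSet T), card_liftSet]

theorem insert_succ_liftSet (l : Fin n) (T : Finset (Fin n)) :
    insert l.succ (liftSet T) = liftSet (insert l T) := by
  simp [liftSet, Finset.map_insert]

theorem compl_liftSet (T : Finset (Fin n)) : (liftSet T)ᶜ = insert 0 (liftSet Tᶜ) := by
  ext j
  induction j using Fin.cases with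
  | zero => simp [zero_notMem_liftSet]
  | succ l => simp [succ_mem_liftSet, Fin.succ_ne_zero]

theorem compl_insert_zero_liftSet (T : Finset (Fin n)) :
    (insert 0 (liftSet T))ᶜ = liftSet Tᶜ := by
  rw [← compl_compl (liftSet Tᶜ), compl_liftSet, compl_compl]

theorem exists_liftSet (U : Finset (Fin (n + 1))) :
    ∃ T, U = liftSet T ∨ U = insert 0 (liftSet T) := by
  refine ⟨Finset.univ.filter fun l => l.succ ∈ U, ?_⟩
  by_cases h : (0 : Fin (n + 1)) ∈ U
  · right
    ext j
    induction j using Fin.cases with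
    | zero => simp [h]
    | succ l => simp [succ_mem_liftSet, Fin.succ_ne_zero]
  · left
    ext j
    induction j using Fin.cases with
    | zero => simp [h, zero_notMem_liftSet]
    | succ l => simp [succ_mem_liftSet]

theorem koszulSign_succ_liftSet (l : Fin n) (T : Finset (Fin n)) :
    koszulSign l.succ (liftSet T) = koszulSign l T := by
  unfold koszulSign liftSet
  rw [Finset.filter_map, Finset.card_map]
  congr 3
  ext x
  simp

theorem koszulSign_succ_insert_zero (l : Fin n) (T : Finset (Fin n)) :
    koszulSign l.succ (insert 0 (liftSet T)) = -koszulSign l T := by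
  rw [koszulSign_insert (zero_notMem_liftSet T), if_pos (Fin.succ_pos l), koszulSign_succ_liftSet]

section Glue

variable {M : Type*}

/-- The chain `∑_T a(T) ⊗ e_T + ∑_T b(T) ⊗ e_{z,T}` of the Koszul complex over `B = A[z]`. -/
def glue (a b : Finset (Fin n) → M) (U : Finset (Fin (n + 1))) : M :=
  if 0 ∈ U then b (Finset.univ.filter fun l => l.succ ∈ U) else
    a (Finset.univ.filter fun l => l.succ ∈ U)

theorem glue_liftSet (a b : Finset (Fin n) → M) (T : Finset (Fin n)) :
    glue a b (liftSet T) = a T := by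
  rw [glue, if_neg (zero_notMem_liftSet T)]
  congr
  ext l
  simp [succ_mem_liftSet]

theorem glue_insert_zero (a b : Finset (Fin n) → M) (T : Finset (Fin n)) :
    glue a b (insert 0 (liftSet T)) = b T := by
  rw [glue, if_pos (Finset.mem_insert_self _ _)]
  congr
  ext l
  simp [succ_mem_liftSet, Fin.succ_ne_zero]

theorem exists_eq_glue (x : Finset (Fin (n + 1)) → M) : ∃ a b, x = glue a b := by
  refine ⟨fun T => x (liftSet T), fun T => x (insert 0 (liftSet T)), funext fun U => ?_⟩
  obtain ⟨T, rfl | rfl⟩ := exists_liftSet U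
  · rw [glue_liftSet]
  · rw [glue_insert_zero]

theorem glue_inj {a b a' b' : Finset (Fin n) → M} :
    glue a b = glue a' b' ↔ a = a' ∧ b = b' := by
  constructor
  · intro h
    refine ⟨funext fun T => ?_, funext fun T => ?_⟩
    · rw [← glue_liftSet a b, h, glue_liftSet]
    · rw [← glue_insert_zero a b, h, glue_insert_zero]
  · rintro ⟨rfl, rfl⟩
    rfl

end Glue

section Modules

variable {M : Type*} [AddCommGroup M] [Module (MvPolynomial (Fin (n + 1)) k) M]
  [Module (MvPolynomial (Fin n) k) M]

/-- The Koszul complex over `B = A[z]` is the mapping cone of the multiplication by `z` on the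
Koszul complex over `A`. -/
theorem koszulD_glue
    (hsmul : ∀ (l : Fin n) (m : M), (X l.succ : MvPolynomial (Fin (n + 1)) k) • m =
      (X l : MvPolynomial (Fin n) k) • m) (a b : Finset (Fin n) → M) :
    koszulD k (n + 1) M (glue a b) =
      glue ((fun T => (X 0 : MvPolynomial (Fin (n + 1)) k) • b T) + koszulD k n M a)
        (-koszulD k n M b) := by
  funext U
  obtain ⟨T, rfl | rfl⟩ := exists_liftSet U
  · rw [glue_liftSet, koszulD_apply, compl_liftSet, Finset.sum_insert (zero_notMem_liftSet _),
      glue_insert_zero, koszulSign_eq_one (fun l _ => Fin.zero_le l), one_smul, liftSet,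
      Finset.sum_map, Pi.add_apply, koszulD_apply]
    congr 1
    refine Finset.sum_congr rfl fun l _ => ?_
    rw [Fin.coe_succEmb, koszulSign_succ_liftSet, insert_succ_liftSet, glue_liftSet, hsmul]
  · rw [glue_insert_zero, koszulD_apply, compl_insert_zero_liftSet, liftSet,
      Finset.sum_map, Pi.neg_apply, koszulD_apply, ← Finset.sum_neg_distrib]
    refine Finset.sum_congr rfl fun l _ => ?_
    rw [Fin.coe_succEmb, koszulSign_succ_insert_zero, Finset.insert_comm, insert_succ_liftSet,
      glue_insert_zero, hsmul, neg_smul]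

end Modules

theorem glue_mem_koszulChains {M : Type*} [AddCommGroup M] [Module k M] {𝓜 : ℕ → Submodule k M}
    {a b : Finset (Fin n) → M} {i j : ℕ} :
    glue a b ∈ koszulChains (n := n + 1) 𝓜 (i + 1) (j + 1) ↔
      a ∈ koszulChains (n := n) 𝓜 (i + 1) (j + 1) ∧ b ∈ koszulChains (n := n) 𝓜 i j := by
  simp only [mem_koszulChains]
  constructor
  · intro h
    refine ⟨fun T => ?_, fun T => ?_⟩
    · have := h (liftSet T)
      rwa [glue_liftSet, card_liftSet] at this
    · have := h (insert 0 (liftSet T))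
      rwa [glue_insert_zero, card_insert_zero_liftSet, add_le_add_iff_right, add_left_inj,
        Nat.add_sub_add_right] at this
  · rintro ⟨ha, hb⟩ U
    obtain ⟨T, rfl | rfl⟩ := exists_liftSet U
    · rw [glue_liftSet, card_liftSet]
      exact ha T
    · rw [glue_insert_zero, card_insert_zero_liftSet, add_le_add_iff_right, add_left_inj,
        Nat.add_sub_add_right]
      exact hb T

/-- Two subquotients are of the same dimension if some linear map identifies them. -/
theorem finrank_subquotient_eq {K V W : Type*} [Field K] [AddCommGroup V] [Module K V]
    [AddCommGroup W] [Module K W] {Z B : Submodule K V} {Z' B' : Submodule K W} (φ : V →ₗ[K] W)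
    (hZ : ∀ x ∈ Z, φ x ∈ Z') (hB : ∀ x ∈ Z, φ x ∈ B' ↔ x ∈ B)
    (hsurj : ∀ y ∈ Z', ∃ x ∈ Z, y - φ x ∈ B') :
    finrank K (Z' ⧸ B'.submoduleOf Z') = finrank K (Z ⧸ B.submoduleOf Z) := by
  let ψ : Z →ₗ[K] Z' := φ.restrict hZ
  have hψ : B.submoduleOf Z = (B'.submoduleOf Z').comap ψ := by
    ext x
    exact (hB x.1 x.2).symm
  let ψ' := Submodule.mapQ (B.submoduleOf Z) (B'.submoduleOf Z') ψ hψ.le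
  refine (LinearEquiv.ofBijective ψ' ⟨?_, ?_⟩).finrank_eq.symm
  · rw [← LinearMap.ker_eq_bot, Submodule.ker_mapQ, ← hψ, Submodule.mkQ_map_self]
  · intro y
    obtain ⟨y, rfl⟩ := Submodule.Quotient.mk_surjective _ y
    obtain ⟨x, hx, hxy⟩ := hsurj y.1 y.2
    refine ⟨Submodule.Quotient.mk ⟨x, hx⟩, ?_⟩
    rw [Submodule.mapQ_apply]
    refine ((Submodule.Quotient.eq _).mpr ?_).symm
    exact hxy

theorem finrank_prod_subquotient {K V V' : Type*} [Field K] [AddCommGroup V] [Module K V]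
    [AddCommGroup V'] [Module K V'] (Z B : Submodule K V) (Z' B' : Submodule K V')
    [Module.Finite K Z] [Module.Finite K Z'] :
    finrank K (Z.prod Z' ⧸ (B.prod B').submoduleOf (Z.prod Z')) =
      finrank K (Z ⧸ B.submoduleOf Z) + finrank K (Z' ⧸ B'.submoduleOf Z') := by
  rw [← Module.finrank_prod]
  let f : Z.prod Z' →ₗ[K] (Z ⧸ B.submoduleOf Z) × (Z' ⧸ B'.submoduleOf Z') :=
    LinearMap.prod ((B.submoduleOf Z).mkQ ∘ₗ (LinearMap.fst K V V').restrict fun x hx => hx.1)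
      ((B'.submoduleOf Z').mkQ ∘ₗ (LinearMap.snd K V V').restrict fun x hx => hx.2)
  have hf : Function.Surjective f := by
    rintro ⟨x, y⟩
    obtain ⟨x, rfl⟩ := Submodule.Quotient.mk_surjective _ x
    obtain ⟨y, rfl⟩ := Submodule.Quotient.mk_surjective _ y
    exact ⟨⟨(x.1, y.1), x.2, y.2⟩, rfl⟩
  have hk : (B.prod B').submoduleOf (Z.prod Z') = LinearMap.ker f := by
    ext x
    rw [LinearMap.mem_ker, Prod.ext_iff]
    exact and_congr
      (Submodule.Quotient.mk_eq_zero (B.submoduleOf Z) (x := ⟨x.1.1, x.2.1⟩)).symm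
      (Submodule.Quotient.mk_eq_zero (B'.submoduleOf Z') (x := ⟨x.1.2, x.2.2⟩)).symm
  rw [hk]
  exact (f.quotKerEquivOfSurjective hf).finrank_eq

end Cone

/-! ### Betti numbers over `A[z]` -/

section ConeHomology

variable {k : Type*} [Field k] {n : ℕ}

theorem map_mem_koszulChains {M M' : Type*} [AddCommGroup M] [Module k M] [AddCommGroup M']
    [Module k M'] {𝓜 : ℕ → Submodule k M} {𝓜' : ℕ → Submodule k M'} {F : Type*} [FunLike F M M']
    [ZeroHomClass F M M'] {f : F} (hf : ∀ d, ∀ m ∈ 𝓜 d, f m ∈ 𝓜' d) {i j : ℕ}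
    {x : Finset (Fin n) → M} (hx : x ∈ koszulChains 𝓜 i j) :
    (fun T => f (x T)) ∈ koszulChains 𝓜' i j := by
  rw [mem_koszulChains] at hx ⊢
  refine fun T => ⟨fun hT => hf _ _ ((hx T).1 hT), fun hT => ?_⟩
  rw [(hx T).2 hT, map_zero]

theorem finrank_quotient_bot_submoduleOf {K V : Type*} [Field K] [AddCommGroup V] [Module K V]
    (Z : Submodule K V) : finrank K (Z ⧸ (⊥ : Submodule K V).submoduleOf Z) = finrank K Z := by
  refine (Submodule.quotEquivOfEqBot _ ?_).finrank_eq
  rw [Submodule.submoduleOf, ← LinearMap.ker, Submodule.ker_subtype]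

variable {M P Q : Type*} [AddCommGroup M] [AddCommGroup P] [AddCommGroup Q]
  [Module k M] [Module k P] [Module k Q]
  [Module (MvPolynomial (Fin (n + 1)) k) M] [IsScalarTower k (MvPolynomial (Fin (n + 1)) k) M]

variable (k n M) in
/-- The multiplication by `z` on a module over `B = A[z]`. -/
def zMul : M →ₗ[k] M :=
  (LinearMap.lsmul (MvPolynomial (Fin (n + 1)) k) M (X 0)).restrictScalars k

theorem zMul_apply (m : M) : zMul k n M m = (X 0 : MvPolynomial (Fin (n + 1)) k) • m := rfl

variable [Module (MvPolynomial (Fin n) k) M] [Module (MvPolynomial (Fin n) k) P]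
  [Module (MvPolynomial (Fin n) k) Q]

/-- The splitting of a graded module `M` over `B = A[z]` that determines its Betti numbers: `M` is
the direct sum of `P` and `zM` as a module over `A`, and the kernel of `z` on `M` is the direct sum
of `Q` and of a module killed by the variables of `A`. -/
structure ZSplitting (𝓜 : ℕ → Submodule k M) (𝓟 : ℕ → Submodule k P) (𝓠 : ℕ → Submodule k Q)
    (ι : P →ₗ[MvPolynomial (Fin n) k] M) (π : M →ₗ[MvPolynomial (Fin n) k] P)
    (σ : Q →ₗ[MvPolynomial (Fin n) k] M) (τ : M →ₗ[MvPolynomial (Fin n) k] Q) : Prop where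
  smul : ∀ (l : Fin n) (m : M), (X l.succ : MvPolynomial (Fin (n + 1)) k) • m =
    (X l : MvPolynomial (Fin n) k) • m
  graded : IsGradedPieces n 𝓜
  π_ι : ∀ p, π (ι p) = p
  τ_σ : ∀ q, τ (σ q) = q
  ι_mem : ∀ d, ∀ p ∈ 𝓟 d, ι p ∈ 𝓜 d
  π_mem : ∀ d, ∀ m ∈ 𝓜 d, π m ∈ 𝓟 d
  σ_mem : ∀ d, ∀ q ∈ 𝓠 d, σ q ∈ 𝓜 d
  τ_mem : ∀ d, ∀ m ∈ 𝓜 d, τ m ∈ 𝓠 d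
  z_mem : ∀ d, ∀ m ∈ 𝓜 d, zMul k n M m ∈ 𝓜 (d + 1)
  π_z : ∀ m, π (zMul k n M m) = 0
  z_σ : ∀ q, zMul k n M (σ q) = 0
  eq_zero_of_π : ∀ m ∈ 𝓜 0, π m = 0 → m = 0
  exists_z_eq : ∀ d, ∀ m ∈ 𝓜 (d + 1), π m = 0 → ∃ m' ∈ 𝓜 d, zMul k n M m' = m
  X_smul : ∀ m, zMul k n M m = 0 → τ m = 0 → ∀ l : Fin n, (X l : MvPolynomial (Fin n) k) • m = 0

variable {𝓜 : ℕ → Submodule k M} {𝓟 : ℕ → Submodule k P} {𝓠 : ℕ → Submodule k Q}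
  {ι : P →ₗ[MvPolynomial (Fin n) k] M} {π : M →ₗ[MvPolynomial (Fin n) k] P}
  {σ : Q →ₗ[MvPolynomial (Fin n) k] M} {τ : M →ₗ[MvPolynomial (Fin n) k] Q}

namespace ZSplitting

theorem koszulD_eq_zero (h : ZSplitting 𝓜 𝓟 𝓠 ι π σ τ) {x : Finset (Fin n) → M}
    (hx : ∀ T, zMul k n M (x T) = 0) (hx' : ∀ T, τ (x T) = 0) : koszulD k n M x = 0 := by
  funext T
  rw [koszulD_apply]
  refine Finset.sum_eq_zero fun l _ => ?_
  rw [h.X_smul _ (hx _) (hx' _), smul_zero]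

theorem exists_zMul_eq (h : ZSplitting 𝓜 𝓟 𝓠 ι π σ τ) {i j : ℕ} {x : Finset (Fin n) → M}
    (hx : x ∈ koszulChains 𝓜 i (j + 1)) (hπ : ∀ T, π (x T) = 0) :
    ∃ y ∈ koszulChains 𝓜 i j, (fun T => zMul k n M (y T)) = x := by
  rw [mem_koszulChains] at hx
  have : ∀ T, ∃ m, zMul k n M m = x T ∧ (T.card = i ∧ i ≤ j → m ∈ 𝓜 (j - i)) ∧
      (¬ (T.card = i ∧ i ≤ j) → m = 0) := by
    intro T
    by_cases hT : T.card = i ∧ i ≤ j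
    · have h1 := (hx T).1 ⟨hT.1, by omega⟩
      rw [show j + 1 - i = j - i + 1 by omega] at h1
      obtain ⟨m, hm, hmx⟩ := h.exists_z_eq _ _ h1 (hπ T)
      exact ⟨m, hmx, fun _ => hm, fun h' => (h' hT).elim⟩
    · refine ⟨0, ?_, fun h' => (hT h').elim, fun _ => rfl⟩
      rw [map_zero]
      by_cases hT' : T.card = i ∧ i ≤ j + 1
      · have h1 := (hx T).1 hT'
        rw [show j + 1 - i = 0 by omega] at h1
        exact (h.eq_zero_of_π _ h1 (hπ T)).symm
      · exact ((hx T).2 hT').symm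
  choose y hy hy' using this
  exact ⟨y, mem_koszulChains.mpr hy', funext hy⟩

theorem koszulD_glue_zMul (h : ZSplitting 𝓜 𝓟 𝓠 ι π σ τ) (a b : Finset (Fin n) → M) :
    koszulD k (n + 1) M (glue a b) =
      glue ((fun T => zMul k n M (b T)) + koszulD k n M a) (-koszulD k n M b) :=
  koszulD_glue h.smul a b

theorem koszulD_zMul (h : ZSplitting 𝓜 𝓟 𝓠 ι π σ τ) (x : Finset (Fin n) → M) :
    koszulD k n M (fun T => zMul k n M (x T)) = fun T => zMul k n M (koszulD k n M x T) := by
  funext T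
  simp only [koszulD_apply, map_sum, map_zsmul]
  refine Finset.sum_congr rfl fun l _ => ?_
  congr 1
  rw [← h.smul, ← h.smul, zMul_apply, zMul_apply, smul_comm]

theorem glue_mem_koszulCycles (h : ZSplitting 𝓜 𝓟 𝓠 ι π σ τ) {a b : Finset (Fin n) → M}
    {i j : ℕ} :
    glue a b ∈ koszulCycles (n := n + 1) 𝓜 (i + 1) (j + 1) ↔
      (a ∈ koszulChains (n := n) 𝓜 (i + 1) (j + 1) ∧ b ∈ koszulChains (n := n) 𝓜 i j) ∧
        (fun T => zMul k n M (b T)) + koszulD k n M a = 0 ∧ koszulD k n M b = 0 := by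
  rw [koszulCycles, Submodule.mem_inf, glue_mem_koszulChains]
  refine and_congr_right fun _ => ?_
  change koszulD k (n + 1) M (glue a b) = 0 ↔ _
  have h0 : (0 : Finset (Fin (n + 1)) → M) = glue 0 0 := by
    funext U
    simp [glue]
  rw [h.koszulD_glue_zMul, h0, glue_inj, neg_eq_zero]

theorem glue_mem_koszulBoundaries (h : ZSplitting 𝓜 𝓟 𝓠 ι π σ τ) {a b : Finset (Fin n) → M}
    {i j : ℕ} :
    glue a b ∈ koszulBoundaries (n := n + 1) 𝓜 (i + 1) (j + 1) ↔
      ∃ a' ∈ koszulChains (n := n) 𝓜 (i + 2) (j + 1), ∃ b' ∈ koszulChains (n := n) 𝓜 (i + 1) j,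
        (fun T => zMul k n M (b' T)) + koszulD k n M a' = a ∧ -koszulD k n M b' = b := by
  constructor
  · rintro ⟨x, hx, hxe⟩
    obtain ⟨a', b', rfl⟩ := exists_eq_glue x
    obtain ⟨ha', hb'⟩ := glue_mem_koszulChains.mp hx
    refine ⟨a', ha', b', hb', ?_⟩
    rw [← glue_inj, ← h.koszulD_glue_zMul]
    exact hxe
  · rintro ⟨a', ha', b', hb', rfl, rfl⟩
    exact ⟨glue a' b', glue_mem_koszulChains.mpr ⟨ha', hb'⟩, h.koszulD_glue_zMul a' b'⟩

end ZSplitting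

variable [IsScalarTower k (MvPolynomial (Fin n) k) M]
  [IsScalarTower k (MvPolynomial (Fin n) k) Q]

variable (n 𝓜 τ) in
/-- The graded pieces of the complement of `Q` in the kernel of `z`. -/
def socle (d : ℕ) : Submodule k M :=
  𝓜 d ⊓ (LinearMap.ker (zMul k n M) ⊓ LinearMap.ker (τ.restrictScalars k))

namespace ZSplitting

theorem sub_mem_socle (h : ZSplitting 𝓜 𝓟 𝓠 ι π σ τ) {i j : ℕ} {x : Finset (Fin n) → M}
    (hx : x ∈ koszulChains 𝓜 i j) (hz : ∀ T, zMul k n M (x T) = 0) :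
    (fun T => x T - σ (τ (x T))) ∈ koszulChains (socle n 𝓜 τ) i j := by
  rw [mem_koszulChains] at hx ⊢
  refine fun T => ⟨fun hT => ⟨?_, ?_, ?_⟩, fun hT => ?_⟩
  · exact sub_mem ((hx T).1 hT) (h.σ_mem _ _ (h.τ_mem _ _ ((hx T).1 hT)))
  · change zMul k n M _ = 0
    rw [map_sub, h.z_σ, hz, sub_zero]
  · change τ _ = 0
    rw [map_sub, h.τ_σ, sub_self]
  · rw [(hx T).2 hT, map_zero, map_zero, sub_zero]

theorem of_mem_socle {i j : ℕ} {x : Finset (Fin n) → M}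
    (hx : x ∈ koszulChains (socle n 𝓜 τ) i j) :
    x ∈ koszulChains 𝓜 i j ∧ (∀ T, zMul k n M (x T) = 0) ∧ ∀ T, τ (x T) = 0 := by
  rw [mem_koszulChains] at hx ⊢
  have key : ∀ T, zMul k n M (x T) = 0 ∧ τ (x T) = 0 := by
    intro T
    by_cases hT : T.card = i ∧ i ≤ j
    · exact ((hx T).1 hT).2
    · rw [(hx T).2 hT, map_zero, map_zero]
      exact ⟨rfl, rfl⟩
  exact ⟨fun T => ⟨fun hT => ((hx T).1 hT).1, (hx T).2⟩, fun T => (key T).1, fun T => (key T).2⟩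

variable [IsScalarTower k (MvPolynomial (Fin n) k) P]

/-- The homology of the Koszul complex over `B` of a module with a splitting: since `z : M → zM`
is onto, the cone of `z` on the Koszul complex of `M = P ⊕ zM` has the homology of `P` and, one
step up, that of the kernel of `z`. -/
theorem gradedBetti_eq (h : ZSplitting 𝓜 𝓟 𝓠 ι π σ τ) [∀ d, Module.Finite k (𝓜 d)]
    [∀ d, Module.Finite k (𝓟 d)] [∀ d, Module.Finite k (𝓠 d)] (i j : ℕ) :
    gradedBetti (n := n + 1) 𝓜 (i + 1) (j + 1) =
      gradedBetti (n := n) 𝓟 (i + 1) (j + 1) +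
        (finrank k (koszulChains (n := n) (socle n 𝓜 τ) i j) + gradedBetti (n := n) 𝓠 i j) := by
  have : ∀ d, Module.Finite k (socle n 𝓜 τ d) := fun d =>
    Submodule.finiteDimensional_of_le (inf_le_left : _ ≤ 𝓜 d)
  have : Module.Finite k (koszulCycles (n := n) 𝓟 (i + 1) (j + 1)) :=
    Submodule.finiteDimensional_of_le (inf_le_left : _ ≤ koszulChains 𝓟 (i + 1) (j + 1))
  have : Module.Finite k (koszulCycles (n := n) 𝓠 i j) :=
    Submodule.finiteDimensional_of_le (inf_le_left : _ ≤ koszulChains 𝓠 i j)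
  have : Module.Finite k ((koszulChains (n := n) (socle n 𝓜 τ) i j).prod
      (koszulCycles (n := n) 𝓠 i j)) :=
    Module.Finite.iff_fg.mpr
      ((Module.Finite.iff_fg.mp inferInstance).prod (Module.Finite.iff_fg.mp inferInstance))
  -- in a cycle `a + b e_z`, one has `z b = -∂a` and `∂b = 0`; up to boundaries, `a` takes values in
  -- `P`, and then `b` takes values in the kernel of `z`
  let φ : (Finset (Fin n) → P) × (Finset (Fin n) → M) × (Finset (Fin n) → Q) →ₗ[k]
      (Finset (Fin (n + 1)) → M) :=
    { toFun := fun v => glue (fun T => ι (v.1 T)) (fun T => v.2.1 T + σ (v.2.2 T))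
      map_add' := fun v w => by
        funext U
        simp only [glue, Pi.add_apply, Prod.fst_add, Prod.snd_add, map_add]
        split_ifs
        · abel
        · rfl
      map_smul' := fun c v => by
        funext U
        simp only [glue, Pi.smul_apply, Prod.smul_fst, Prod.smul_snd, RingHom.id_apply,
          LinearMap.map_smul_of_tower]
        split_ifs
        · rw [smul_add]
        · rfl }
  have hφ : ∀ v, φ v = glue (fun T => ι (v.1 T)) (fun T => v.2.1 T + σ (v.2.2 T)) := fun _ => rfl
  have hmain : finrank k (koszulCycles (n := n + 1) 𝓜 (i + 1) (j + 1) ⧸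
      (koszulBoundaries (n := n + 1) 𝓜 (i + 1) (j + 1)).submoduleOf
        (koszulCycles 𝓜 (i + 1) (j + 1))) = _ :=
    finrank_subquotient_eq
      (Z := (koszulCycles (n := n) 𝓟 (i + 1) (j + 1)).prod
        ((koszulChains (n := n) (socle n 𝓜 τ) i j).prod (koszulCycles (n := n) 𝓠 i j)))
      (B := (koszulBoundaries (n := n) 𝓟 (i + 1) (j + 1)).prod
        ((⊥ : Submodule k (Finset (Fin n) → M)).prod (koszulBoundaries (n := n) 𝓠 i j)))
      φ ?_ ?_ ?_
  · rw [gradedBetti, hmain, finrank_prod_subquotient, finrank_prod_subquotient,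
      finrank_quotient_bot_submoduleOf]
    rfl
  · rintro ⟨a, w, q⟩ ⟨⟨ha, hda⟩, hw, hq, hdq⟩
    obtain ⟨hw1, hw2, hw3⟩ := of_mem_socle hw
    have hda' : koszulD k n P a = 0 := hda
    have hdq' : koszulD k n Q q = 0 := hdq
    rw [hφ, h.glue_mem_koszulCycles]
    refine ⟨⟨map_mem_koszulChains h.ι_mem ha, add_mem hw1 (map_mem_koszulChains h.σ_mem hq)⟩,
      ?_, ?_⟩
    · rw [koszulD_comp, hda']
      funext T
      simp [hw2, h.z_σ]
    · have : (fun T => w T + σ (q T)) = w + fun T => σ (q T) := rfl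
      rw [this, map_add, koszulD_comp, hdq', h.koszulD_eq_zero hw2 hw3]
      funext T
      simp
  · rintro ⟨a, w, q⟩ ⟨⟨ha, hda⟩, hw, hq, hdq⟩
    obtain ⟨hw1, hw2, hw3⟩ := of_mem_socle hw
    rw [hφ, h.glue_mem_koszulBoundaries]
    constructor
    · rintro ⟨a', ha', b', hb', h1, h2⟩
      have h1' : ∀ T, zMul k n M (b' T) + koszulD k n M a' T = ι (a T) := fun T => congrFun h1 T
      have h2' : ∀ T, -koszulD k n M b' T = w T + σ (q T) := fun T => congrFun h2 T
      have hπa : koszulD k n P (fun T => π (a' T)) = a := by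
        rw [koszulD_comp]
        funext T
        have := congrArg π (h1' T)
        rwa [map_add, h.π_z, zero_add, h.π_ι] at this
      -- `a'` can be corrected by a multiple of `z` so that it lies in `P`
      obtain ⟨y, hy, hya⟩ := h.exists_zMul_eq (x := fun T => a' T - ι (π (a' T)))
        (sub_mem ha' (map_mem_koszulChains h.ι_mem (map_mem_koszulChains h.π_mem ha')))
        (fun T => by rw [map_sub, h.π_ι, sub_self])
      have hya' : koszulD k n M (fun T => zMul k n M (y T)) =
          koszulD k n M a' - fun T => ι (a T) := by
        have e : (fun T => a' T - ι (π (a' T))) = a' - fun T => ι (π (a' T)) := rfl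
        rw [hya, e, map_sub, koszulD_comp ι (fun T => π (a' T)), hπa]
      have hN : ∀ T, zMul k n M (b' T + koszulD k n M y T) = 0 := by
        intro T
        have := congrFun hya' T
        rw [h.koszulD_zMul, Pi.sub_apply] at this
        dsimp only at this
        rw [map_add, this, ← h1' T]
        abel
      have hyc := koszulD_mem_koszulChains h.graded hy
      have hd := h.koszulD_eq_zero (x := fun T => (b' T + koszulD k n M y T) -
          σ (τ (b' T + koszulD k n M y T)))
        (fun T => by rw [map_sub, hN, h.z_σ, sub_zero])
        (fun T => by rw [map_sub, h.τ_σ, sub_self])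
      have hd' : koszulD k n M b' =
          fun T => σ (koszulD k n Q (fun T => τ (b' T + koszulD k n M y T)) T) := by
        have e : (fun T => (b' T + koszulD k n M y T) - σ (τ (b' T + koszulD k n M y T))) =
            b' + koszulD k n M y - fun T => σ (τ (b' T + koszulD k n M y T)) := rfl
        rw [e, map_sub, map_add, koszulD_koszulD, add_zero, sub_eq_zero,
          koszulD_comp σ (fun T => τ (b' T + koszulD k n M y T))] at hd
        exact hd
      have hq' : koszulD k n Q (fun T => τ (b' T + koszulD k n M y T)) = -q := by
        funext T
        have h3 := h2' T
        rw [hd'] at h3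
        have h4 := congrArg τ h3
        rw [map_neg, h.τ_σ, map_add, hw3, h.τ_σ, zero_add] at h4
        rw [Pi.neg_apply, ← h4, neg_neg]
      refine ⟨⟨_, map_mem_koszulChains h.π_mem ha', hπa⟩, ?_, -_,
        neg_mem (map_mem_koszulChains h.τ_mem (add_mem hb' hyc)), ?_⟩
      · rw [SetLike.mem_coe, Submodule.mem_bot]
        funext T
        have h3 := h2' T
        rw [hd', hq'] at h3
        dsimp only at h3
        rw [Pi.neg_apply, map_neg, neg_neg] at h3
        exact (left_eq_add.mp (h3.trans (add_comm _ _)))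
      · change koszulD k n Q _ = q
        rw [map_neg]
        exact neg_eq_iff_eq_neg.mpr hq'
    · rintro ⟨⟨a', ha', rfl⟩, hw0, y, hy, rfl⟩
      have hw0' : w = 0 := hw0
      refine ⟨fun T => ι (a' T), map_mem_koszulChains h.ι_mem ha', -fun T => σ (y T),
        neg_mem (map_mem_koszulChains h.σ_mem hy), ?_, ?_⟩
      · rw [koszulD_comp]
        funext T
        simp [h.z_σ]
      · rw [map_neg, koszulD_comp, neg_neg, hw0']
        funext T
        simp
  · intro x hx
    obtain ⟨a, b, rfl⟩ := exists_eq_glue x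
    obtain ⟨⟨ha, hb⟩, h1, h2⟩ := h.glue_mem_koszulCycles.mp hx
    have h1' : ∀ T, zMul k n M (b T) + koszulD k n M a T = 0 := fun T => congrFun h1 T
    have hπa : koszulD k n P (fun T => π (a T)) = 0 := by
      rw [koszulD_comp]
      funext T
      have := congrArg π (h1' T)
      rwa [map_add, h.π_z, zero_add, map_zero] at this
    obtain ⟨y, hy, hya⟩ := h.exists_zMul_eq (x := fun T => a T - ι (π (a T)))
      (sub_mem ha (map_mem_koszulChains h.ι_mem (map_mem_koszulChains h.π_mem ha)))
      (fun T => by rw [map_sub, h.π_ι, sub_self])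
    have hya' : koszulD k n M (fun T => zMul k n M (y T)) = koszulD k n M a := by
      have e : (fun T => a T - ι (π (a T))) = a - fun T => ι (π (a T)) := rfl
      rw [hya, e, map_sub, koszulD_comp ι (fun T => π (a T)), hπa]
      funext T
      simp
    have hN : ∀ T, zMul k n M (b T + koszulD k n M y T) = 0 := by
      intro T
      have := congrFun hya' T
      rw [h.koszulD_zMul] at this
      dsimp only at this
      rw [map_add, this, h1' T]
    have hbc : (fun T => b T + koszulD k n M y T) ∈ koszulChains 𝓜 i j :=
      add_mem hb (koszulD_mem_koszulChains h.graded hy)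
    refine ⟨(fun T => π (a T), fun T => (b T + koszulD k n M y T) -
        σ (τ (b T + koszulD k n M y T)), fun T => τ (b T + koszulD k n M y T)),
      ⟨⟨map_mem_koszulChains h.π_mem ha, hπa⟩, h.sub_mem_socle hbc hN,
        map_mem_koszulChains h.τ_mem hbc, ?_⟩, ?_⟩
    · change koszulD k n Q (fun T => τ (b T + koszulD k n M y T)) = 0
      rw [koszulD_comp τ (fun T => b T + koszulD k n M y T)]
      have e : (fun T => b T + koszulD k n M y T) = b + koszulD k n M y := rfl
      rw [e, map_add, h2, koszulD_koszulD]
      funext T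
      simp
    · have e : glue a b - φ (fun T => π (a T), fun T => (b T + koszulD k n M y T) -
          σ (τ (b T + koszulD k n M y T)), fun T => τ (b T + koszulD k n M y T)) =
          glue (fun T => zMul k n M (y T)) (-koszulD k n M y) := by
        rw [hφ, hya]
        funext U
        simp only [glue, Pi.sub_apply, Pi.neg_apply]
        split_ifs
        · abel
        · rfl
      rw [e, h.glue_mem_koszulBoundaries]
      refine ⟨0, zero_mem _, y, hy, ?_, rfl⟩
      rw [map_zero, add_zero]

/-- The dimensions of the complement of `Q` in the kernel of `z` are determined by those of `M`,
`P` and `Q`. -/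
theorem finrank_socle (h : ZSplitting 𝓜 𝓟 𝓠 ι π σ τ) [∀ d, Module.Finite k (𝓜 d)] (d : ℕ) :
    finrank k (socle n 𝓜 τ d) + finrank k (𝓠 d) + finrank k (𝓜 (d + 1)) =
      finrank k (𝓜 d) + finrank k (𝓟 (d + 1)) := by
  have : Module.Finite k ↥(𝓜 d ⊓ LinearMap.ker (zMul k n M)) :=
    Submodule.finiteDimensional_of_le (inf_le_left : _ ≤ 𝓜 d)
  have h1 := finrank_map_add_finrank_inf_ker (zMul k n M) (𝓜 d)
  have h2 := finrank_map_add_finrank_inf_ker (π.restrictScalars k) (𝓜 (d + 1))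
  have h3 := finrank_map_add_finrank_inf_ker (τ.restrictScalars k)
    (𝓜 d ⊓ LinearMap.ker (zMul k n M))
  have e1 : (𝓜 d).map (zMul k n M) = 𝓜 (d + 1) ⊓ LinearMap.ker (π.restrictScalars k) := by
    ext m
    constructor
    · rintro ⟨m', hm', rfl⟩
      exact ⟨h.z_mem d m' hm', h.π_z m'⟩
    · rintro ⟨hm, hm'⟩
      exact h.exists_z_eq d m hm hm'
  have e2 : (𝓜 (d + 1)).map (π.restrictScalars k) = 𝓟 (d + 1) := by
    ext p
    constructor
    · rintro ⟨m, hm, rfl⟩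
      exact h.π_mem _ _ hm
    · intro hp
      exact ⟨ι p, h.ι_mem _ _ hp, h.π_ι p⟩
  have e3 : (𝓜 d ⊓ LinearMap.ker (zMul k n M)).map (τ.restrictScalars k) = 𝓠 d := by
    ext q
    constructor
    · rintro ⟨m, hm, rfl⟩
      exact h.τ_mem _ _ hm.1
    · intro hq
      exact ⟨σ q, ⟨h.σ_mem _ _ hq, h.z_σ q⟩, h.τ_σ q⟩
  rw [e1] at h1
  rw [e2] at h2
  rw [e3, inf_assoc] at h3
  unfold socle
  omega

end ZSplitting

end ConeHomology

/-! ### The splitting of a quotient by a `z`-stable ideal -/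

section Shift

variable {k : Type*} [Field k] {n : ℕ} {M : Type*} [AddCommGroup M] [Module k M]

/-- The graded pieces of the module `M(-s)`. -/
def shiftPieces (s : ℕ) (𝓜 : ℕ → Submodule k M) (d : ℕ) : Submodule k M :=
  if s ≤ d then 𝓜 (d - s) else ⊥

instance finite_shiftPieces (s : ℕ) (𝓜 : ℕ → Submodule k M) [∀ d, Module.Finite k (𝓜 d)] (d : ℕ) :
    Module.Finite k (shiftPieces s 𝓜 d) := by
  by_cases h : s ≤ d
  · rw [shiftPieces, if_pos h]
    infer_instance
  · rw [shiftPieces, if_neg h]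
    infer_instance

theorem koszulChains_shiftPieces (s : ℕ) (𝓜 : ℕ → Submodule k M) (i j : ℕ) :
    koszulChains (n := n) (shiftPieces s 𝓜) i j =
      if s ≤ j then koszulChains 𝓜 i (j - s) else ⊥ := by
  ext x
  have hbot : ∀ d, d < s → shiftPieces s 𝓜 d = ⊥ := fun d hd => if_neg (by omega)
  have hpos : ∀ d, shiftPieces s 𝓜 (d + s) = 𝓜 d := fun d => by
    rw [shiftPieces, if_pos (by omega), Nat.add_sub_cancel]
  split_ifs with hs
  · rw [mem_koszulChains, mem_koszulChains]
    refine forall_congr' fun T => ?_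
    by_cases hT : T.card = i ∧ i ≤ j - s
    · rw [show j - i = j - s - i + s by omega, hpos]
      have hT' : T.card = i ∧ i ≤ j := ⟨hT.1, by omega⟩
      simp only [hT, hT', not_true_eq_false, true_imp_iff, false_imp_iff, and_self]
    · by_cases hT' : T.card = i ∧ i ≤ j
      · rw [hbot _ (by omega)]
        have : j - s < i := by omega
        simp [hT', this.not_ge]
      · simp [hT, hT']
  · rw [mem_koszulChains, Submodule.mem_bot]
    constructor
    · intro h
      funext T
      by_cases hT : T.card = i ∧ i ≤ j
      · have := (h T).1 hT
        rwa [hbot _ (by omega)] at this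
      · exact (h T).2 hT
    · rintro rfl T
      exact ⟨fun _ => zero_mem _, fun _ => rfl⟩

theorem finrank_koszulChains_shiftPieces (s : ℕ) (𝓜 : ℕ → Submodule k M) (i j : ℕ) :
    finrank k (koszulChains (n := n) (shiftPieces s 𝓜) i j) =
      if s ≤ j then finrank k (koszulChains (n := n) 𝓜 i (j - s)) else 0 := by
  by_cases h : s ≤ j
  · rw [(koszulChains_shiftPieces s 𝓜 i j).trans (if_pos h), if_pos h]
  · rw [(koszulChains_shiftPieces s 𝓜 i j).trans (if_neg h), if_neg h, finrank_bot]

theorem gradedBetti_shiftPieces [Module (MvPolynomial (Fin n) k) M]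
    [IsScalarTower k (MvPolynomial (Fin n) k) M] (s : ℕ) (𝓜 : ℕ → Submodule k M) (i j : ℕ) :
    gradedBetti (n := n) (shiftPieces s 𝓜) i j =
      if s ≤ j then gradedBetti (n := n) 𝓜 i (j - s) else 0 := by
  unfold gradedBetti koszulCycles koszulBoundaries
  by_cases h : s ≤ j
  · have h' : ∀ i, koszulChains (n := n) (shiftPieces s 𝓜) i j = koszulChains 𝓜 i (j - s) :=
      fun i => (koszulChains_shiftPieces s 𝓜 i j).trans (if_pos h)
    rw [h', h', if_pos h]
  · have h' : ∀ i, koszulChains (n := n) (shiftPieces s 𝓜) i j = ⊥ :=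
      fun i => (koszulChains_shiftPieces s 𝓜 i j).trans (if_neg h)
    rw [h', h', if_neg h, bot_inf_eq]
    exact Module.finrank_zero_of_subsingleton

end Shift

section CoefQuotient

variable {k : Type*} [Field k] {n : ℕ} {F : ℕ → Ideal (MvPolynomial (Fin n) k)} {hF : Monotone F}

/-- A quotient of `B = A[z]` as a module over `A`. -/
abbrev baseModule (I : Ideal (MvPolynomial (Fin (n + 1)) k)) :
    Module (MvPolynomial (Fin n) k) (MvPolynomial (Fin (n + 1)) k ⧸ I) :=
  Module.compHom _ (rename (R := k) Fin.succ).toRingHom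

attribute [local instance] baseModule

/-- The scalar multiplication of `baseModule`. As an instance of its own, it spares the search for a
scalar multiplication a detour through algebra structures. -/
abbrev baseSMul (I : Ideal (MvPolynomial (Fin (n + 1)) k)) :
    SMul (MvPolynomial (Fin n) k) (MvPolynomial (Fin (n + 1)) k ⧸ I) :=
  (baseModule I).toSMul

attribute [local instance] baseSMul

theorem smul_mk (I : Ideal (MvPolynomial (Fin (n + 1)) k)) (a : MvPolynomial (Fin n) k)
    (p : MvPolynomial (Fin (n + 1)) k) :
    a • Ideal.Quotient.mk I p = Ideal.Quotient.mk I (rename Fin.succ a * p) := rfl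

instance isScalarTower_baseModule (I : Ideal (MvPolynomial (Fin (n + 1)) k)) :
    IsScalarTower k (MvPolynomial (Fin n) k) (MvPolynomial (Fin (n + 1)) k ⧸ I) where
  smul_assoc c a m := by
    obtain ⟨p, rfl⟩ := Ideal.Quotient.mk_surjective m
    rw [smul_mk, smul_mk, map_smul, smul_mul_assoc]
    rfl

variable (F hF) in
/-- The map `A/F_i → B/⨁_i F_i z^i`, `a ↦ a z^i`. -/
def coefIncl (i : ℕ) : (MvPolynomial (Fin n) k ⧸ F i) →ₗ[MvPolynomial (Fin n) k]
    (MvPolynomial (Fin (n + 1)) k ⧸ coefIdeal F hF) :=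
  Submodule.liftQ (F i)
    { toFun := fun a => Ideal.Quotient.mk _ (rename Fin.succ a * X 0 ^ i)
      map_add' := fun a b => by rw [map_add, add_mul, map_add]
      map_smul' := fun a b => by
        rw [RingHom.id_apply, smul_mk, smul_eq_mul, map_mul (rename Fin.succ), mul_assoc] }
    fun a ha => Ideal.Quotient.eq_zero_iff_mem.mpr (rename_mul_X_pow_mem_coefIdeal.mpr ha)

theorem coefIncl_mk (i : ℕ) (a : MvPolynomial (Fin n) k) :
    coefIncl F hF i (Ideal.Quotient.mk _ a) =
      Ideal.Quotient.mk _ (rename Fin.succ a * X 0 ^ i) := rfl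

variable (F hF) in
/-- The coefficient of `z^i`, as a map `B/⨁_i F_i z^i → A/F_i`. -/
def coefProj (i : ℕ) : (MvPolynomial (Fin (n + 1)) k ⧸ coefIdeal F hF) →ₗ[MvPolynomial (Fin n) k]
    (MvPolynomial (Fin n) k ⧸ F i) where
  toFun m := Quotient.liftOn' m (fun p => Ideal.Quotient.mk (F i) (zCoeff i p)) fun p q h => by
    have h' : p - q ∈ coefIdeal F hF := (Submodule.quotientRel_def _).mp h
    rw [Ideal.Quotient.eq, ← map_sub]
    exact h' i
  map_add' m m' := by
    obtain ⟨p, rfl⟩ := Ideal.Quotient.mk_surjective m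
    obtain ⟨q, rfl⟩ := Ideal.Quotient.mk_surjective m'
    change Ideal.Quotient.mk (F i) (zCoeff i (p + q)) = _
    rw [map_add, map_add]
    rfl
  map_smul' a m := by
    obtain ⟨p, rfl⟩ := Ideal.Quotient.mk_surjective m
    change Ideal.Quotient.mk (F i) (zCoeff i (rename Fin.succ a * p)) = _
    rw [zCoeff_rename_mul]
    rfl

theorem coefProj_mk (i : ℕ) (p : MvPolynomial (Fin (n + 1)) k) :
    coefProj F hF i (Ideal.Quotient.mk _ p) = Ideal.Quotient.mk _ (zCoeff i p) := rfl

theorem coefProj_coefIncl (i : ℕ) (m : MvPolynomial (Fin n) k ⧸ F i) :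
    coefProj F hF i (coefIncl F hF i m) = m := by
  obtain ⟨a, rfl⟩ := Ideal.Quotient.mk_surjective m
  rw [coefIncl_mk, coefProj_mk, zCoeff_rename_mul_X_pow, if_pos rfl]

theorem coefIncl_mem (s d : ℕ) {m : MvPolynomial (Fin n) k ⧸ F s}
    (hm : m ∈ shiftPieces s (component k n (MvPolynomial (Fin n) k ⧸ F s)) d) :
    coefIncl F hF s m ∈
      component k (n + 1) (MvPolynomial (Fin (n + 1)) k ⧸ coefIdeal F hF) d := by
  unfold shiftPieces at hm
  split_ifs at hm with hs
  · obtain ⟨a, ha, rfl⟩ := hm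
    refine ⟨rename Fin.succ a * X 0 ^ s, ?_, rfl⟩
    have := (IsHomogeneous.rename_isHomogeneous (f := Fin.succ) ha).mul
      (isHomogeneous_X_pow (R := k) (0 : Fin (n + 1)) s)
    rwa [Nat.sub_add_cancel hs] at this
  · rw [(Submodule.mem_bot k).mp hm, map_zero]
    exact zero_mem _

theorem coefProj_mem (s d : ℕ) {m : MvPolynomial (Fin (n + 1)) k ⧸ coefIdeal F hF}
    (hm : m ∈ component k (n + 1) (MvPolynomial (Fin (n + 1)) k ⧸ coefIdeal F hF) d) :
    coefProj F hF s m ∈ shiftPieces s (component k n (MvPolynomial (Fin n) k ⧸ F s)) d := by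
  obtain ⟨p, hp, rfl⟩ := hm
  have h := isHomogeneous_iff_zCoeff.mp hp
  change Ideal.Quotient.mk _ (zCoeff s p) ∈ _
  unfold shiftPieces
  split_ifs with hs
  · exact ⟨zCoeff s p, h.1 s hs, rfl⟩
  · rw [h.2 s (by omega), map_zero]
    exact zero_mem _

theorem exists_zCoeff_eq_succ (p : MvPolynomial (Fin (n + 1)) k) :
    ∃ q : MvPolynomial (Fin (n + 1)) k, ∀ i, zCoeff i q = zCoeff (i + 1) p := by
  refine ⟨(finSuccEquiv k n).symm (finSuccEquiv k n p).divX, fun i => ?_⟩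
  rw [zCoeff_apply, AlgEquiv.apply_symm_apply, Polynomial.coeff_divX, zCoeff_apply]

theorem zMul_mk (I : Ideal (MvPolynomial (Fin (n + 1)) k)) (p : MvPolynomial (Fin (n + 1)) k) :
    zMul k n (MvPolynomial (Fin (n + 1)) k ⧸ I) (Ideal.Quotient.mk I p) =
      Ideal.Quotient.mk I (X 0 * p) := rfl

theorem exists_zMul_mk_eq (d : ℕ) {m : MvPolynomial (Fin (n + 1)) k ⧸ coefIdeal F hF}
    (hm : m ∈ component k (n + 1) (MvPolynomial (Fin (n + 1)) k ⧸ coefIdeal F hF) (d + 1))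
    (h : coefProj F hF 0 m = 0) :
    ∃ m' ∈ component k (n + 1) (MvPolynomial (Fin (n + 1)) k ⧸ coefIdeal F hF) d,
      zMul k n _ m' = m := by
  obtain ⟨p, hp, rfl⟩ := hm
  have h' := isHomogeneous_iff_zCoeff.mp hp
  have h0 : zCoeff 0 p ∈ F 0 := Ideal.Quotient.eq_zero_iff_mem.mp h
  obtain ⟨q, hq⟩ := exists_zCoeff_eq_succ p
  refine ⟨Ideal.Quotient.mk _ q, ⟨q, isHomogeneous_iff_zCoeff.mpr ⟨fun i hi => ?_, fun i hi => ?_⟩,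
    rfl⟩, ?_⟩
  · rw [hq]
    have := h'.1 (i + 1) (by omega)
    rwa [Nat.add_sub_add_right] at this
  · rw [hq]
    exact h'.2 _ (by omega)
  · refine Ideal.Quotient.eq.mpr fun i => ?_
    change zCoeff i (X 0 * q - p) ∈ F i
    rw [map_sub]
    cases i with
    | zero =>
      rw [zCoeff_zero_X_zero_mul, zero_sub]
      exact neg_mem h0
    | succ i =>
      rw [zCoeff_X_zero_mul, hq, sub_self]
      exact zero_mem _

theorem mk_eq_zero_of_coefProj {m : MvPolynomial (Fin (n + 1)) k ⧸ coefIdeal F hF}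
    (hm : m ∈ component k (n + 1) (MvPolynomial (Fin (n + 1)) k ⧸ coefIdeal F hF) 0)
    (h : coefProj F hF 0 m = 0) : m = 0 := by
  obtain ⟨p, hp, rfl⟩ := hm
  have h' := isHomogeneous_iff_zCoeff.mp hp
  have h0 : zCoeff 0 p ∈ F 0 := Ideal.Quotient.eq_zero_iff_mem.mp h
  refine Ideal.Quotient.eq_zero_iff_mem.mpr fun i => ?_
  change zCoeff i p ∈ F i
  cases i with
  | zero => exact h0
  | succ i =>
    rw [h'.2 _ (Nat.succ_pos i)]
    exact zero_mem _

variable (F hF) in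
theorem isGradedPieces_coefIdeal :
    IsGradedPieces (n + 1)
      (component k (n + 1) (MvPolynomial (Fin (n + 1)) k ⧸ coefIdeal F hF)) :=
  isGradedPieces_component (k := k) (n := n + 1) _

/-- `B/⨁_i F_i z^i` is the direct sum of `A/F_0` and of its multiples of `z`. -/
theorem zSplitting_coefIdeal {Q : Type*} [AddCommGroup Q] [Module k Q]
    [Module (MvPolynomial (Fin n) k) Q] [IsScalarTower k (MvPolynomial (Fin n) k) Q]
    {𝓠 : ℕ → Submodule k Q}
    {σ : Q →ₗ[MvPolynomial (Fin n) k] MvPolynomial (Fin (n + 1)) k ⧸ coefIdeal F hF}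
    {τ : (MvPolynomial (Fin (n + 1)) k ⧸ coefIdeal F hF) →ₗ[MvPolynomial (Fin n) k] Q}
    (τ_σ : ∀ q, τ (σ q) = q)
    (σ_mem : ∀ d, ∀ q ∈ 𝓠 d,
      σ q ∈ component k (n + 1) (MvPolynomial (Fin (n + 1)) k ⧸ coefIdeal F hF) d)
    (τ_mem : ∀ d,
      ∀ m ∈ component k (n + 1) (MvPolynomial (Fin (n + 1)) k ⧸ coefIdeal F hF) d, τ m ∈ 𝓠 d)
    (z_σ : ∀ q, zMul k n _ (σ q) = 0)
    (hX : ∀ p, (∀ i, zCoeff i p ∈ F (i + 1)) → τ (Ideal.Quotient.mk _ p) = 0 →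
      ∀ (l : Fin n) (i : ℕ), X l * zCoeff i p ∈ F i) :
    ZSplitting (component k (n + 1) (MvPolynomial (Fin (n + 1)) k ⧸ coefIdeal F hF))
      (component k n (MvPolynomial (Fin n) k ⧸ F 0)) 𝓠
      (coefIncl F hF 0) (coefProj F hF 0) σ τ := by
  have smul : ∀ (l : Fin n) (m : MvPolynomial (Fin (n + 1)) k ⧸ coefIdeal F hF),
      (X l.succ : MvPolynomial (Fin (n + 1)) k) • m = (X l : MvPolynomial (Fin n) k) • m := by
    intro l m
    obtain ⟨p, rfl⟩ := Ideal.Quotient.mk_surjective m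
    rw [smul_mk, rename_X]
    rfl
  refine ⟨smul, fun d l m hm => smul l m ▸ isGradedPieces_coefIdeal F hF d l.succ m hm,
    coefProj_coefIncl 0, τ_σ, fun d _ => coefIncl_mem 0 d, fun d _ => coefProj_mem 0 d, σ_mem,
    τ_mem, fun d m hm => isGradedPieces_coefIdeal F hF d 0 m hm, ?_, z_σ,
    fun _ hm h => mk_eq_zero_of_coefProj hm h, fun d _ hm h => exists_zMul_mk_eq d hm h, ?_⟩
  · intro m
    obtain ⟨p, rfl⟩ := Ideal.Quotient.mk_surjective m
    rw [zMul_mk, coefProj_mk, zCoeff_zero_X_zero_mul, map_zero]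
  · intro m h h' l
    obtain ⟨p, rfl⟩ := Ideal.Quotient.mk_surjective m
    rw [zMul_mk, Ideal.Quotient.eq_zero_iff_mem] at h
    rw [smul_mk, Ideal.Quotient.eq_zero_iff_mem]
    intro i
    rw [zCoeff_rename_mul]
    refine hX p (fun i => ?_) h' l i
    have := h (i + 1)
    rwa [zCoeff_X_zero_mul] at this

/-- The splitting for `t = s + 1`: the kernel of `z` on `B/⨁_i F_i z^i` contains
`(A/F_s) z^s`. -/
theorem zSplitting_of_finite {s : ℕ} (htop : ∀ i, s < i → F i = ⊤)
    (hst : ∀ i < s, ∀ l, ∀ a ∈ F (i + 1), X l * a ∈ F i) :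
    ZSplitting (component k (n + 1) (MvPolynomial (Fin (n + 1)) k ⧸ coefIdeal F hF))
      (component k n (MvPolynomial (Fin n) k ⧸ F 0))
      (shiftPieces s (component k n (MvPolynomial (Fin n) k ⧸ F s)))
      (coefIncl F hF 0) (coefProj F hF 0) (coefIncl F hF s) (coefProj F hF s) := by
  refine zSplitting_coefIdeal (coefProj_coefIncl s) (fun d _ => coefIncl_mem s d)
    (fun d _ => coefProj_mem s d) (fun q => ?_) fun p h h' l i => ?_
  · obtain ⟨a, rfl⟩ := Ideal.Quotient.mk_surjective q
    rw [coefIncl_mk, zMul_mk, Ideal.Quotient.eq_zero_iff_mem, mul_left_comm, ← pow_succ',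
      rename_mul_X_pow_mem_coefIdeal, htop _ (Nat.lt_succ_self s)]
    trivial
  · rw [coefProj_mk, Ideal.Quotient.eq_zero_iff_mem] at h'
    rcases lt_trichotomy i s with hi | rfl | hi
    · exact hst i hi l _ (h i)
    · exact (F i).mul_mem_left _ h'
    · rw [htop i hi]
      trivial

/-- The splitting for `t = ∞`, where the variables of `A` kill the whole kernel of `z`. -/
theorem zSplitting_of_infinite (s : ℕ) (hst : ∀ i, ∀ l, ∀ a ∈ F (i + 1), X l * a ∈ F i) :
    ZSplitting (component k (n + 1) (MvPolynomial (Fin (n + 1)) k ⧸ coefIdeal F hF))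
      (component k n (MvPolynomial (Fin n) k ⧸ F 0))
      (shiftPieces s (component k n
        (MvPolynomial (Fin n) k ⧸ (⊤ : Ideal (MvPolynomial (Fin n) k)))))
      (coefIncl F hF 0) (coefProj F hF 0) 0 0 := by
  have hsub : Subsingleton (MvPolynomial (Fin n) k ⧸ (⊤ : Ideal (MvPolynomial (Fin n) k))) :=
    Ideal.Quotient.subsingleton_iff.mpr rfl
  exact zSplitting_coefIdeal (fun _ => Subsingleton.elim _ _) (fun _ _ _ => zero_mem _)
    (fun _ _ _ => zero_mem _) (fun q => by rw [LinearMap.zero_apply, map_zero])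
    fun p h _ l i => hst i l _ (h i)

/-- The Betti numbers of a module with a splitting, in terms of those of `P` and `Q` and of
dimensions only. -/
theorem ZSplitting.gradedBetti_add {M P Q : Type*} [AddCommGroup M] [AddCommGroup P]
    [AddCommGroup Q] [Module k M] [Module k P] [Module k Q]
    [Module (MvPolynomial (Fin (n + 1)) k) M] [IsScalarTower k (MvPolynomial (Fin (n + 1)) k) M]
    [Module (MvPolynomial (Fin n) k) M] [IsScalarTower k (MvPolynomial (Fin n) k) M]
    [Module (MvPolynomial (Fin n) k) P] [IsScalarTower k (MvPolynomial (Fin n) k) P]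
    [Module (MvPolynomial (Fin n) k) Q] [IsScalarTower k (MvPolynomial (Fin n) k) Q]
    {𝓜 : ℕ → Submodule k M} {𝓟 : ℕ → Submodule k P} {𝓠 : ℕ → Submodule k Q}
    {ι : P →ₗ[MvPolynomial (Fin n) k] M} {π : M →ₗ[MvPolynomial (Fin n) k] P}
    {σ : Q →ₗ[MvPolynomial (Fin n) k] M} {τ : M →ₗ[MvPolynomial (Fin n) k] Q}
    (h : ZSplitting 𝓜 𝓟 𝓠 ι π σ τ) [∀ d, Module.Finite k (𝓜 d)]
    [∀ d, Module.Finite k (𝓟 d)] [∀ d, Module.Finite k (𝓠 d)] {i j : ℕ} (hij : i ≤ j) :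
    gradedBetti (n := n + 1) 𝓜 (i + 1) (j + 1) + finrank k (koszulChains (n := n) 𝓠 i j) +
        n.choose i * finrank k (𝓜 (j - i + 1)) =
      gradedBetti (n := n) 𝓟 (i + 1) (j + 1) + finrank k (koszulChains (n := n) 𝓟 i (j + 1)) +
        gradedBetti (n := n) 𝓠 i j + n.choose i * finrank k (𝓜 (j - i)) := by
  have : ∀ d, Module.Finite k (socle n 𝓜 τ d) := fun d =>
    Submodule.finiteDimensional_of_le (inf_le_left : _ ≤ 𝓜 d)
  rw [h.gradedBetti_eq, finrank_koszulChains hij, finrank_koszulChains hij,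
    finrank_koszulChains (show i ≤ j + 1 by omega), show j + 1 - i = j - i + 1 by omega]
  have := congrArg (n.choose i * ·) (h.finrank_socle (j - i))
  simp only [mul_add] at this
  omega

end CoefQuotient

/-! ### Generators of cyclic modules -/

section HomologicalDegreeZero

variable {k : Type*} [Field k] {n : ℕ}

theorem homogeneousComponent_X_mul (d : ℕ) (l : Fin n) (q : MvPolynomial (Fin n) k) :
    homogeneousComponent (d + 1) (X l * q) = X l * homogeneousComponent d q := by
  classical
  ext m
  rw [coeff_homogeneousComponent, coeff_X_mul', coeff_X_mul', coeff_homogeneousComponent]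
  by_cases hl : l ∈ m.support
  · rw [if_pos hl, if_pos hl]
    have hle : Finsupp.single l 1 ≤ m := by
      rw [Finsupp.single_le_iff]
      exact Nat.one_le_iff_ne_zero.mpr (Finsupp.mem_support_iff.mp hl)
    have hdeg : m.degree = (m - Finsupp.single l 1).degree + 1 := by
      conv_lhs => rw [← tsub_add_cancel_of_le hle]
      rw [map_add, Finsupp.degree_single]
    simp only [hdeg, Nat.add_right_cancel_iff]
  · rw [if_neg hl, if_neg hl, ite_self]

theorem koszulD_eq_zero_of_card {M : Type*} [AddCommGroup M] [Module (MvPolynomial (Fin n) k) M]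
    {x : Finset (Fin n) → M} {i : ℕ} (hx : ∀ T : Finset (Fin n), T.card ≠ i + 1 → x T = 0)
    {T : Finset (Fin n)} (hT : T.card ≠ i) : koszulD k n M x T = 0 := by
  rw [koszulD_apply]
  refine Finset.sum_eq_zero fun l hl => ?_
  have hc := Finset.card_insert_of_notMem (Finset.mem_compl.mp hl)
  rw [hx _ (by omega), smul_zero, smul_zero]

theorem koszulD_homogeneousComponent (d : ℕ) (x : Finset (Fin n) → MvPolynomial (Fin n) k) :
    koszulD k n _ (fun T => homogeneousComponent d (x T)) =
      fun T => homogeneousComponent (d + 1) (koszulD k n _ x T) := by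
  funext T
  simp only [koszulD_apply, map_sum, map_zsmul, smul_eq_mul, homogeneousComponent_X_mul]

/-- The cyclic module `A/I` has its only minimal generator in degree `0`. -/
theorem bettiCyclic_zero_succ (I : Ideal (MvPolynomial (Fin n) k)) (j : ℕ) :
    bettiCyclic I 0 (j + 1) = 0 := by
  have hle : koszulCycles (n := n) (component k n (MvPolynomial (Fin n) k ⧸ I)) 0 (j + 1) ≤
      koszulBoundaries (component k n (MvPolynomial (Fin n) k ⧸ I)) 0 (j + 1) := by
    rintro x ⟨hx, -⟩
    have hx' := mem_koszulChains.mp hx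
    obtain ⟨p, hp, hpx⟩ := (hx' ∅).1 ⟨Finset.card_empty, Nat.zero_le _⟩
    rw [SetLike.mem_coe, mem_homogeneousSubmodule, Nat.sub_zero] at hp
    have hspan : p ∈ Ideal.span (Set.range (X : Fin n → MvPolynomial (Fin n) k)) := by
      rw [← Set.image_univ, mem_ideal_span_X_image]
      intro m hm
      have hdeg : m.degree = j + 1 := by
        by_contra h
        exact mem_support_iff.mp hm (hp.coeff_eq_zero h)
      by_contra! h
      have : m = 0 := Finsupp.ext fun l => h l trivial
      rw [this, map_zero] at hdeg
      omega
    obtain ⟨g, hg, hgp⟩ := (koszul_augmentation p).mp hspan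
    let f : MvPolynomial (Fin n) k →ₗ[MvPolynomial (Fin n) k] (MvPolynomial (Fin n) k ⧸ I) :=
      (Ideal.Quotient.mkₐ (MvPolynomial (Fin n) k) I).toLinearMap
    refine ⟨fun T => f (homogeneousComponent j (g T)), ?_, ?_⟩
    · refine mem_koszulChains.mpr fun T => ⟨fun _ => ?_, fun hT => ?_⟩
      · exact ⟨_, homogeneousComponent_mem _ _, rfl⟩
      · rw [hg T fun h => hT ⟨h, by omega⟩, map_zero, map_zero]
    · change koszulD k n _ (fun T => f (homogeneousComponent j (g T))) = x
      rw [koszulD_comp f, koszulD_homogeneousComponent]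
      funext T
      by_cases hT : T.card = 0
      · obtain rfl := Finset.card_eq_zero.mp hT
        dsimp only
        rw [hgp, homogeneousComponent_of_mem hp, if_pos rfl]
        exact hpx
      · rw [(hx' T).2 fun h => hT h.1]
        dsimp only
        rw [koszulD_eq_zero_of_card hg hT, map_zero, map_zero]
  have : Subsingleton (koszulCycles (n := n)
      (component k n (MvPolynomial (Fin n) k ⧸ I)) 0 (j + 1) ⧸
      (koszulBoundaries (n := n) (component k n (MvPolynomial (Fin n) k ⧸ I)) 0 (j + 1)).submoduleOf
        (koszulCycles (component k n (MvPolynomial (Fin n) k ⧸ I)) 0 (j + 1))) := by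
    rw [Submodule.Quotient.subsingleton_iff, Submodule.submoduleOf_eq_top]
    exact hle
  exact Module.finrank_zero_of_subsingleton

theorem bettiCyclic_zero_zero (I : Ideal (MvPolynomial (Fin n) k)) :
    bettiCyclic I 0 0 = finrank k (component k n (MvPolynomial (Fin n) k ⧸ I) 0) := by
  have h := gradedBetti_add_koszulRank
    (isGradedPieces_component (k := k) (n := n) (MvPolynomial (Fin n) k ⧸ I)) 0 0
  have h1 : koszulRank n (component k n (MvPolynomial (Fin n) k ⧸ I)) (0 + 1) 0 = 0 := by
    rw [koszulRank, koszulChains_eq_bot (by omega), Submodule.map_bot, finrank_bot]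
  have h0 : koszulRank n (component k n (MvPolynomial (Fin n) k ⧸ I)) 0 0 = 0 := by
    refine (congrArg (fun U : Submodule k _ => finrank k U) ((Submodule.eq_bot_iff _).mpr ?_)).trans
      (finrank_bot k _)
    rintro _ ⟨x, hx, rfl⟩
    refine funext fun T => ?_
    change koszulD k n _ x T = 0
    rw [koszulD_apply]
    refine Finset.sum_eq_zero fun l hl => ?_
    rw [(mem_koszulChains.mp hx _).2, smul_zero, smul_zero]
    rw [Finset.card_insert_of_notMem (Finset.mem_compl.mp hl)]
    omega
  rw [h1, h0, finrank_koszulChains le_rfl, Nat.choose_zero_right, one_mul] at h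
  exact h

theorem bettiCyclic_eq_zero_of_lt (I : Ideal (MvPolynomial (Fin n) k)) {i j : ℕ} (h : j < i) :
    bettiCyclic I i j = 0 := by
  rw [bettiCyclic, gradedBetti, koszulCycles, koszulChains_eq_bot h, bot_inf_eq]
  exact Module.finrank_zero_of_subsingleton

end HomologicalDegreeZero

/-! ### Comparison of Betti numbers -/

section Comparison

variable {k : Type*} [Field k] {n : ℕ}

theorem finrank_koszulChains_congr {M M' : Type*} [AddCommGroup M] [Module k M] [AddCommGroup M']
    [Module k M'] {𝓜 : ℕ → Submodule k M} {𝓜' : ℕ → Submodule k M'} [∀ d, Module.Finite k (𝓜 d)]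
    [∀ d, Module.Finite k (𝓜' d)] (h : ∀ d, finrank k (𝓜 d) = finrank k (𝓜' d)) (i j : ℕ) :
    finrank k (koszulChains (n := n) 𝓜 i j) = finrank k (koszulChains (n := n) 𝓜' i j) := by
  by_cases hij : i ≤ j
  · rw [finrank_koszulChains hij, finrank_koszulChains hij, h]
  · rw [koszulChains_eq_bot (by omega), koszulChains_eq_bot (by omega), finrank_bot, finrank_bot]

variable {𝔞 : Ideal (MvPolynomial (Fin n) k)}

theorem finrank_component_congr {I I' : Ideal (MvPolynomial (Fin n) k ⧸ 𝔞)} (h : hilb I = hilb I')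
    (d : ℕ) :
    finrank k (component k n
        (MvPolynomial (Fin n) k ⧸ I.comap (Ideal.Quotient.mk 𝔞)) d) =
      finrank k (component k n
        (MvPolynomial (Fin n) k ⧸ I'.comap (Ideal.Quotient.mk 𝔞)) d) := by
  have h1 := finrank_component_quotient (I.comap (Ideal.Quotient.mk 𝔞)) d
  have h2 := finrank_component_quotient (I'.comap (Ideal.Quotient.mk 𝔞)) d
  have h3 := hilb_add I d
  have h4 := hilb_add I' d
  rw [h] at h3
  omega

variable {εR : hilbPoset 𝔞 ↪o HomogIdeal 𝔞}

/-- Passing from `I` to `ε_R(H)`, where `H` is larger than the Hilbert series of `I`, the Betti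
number `β_{i,j}` drops by at most the loss of dimension of the Koszul chains. -/
theorem bettiCyclic_add_le_of_hilb_le (hεR : IsSection εR)
    (hβ : ∀ (I : HomogIdeal 𝔞) (i j : ℕ),
      bettiQuot I.1 i j ≤ bettiQuot (εR ⟨hilb I.1, I, rfl⟩).1 i j)
    (I : HomogIdeal 𝔞) {H : hilbPoset 𝔞} (h : hilb I.1 ≤ H.1) (i j : ℕ) :
    bettiCyclic (I.1.comap (Ideal.Quotient.mk 𝔞)) i j + finrank k (koszulChains (n := n)
        (component k n (MvPolynomial (Fin n) k ⧸ epsIdeal εR H)) i j) ≤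
      bettiCyclic (epsIdeal εR H) i j + finrank k (koszulChains (n := n)
        (component k n (MvPolynomial (Fin n) k ⧸ I.1.comap (Ideal.Quotient.mk 𝔞))) i j) := by
  have h1 := hβ I i j
  rw [bettiQuot_eq, bettiQuot_eq] at h1
  have h2 := bettiCyclic_add_le (epsIdeal_mono εR (H := ⟨hilb I.1, I, rfl⟩) h) i j
  have h3 := finrank_koszulChains_congr (n := n)
    (finrank_component_congr (hεR ⟨hilb I.1, I, rfl⟩)) i j
  unfold epsIdeal at h2 ⊢
  omega

/-- Passing from `I` to `ε_R(H)`, where `H` is smaller than the Hilbert series of `I`, the Betti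
number `β_{i+1,j}` drops by at most the gain of dimension of the Koszul chains of homological
degree `i`. -/
theorem bettiCyclic_succ_add_le_of_le_hilb (hεR : IsSection εR)
    (hβ : ∀ (I : HomogIdeal 𝔞) (i j : ℕ),
      bettiQuot I.1 i j ≤ bettiQuot (εR ⟨hilb I.1, I, rfl⟩).1 i j)
    (I : HomogIdeal 𝔞) {H : hilbPoset 𝔞} (h : H.1 ≤ hilb I.1) (i j : ℕ) :
    bettiCyclic (I.1.comap (Ideal.Quotient.mk 𝔞)) (i + 1) j + finrank k (koszulChains (n := n)
        (component k n (MvPolynomial (Fin n) k ⧸ I.1.comap (Ideal.Quotient.mk 𝔞))) i j) ≤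
      bettiCyclic (epsIdeal εR H) (i + 1) j + finrank k (koszulChains (n := n)
        (component k n (MvPolynomial (Fin n) k ⧸ epsIdeal εR H)) i j) := by
  have h1 := hβ I (i + 1) j
  rw [bettiQuot_eq, bettiQuot_eq] at h1
  have h2 := bettiCyclic_succ_add_le (epsIdeal_mono εR (H' := ⟨hilb I.1, I, rfl⟩) h) i j
  have h3 := finrank_koszulChains_congr (n := n)
    (finrank_component_congr (hεR ⟨hilb I.1, I, rfl⟩)) i j
  unfold epsIdeal at h2 ⊢
  omega

variable {t : ℕ∞}

/-- The preimage in `A` of the last slice `J_⟨t-1⟩`, and `A` itself if `t = ∞`. -/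
def lastSlice (J : Ideal (ExtRing 𝔞 t)) : Ideal (MvPolynomial (Fin n) k) :=
  if t = ⊤ then ⊤ else sliceIdeal J (t.toNat - 1)

attribute [local instance] baseModule baseSMul

/-- The Betti numbers of `S/J` for a `z`-stable ideal `J`: up to terms that only depend on Hilbert
series, they are those of the first and of the (shifted) last slice. -/
theorem ZStable.bettiCyclic_add (ht : 1 ≤ t) {J : Ideal (ExtRing 𝔞 t)} (hJ : ZStable J) {i j : ℕ}
    (hij : i ≤ j) :
    bettiCyclic (J.comap (Ideal.Quotient.mk (extIdeal 𝔞 t))) (i + 1) (j + 1) +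
        finrank k (koszulChains (n := n) (shiftPieces (t.toNat - 1)
          (component k n (MvPolynomial (Fin n) k ⧸ lastSlice J))) i j) +
        n.choose i * finrank k (component k (n + 1) (MvPolynomial (Fin (n + 1)) k ⧸
          J.comap (Ideal.Quotient.mk (extIdeal 𝔞 t))) (j - i + 1)) =
      bettiCyclic (sliceIdeal J 0) (i + 1) (j + 1) +
        finrank k (koszulChains (n := n)
          (component k n (MvPolynomial (Fin n) k ⧸ sliceIdeal J 0)) i (j + 1)) +
        gradedBetti (n := n) (shiftPieces (t.toNat - 1)
          (component k n (MvPolynomial (Fin n) k ⧸ lastSlice J))) i j +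
        n.choose i * finrank k (component k (n + 1) (MvPolynomial (Fin (n + 1)) k ⧸
          J.comap (Ideal.Quotient.mk (extIdeal 𝔞 t))) (j - i)) := by
  rw [comap_eq_coefIdeal hJ.1]
  by_cases h : t = ⊤
  · have hl : lastSlice J = ⊤ := if_pos h
    rw [hl]
    have hz := zSplitting_of_infinite (F := sliceIdeal J) (hF := sliceIdeal_mono J) (t.toNat - 1)
      fun i l a ha => hJ.X_mul_mem (by rw [h]; exact ENat.natCast_lt_top _) l ha
    exact hz.gradedBetti_add hij
  · have hl : lastSlice J = sliceIdeal J (t.toNat - 1) := if_neg h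
    rw [hl]
    have hs : t = ((t.toNat - 1 + 1 : ℕ) : ℕ∞) := by
      obtain ⟨m, rfl⟩ := ENat.ne_top_iff_exists.mp h
      have : 1 ≤ m := by exact_mod_cast ht
      rw [ENat.toNat_natCast, Nat.sub_add_cancel this]
    have hz := zSplitting_of_finite (F := sliceIdeal J) (hF := sliceIdeal_mono J)
      (s := t.toNat - 1) ?_ ?_
    · exact hz.gradedBetti_add hij
    · refine fun i hi => sliceIdeal_eq_top J ?_
      rw [hs]
      exact_mod_cast hi
    · refine fun i hi l a ha => hJ.X_mul_mem ?_ l ha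
      rw [hs]
      exact_mod_cast Nat.succ_lt_succ hi

theorem isHomog_comap_slice {J : Ideal (ExtRing 𝔞 t)} (hJ : Multigraded J) (i : ℕ) :
    IsHomog ((slice J i).comap (Ideal.Quotient.mk 𝔞)) := isHomog_sliceIdeal hJ i

variable {εS : stabHilbPoset 𝔞 t ↪o HomogIdeal (extIdeal 𝔞 t)}

theorem IsInduced.exists_epsIdeal_eq (hεR : IsSection εR) (hS : IsInduced εR εS)
    (H : stabHilbPoset 𝔞 t) {i : ℕ} (hi : (i : ℕ∞) < t) :
    ∃ H' : hilbPoset 𝔞,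
      epsIdeal εR H' = sliceIdeal (εS H).1 i ∧ H'.1 = hilb (slice (εS H).1 i) := by
  obtain ⟨H', h⟩ := hS.slice_mem_range H i hi
  exact ⟨H', by rw [epsIdeal, h, sliceIdeal], by rw [← h, hεR]⟩

theorem IsInduced.hilb_slice_zero_le (hS : IsInduced εR εS) (ht : 1 ≤ t)
    {J : Ideal (ExtRing 𝔞 t)} (hJ : ZStable J) :
    hilb (slice (εS (stabHilb J hJ)).1 0) ≤ hilb (slice J 0) := by
  intro d
  have h0 : ((0 : ℕ) : ℕ∞) < t := lt_of_lt_of_le zero_lt_one ht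
  have := hS.sum_sliceDim_le hJ (D := d) (s := 1) (by omega)
  simpa only [Finset.sum_range_one, sliceDim, if_pos h0, Nat.sub_zero] using this

theorem IsInduced.hilb_last_slice_le (hS : IsInduced εR εS) {s : ℕ} (hs : t = ((s + 1 : ℕ) : ℕ∞))
    {J : Ideal (ExtRing 𝔞 t)} (hJ : ZStable J) :
    hilb (slice J s) ≤ hilb (slice (εS (stabHilb J hJ)).1 s) := by
  intro e
  have hst : (s : ℕ∞) < t := by
    rw [hs]
    exact_mod_cast Nat.lt_succ_self s
  have hL := hS.zStable (stabHilb J hJ)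
  have key : ∀ I : Ideal (ExtRing 𝔞 t), Multigraded I →
      ∑ i ∈ Finset.range s, sliceDim I (s + e) i + hilb (slice I s) e = hilb I (s + e) := by
    intro I hI
    rw [← sum_sliceDim hI, ← Finset.sum_range_add_sum_Ico _ (show s + 1 ≤ s + e + 1 by omega),
      Finset.sum_eq_zero (s := Finset.Ico (s + 1) (s + e + 1)), add_zero, Finset.sum_range_succ]
    · congr 1
      rw [sliceDim, if_pos hst, Nat.add_sub_cancel_left]
    · intro i hi
      refine sliceDim_eq_zero I _ ?_
      rw [hs]
      exact_mod_cast (Finset.mem_Ico.mp hi).1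
  have h1 := key _ hL.1
  have h2 := key J hJ.1
  have h3 := hS.sum_sliceDim_le hJ (D := s + e) (s := s) (by omega)
  have h4 : hilb (εS (stabHilb J hJ)).1 = hilb J := hS.isSection _
  rw [h4] at h1
  have : hilb (slice J s) e ≤ hilb (slice (εS (stabHilb J hJ)).1 s) e := by omega
  exact this

/-- The comparison of the last slices of `J` and of `ε_S(H_J)`. -/
theorem IsInduced.gradedBetti_lastSlice_le (hεR : IsSection εR)
    (hβ : ∀ (I : HomogIdeal 𝔞) (i j : ℕ),
      bettiQuot I.1 i j ≤ bettiQuot (εR ⟨hilb I.1, I, rfl⟩).1 i j)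
    (ht : 1 ≤ t) (hS : IsInduced εR εS) {J : Ideal (ExtRing 𝔞 t)} (hJ : ZStable J) (i j : ℕ) :
    gradedBetti (n := n) (shiftPieces (t.toNat - 1)
        (component k n (MvPolynomial (Fin n) k ⧸ lastSlice J))) i j +
      finrank k (koszulChains (n := n) (shiftPieces (t.toNat - 1)
        (component k n (MvPolynomial (Fin n) k ⧸ lastSlice (εS (stabHilb J hJ)).1))) i j) ≤
    gradedBetti (n := n) (shiftPieces (t.toNat - 1)
        (component k n (MvPolynomial (Fin n) k ⧸ lastSlice (εS (stabHilb J hJ)).1))) i j +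
      finrank k (koszulChains (n := n) (shiftPieces (t.toNat - 1)
        (component k n (MvPolynomial (Fin n) k ⧸ lastSlice J))) i j) := by
  by_cases h : t = ⊤
  · have hc : ∀ I : Ideal (ExtRing 𝔞 t), lastSlice I = ⊤ := fun I => if_pos h
    rw [hc, hc]
  · have hc : ∀ I : Ideal (ExtRing 𝔞 t), lastSlice I = sliceIdeal I (t.toNat - 1) :=
      fun I => if_neg h
    rw [hc, hc, gradedBetti_shiftPieces, gradedBetti_shiftPieces,
      finrank_koszulChains_shiftPieces, finrank_koszulChains_shiftPieces]
    split_ifs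
    · have hs : t = ((t.toNat - 1 + 1 : ℕ) : ℕ∞) := by
        obtain ⟨m, rfl⟩ := ENat.ne_top_iff_exists.mp h
        have : 1 ≤ m := by exact_mod_cast ht
        rw [ENat.toNat_natCast, Nat.sub_add_cancel this]
      have hst : ((t.toNat - 1 : ℕ) : ℕ∞) < t := by
        conv_rhs => rw [hs]
        exact_mod_cast Nat.lt_succ_self _
      obtain ⟨H, hH, hH'⟩ := hS.exists_epsIdeal_eq hεR (stabHilb J hJ) hst
      rw [← hH]
      exact bettiCyclic_add_le_of_hilb_le hεR hβ ⟨slice J _, isHomog_comap_slice hJ.1 _⟩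
        ((hS.hilb_last_slice_le hs hJ).trans_eq hH'.symm) i _
    · exact le_rfl

/-- The Betti numbers of a `z`-stable ideal `J` are at most those of `ε_S(H_J)`. -/
theorem IsInduced.bettiQuot_le (hεR : IsSection εR)
    (hβ : ∀ (I : HomogIdeal 𝔞) (i j : ℕ),
      bettiQuot I.1 i j ≤ bettiQuot (εR ⟨hilb I.1, I, rfl⟩).1 i j)
    (ht : 1 ≤ t) (hS : IsInduced εR εS) {J : Ideal (ExtRing 𝔞 t)} (hJ : ZStable J) (i j : ℕ) :
    bettiQuot J i j ≤ bettiQuot (εS (stabHilb J hJ)).1 i j := by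
  have hL := hS.zStable (stabHilb J hJ)
  have hdim := finrank_component_congr
    (show hilb J = hilb (εS (stabHilb J hJ)).1 from (hS.isSection (stabHilb J hJ)).symm)
  rw [bettiQuot_eq, bettiQuot_eq]
  rcases i with _ | i
  · rcases j with _ | j
    · rw [bettiCyclic_zero_zero, bettiCyclic_zero_zero, hdim]
    · rw [bettiCyclic_zero_succ, bettiCyclic_zero_succ]
  rcases lt_or_ge j (i + 1) with hij | hij
  · rw [bettiCyclic_eq_zero_of_lt _ hij]
    exact Nat.zero_le _
  obtain ⟨j, rfl⟩ : ∃ j', j = j' + 1 := ⟨j - 1, by omega⟩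
  have h1 := hJ.bettiCyclic_add ht (show i ≤ j by omega)
  have h2 := hL.bettiCyclic_add ht (show i ≤ j by omega)
  have h3 := hS.gradedBetti_lastSlice_le hεR hβ ht hJ i j
  obtain ⟨H, hH, hH'⟩ := hS.exists_epsIdeal_eq hεR (stabHilb J hJ) (i := 0)
    (lt_of_lt_of_le zero_lt_one ht)
  have h4 := bettiCyclic_succ_add_le_of_le_hilb hεR hβ ⟨slice J 0, isHomog_comap_slice hJ.1 0⟩
    (hH'.le.trans (hS.hilb_slice_zero_le ht hJ)) i (j + 1)
  rw [hH] at h4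
  change bettiCyclic (sliceIdeal J 0) _ _ + finrank k (koszulChains (n := n)
    (component k n (MvPolynomial (Fin n) k ⧸ sliceIdeal J 0)) i (j + 1)) ≤ _ at h4
  -- `h3` and `h4` involve exactly the numbers of chains that occur in `h1` and `h2`
  rw [hdim, hdim] at h1
  omega

end Comparison

end PosetEmbedding

end

open PosetEmbedding in
theorem theorem3p1 {k : Type*} [Field k] (n : ℕ) (𝔞 : Ideal (MvPolynomial (Fin n) k))
    (h𝔞 : IsHomog 𝔞) (t : ℕ∞) (ht : 1 ≤ t)
    (εR : hilbPoset 𝔞 ↪o HomogIdeal 𝔞) (hεR : IsSection εR)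
    (hβ : ∀ (I : HomogIdeal 𝔞) (i j : ℕ),
      bettiQuot I.1 i j ≤ bettiQuot (εR ⟨hilb I.1, I, rfl⟩).1 i j) :
    (∃! εS : stabHilbPoset 𝔞 t ↪o HomogIdeal (extIdeal 𝔞 t), IsInduced εR εS) ∧
      ∀ εS : stabHilbPoset 𝔞 t ↪o HomogIdeal (extIdeal 𝔞 t), IsInduced εR εS →
        ∀ (J : Ideal (ExtRing 𝔞 t)) (hJ : ZStable J) (i j : ℕ),
          bettiQuot J i j ≤ bettiQuot (εS (stabHilb J hJ)).1 i j := by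
  obtain ⟨εS, hS⟩ := exists_isInduced h𝔞 hεR ht
  exact ⟨⟨εS, hS, fun εS' hS' => hS'.unique hεR hS⟩,
    fun εS' hS' J hJ i j => hS'.bettiQuot_le hεR hβ ht hJ i j⟩
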